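/- Let $\Omega\subset\mathbb C$ be a Borel set, $\lambda$ Lebesgue measure, and $\mathcal B=\mathcal B(L^2(\Omega,\lambda))$. For $f\in L^\infty(\Omega,\lambda)$ let $M_f\in\mathcal B$ be multiplication by $f$ and $Df(s,t)=\frac{f(s)-f(t)}{s-t}$ $(s\neq t)$, and let $\Lambda(\Omega)=\{f\in L^\infty(\Omega,\lambda): Df\in L^\infty(\Omega\times\Omega,\lambda\otimes\lambda)\}$. With $|\cdot|_2$ the Hilbert--Schmidt norm (equal to $\infty$ for operators that are not Hilbert--Schmidt), put, for $T\in\mathcal B$, $$L(T)=\sup\{|[M_f,T]|_2 : f\in\Lambda(\Omega),\ \|Df\|_\infty\le 1\},\qquad |||T|||=\|T\|+L(T).$$ Let $E\Lambda(\Omega)=\{T\in\mathcal B: L(T)<\infty\}$, a $*$-subalgebra of $\mathcal B$, and let $K\Lambda(\Omega)$ be the two-sided ideal of $E\Lambda(\Omega)$ consisting of the compact operators in $E\Lambda(\Omega)$. For $n\in\mathbb N$ let $n\mathbb D=\{z\in\mathbb C:|z|<n\}$, and for $\Omega_1\subset\Omega$ let $i(\Omega,\Omega_1)(T)=T\oplus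 0$ with respect to $L^2(\Omega)=L^2(\Omega_1)\oplus L^2(\Omega\setminus\Omega_1)$. Then there are self-adjoint projections $P_n\in K\Lambda(\Omega)$ of finite rank such that: (a) $P_n\uparrow I$ (that is, $P_n\le P_{n+1}$ for all $n$ and $P_n\to I$ strongly), and $L(P_n)\to 0$; (b) $P_n\in i(\Omega,\Omega\cap n\mathbb D)\bigl(E\Lambda(\Omega\cap n\mathbb D)\bigr)$ for all $n$, and $[P_n,M_{\chi_{\Omega\cap m\mathbb D}}]=0$ for all $n,m\in\mathbb N$; (c) $(P_n)$ is a bounded approximate unit of $K\Lambda(\Omega)$: $\sup_n|||P_n|||<\infty$, and $|||P_nT-T|||\to0$ and $|||TP_n-T|||\to0$ for every $T\in K\Lambda(\Omega)$; (d) $\bigcup_n P_n\mathcal B(L^2(\Omega,\lambda))P_n$ is a subalgebra of $K\Lambda(\Omega)$ which is dense in $K\Lambda(\Omega)$ in the norm $|||\cdot|||$. -/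

import Mathlib

open MeasureTheory Filter Topology
open scoped ENNReal NNReal InnerProductSpace

noncomputable section

namespace LipAlg

/-! ### The Hilbert-Schmidt norm -/

section HilbertSchmidt

variable {H : Type*} [NormedAddCommGroup H] [InnerProductSpace ℂ H]

/-- The square of the Hilbert-Schmidt norm of a bounded operator, with values in `[0, ∞]`: the
supremum of `∑ ‖T e‖²` over the finite orthonormal families. By `hsSq_eq_tsum` below it is
`∑ i, ‖T (b i)‖²` for every Hilbert basis `b`. -/
def hsSq (T : H →L[ℂ] H) : ℝ≥0∞ :=
  ⨆ (s : Finset H) (_ : Orthonormal ℂ (fun x : s => (x : H))), ∑ x ∈ s, ‖T x‖ₑ ^ 2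

/-- The Hilbert-Schmidt norm `|T|₂ ∈ [0, ∞]`; the value is `∞` if `T` is not Hilbert-Schmidt. -/
def hsNorm (T : H →L[ℂ] H) : ℝ≥0∞ := hsSq T ^ (1 / 2 : ℝ)

/-- Parseval's identity. -/
theorem enorm_sq_eq_tsum {ι : Type*} (b : HilbertBasis ι ℂ H) (x : H) :
    ‖x‖ₑ ^ 2 = ∑' i, ‖⟪b i, x⟫_ℂ‖ₑ ^ 2 := by
  have h := b.hasSum_inner_mul_inner x x
  have h2 : HasSum (fun i => ‖⟪b i, x⟫_ℂ‖ ^ 2) (‖x‖ ^ 2) := by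
    have h3 := (Complex.hasSum_re h)
    have e : ∀ i, (⟪x, b i⟫_ℂ * ⟪b i, x⟫_ℂ).re = ‖⟪b i, x⟫_ℂ‖ ^ 2 := by
      intro i
      rw [← inner_conj_symm x (b i), ← Complex.normSq_eq_conj_mul_self, Complex.ofReal_re,
        Complex.normSq_eq_norm_sq]
    simp only [e] at h3
    have e2 : (⟪x, x⟫_ℂ).re = ‖x‖ ^ 2 := by
      rw [inner_self_eq_norm_sq_to_K]; norm_cast
    rwa [e2] at h3
  have h4 : ∀ y : ℝ, 0 ≤ y → ENNReal.ofReal (y ^ 2) = (ENNReal.ofReal y) ^ 2 :=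
    fun y hy => ENNReal.ofReal_pow hy 2
  rw [← ofReal_norm, ← h4 _ (norm_nonneg _), ← h2.tsum_eq,
    ENNReal.ofReal_tsum_of_nonneg (fun i => by positivity) h2.summable]
  congr 1; ext i
  rw [← ofReal_norm, ← h4 _ (norm_nonneg _)]

/-- Bessel's inequality. -/
theorem bessel_enorm (s : Finset H) (hs : Orthonormal ℂ (fun x : s => (x : H))) (y : H) :
    ∑ x ∈ s, ‖⟪x, y⟫_ℂ‖ₑ ^ 2 ≤ ‖y‖ₑ ^ 2 := by
  have h := hs.sum_inner_products_le y (s := Finset.univ)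
  rw [Finset.univ_eq_attach, Finset.sum_attach s (fun x => ‖⟪x, y⟫_ℂ‖ ^ 2)] at h
  have := ENNReal.ofReal_le_ofReal h
  rw [ENNReal.ofReal_sum_of_nonneg (fun i _ => by positivity)] at this
  simpa [ENNReal.ofReal_pow, ofReal_norm] using this

theorem hsSq_le_of_basis [CompleteSpace H] {ι : Type*} (b : HilbertBasis ι ℂ H) (T : H →L[ℂ] H) :
    hsSq T ≤ ∑' i, ‖(ContinuousLinearMap.adjoint T) (b i)‖ₑ ^ 2 := by
  refine iSup₂_le fun s hs => ?_
  calc ∑ x ∈ s, ‖T x‖ₑ ^ 2 = ∑ x ∈ s, ∑' i, ‖⟪x, (ContinuousLinearMap.adjoint T) (b i)⟫_ℂ‖ₑ ^ 2 := by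
        refine Finset.sum_congr rfl fun x _ => ?_
        rw [enorm_sq_eq_tsum b]
        congr 1; ext i
        rw [ContinuousLinearMap.adjoint_inner_right, ← inner_conj_symm, RCLike.enorm_conj]
    _ = ∑' i, ∑ x ∈ s, ‖⟪x, (ContinuousLinearMap.adjoint T) (b i)⟫_ℂ‖ₑ ^ 2 :=
        (Summable.tsum_finsetSum (fun _ _ => ENNReal.summable)).symm
    _ ≤ _ := ENNReal.tsum_le_tsum fun i => bessel_enorm s hs _

theorem tsum_le_hsSq {ι : Type*} (b : HilbertBasis ι ℂ H) (T : H →L[ℂ] H) :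
    ∑' i, ‖T (b i)‖ₑ ^ 2 ≤ hsSq T := by
  classical
  rw [ENNReal.tsum_eq_iSup_sum]
  refine iSup_le fun t => ?_
  have inj : Function.Injective b := b.orthonormal.linearIndependent.injective
  have hs : Orthonormal ℂ (fun x : t.image b => (x : H)) := by
    have h1 := b.orthonormal.toSubtypeRange
    exact h1.comp (fun x : t.image b => (⟨x, by
      obtain ⟨i, _, hi⟩ := Finset.mem_image.1 x.2; exact ⟨i, hi⟩⟩ : Set.range b))
      (fun x y h => Subtype.ext (congrArg (fun z : Set.range b => (z : H)) h))
  refine le_trans (le_of_eq ?_) (le_iSup₂ (f := fun (s : Finset H)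
    (_ : Orthonormal ℂ (fun x : s => (x : H))) => ∑ x ∈ s, ‖T x‖ₑ ^ 2) (t.image b) hs)
  rw [Finset.sum_image (fun x _ y _ h => inj h)]

theorem hsNorm_neg (T : H →L[ℂ] H) : hsNorm (-T) = hsNorm T := by
  simp [hsNorm, hsSq]

theorem hsNorm_zero : hsNorm (0 : H →L[ℂ] H) = 0 := by
  simp [hsNorm, hsSq]

variable [CompleteSpace H]

theorem hsSq_adjoint_le (T : H →L[ℂ] H) : hsSq (star T) ≤ hsSq T := by
  obtain ⟨w, b, -⟩ := exists_hilbertBasis ℂ H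
  have h := hsSq_le_of_basis b (star T)
  rw [← ContinuousLinearMap.star_eq_adjoint, star_star] at h
  exact h.trans (tsum_le_hsSq b T)

theorem hsSq_star (T : H →L[ℂ] H) : hsSq (star T) = hsSq T :=
  le_antisymm (hsSq_adjoint_le T) (by simpa using hsSq_adjoint_le (star T))

theorem hsSq_eq_tsum {ι : Type*} (b : HilbertBasis ι ℂ H) (T : H →L[ℂ] H) :
    hsSq T = ∑' i, ‖T (b i)‖ₑ ^ 2 := by
  refine le_antisymm ?_ (tsum_le_hsSq b T)
  rw [← hsSq_star T]
  have h := hsSq_le_of_basis b (star T)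
  rwa [← ContinuousLinearMap.star_eq_adjoint, star_star] at h

theorem hsNorm_star (T : H →L[ℂ] H) : hsNorm (star T) = hsNorm T := by
  rw [hsNorm, hsSq_star, hsNorm]


theorem hsNorm_le_iff (T : H →L[ℂ] H) (c : ℝ≥0∞) : hsNorm T ≤ c ↔
    ∀ s : Finset H, Orthonormal ℂ (fun x : s => (x : H)) →
      (∑ x ∈ s, ‖T x‖ₑ ^ (2 : ℝ)) ^ (1 / 2 : ℝ) ≤ c := by
  have e : ∀ a : ℝ≥0∞, a ^ (1 / 2 : ℝ) ≤ c ↔ a ≤ c ^ (2 : ℝ) := fun a => by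
    rw [one_div]; exact ENNReal.rpow_inv_le_iff (by norm_num)
  simp only [hsNorm, e, hsSq, iSup_le_iff, ENNReal.rpow_ofNat]

theorem hsNorm_add_le (S T : H →L[ℂ] H) : hsNorm (S + T) ≤ hsNorm S + hsNorm T := by
  rw [hsNorm_le_iff]
  intro s hs
  refine le_trans ?_ (add_le_add ((hsNorm_le_iff S _).1 le_rfl s hs)
    ((hsNorm_le_iff T _).1 le_rfl s hs))
  refine le_trans ?_ (ENNReal.Lp_add_le s (fun x => ‖S x‖ₑ) (fun x => ‖T x‖ₑ) (by norm_num))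
  gcongr
  exact enorm_add_le _ _

theorem hsNorm_mul_le (S T : H →L[ℂ] H) : hsNorm (S * T) ≤ ‖S‖ₑ * hsNorm T := by
  rw [hsNorm_le_iff]
  intro s hs
  refine le_trans ?_ (mul_le_mul_right ((hsNorm_le_iff T _).1 le_rfl s hs) _)
  have : ∑ x ∈ s, ‖(S * T) x‖ₑ ^ (2 : ℝ) ≤ ‖S‖ₑ ^ (2 : ℝ) * ∑ x ∈ s, ‖T x‖ₑ ^ (2 : ℝ) := by
    rw [Finset.mul_sum]
    refine Finset.sum_le_sum fun x _ => ?_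
    rw [← ENNReal.mul_rpow_of_nonneg _ _ (by norm_num)]
    gcongr
    exact S.le_opENorm (T x)
  refine (ENNReal.rpow_le_rpow this (by norm_num)).trans (le_of_eq ?_)
  rw [ENNReal.mul_rpow_of_nonneg _ _ (by norm_num), ← ENNReal.rpow_mul]
  norm_num

theorem enorm_star_op (T : H →L[ℂ] H) : ‖star T‖ₑ = ‖T‖ₑ := by
  rw [← ofReal_norm, ← ofReal_norm, norm_star]

theorem hsNorm_mul_le' (S T : H →L[ℂ] H) : hsNorm (S * T) ≤ hsNorm S * ‖T‖ₑ := by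
  rw [← hsNorm_star, star_mul, mul_comm, ← enorm_star_op T, ← hsNorm_star S]
  exact hsNorm_mul_le _ _

end HilbertSchmidt

/-! ### The spaces, multiplication operators and essentially Lipschitz functions -/

/-- Lebesgue measure of `ℂ`, restricted to `Ω`. -/
abbrev leb (Ω : Set ℂ) : Measure ℂ := (volume : Measure ℂ).restrict Ω

/-- The Hilbert space `L²(Ω)`. -/
abbrev L2 (Ω : Set ℂ) : Type := Lp ℂ 2 (leb Ω)

/-- The bounded operators on `L²(Ω)`. -/
abbrev BL2 (Ω : Set ℂ) : Type := L2 Ω →L[ℂ] L2 Ω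

variable {Ω : Set ℂ}

/-- The operator `M_f` of multiplication by `f ∈ L^∞(Ω)` on `L²(Ω)`. -/
def mulOp (f : Lp ℂ ∞ (leb Ω)) : BL2 Ω :=
  (ContinuousLinearMap.mul ℂ ℂ).holderL (leb Ω) ∞ 2 2 f

theorem mulOp_apply_ae (f : Lp ℂ ∞ (leb Ω)) (g : L2 Ω) :
    mulOp f g =ᵐ[leb Ω] fun z => f z * g z :=
  (ContinuousLinearMap.mul ℂ ℂ).coeFn_holder f g

/-- The indicator function of `A ∩ Ω`, as an element of `L^∞(Ω)`. -/
def indLinf (Ω : Set ℂ) (A : Set ℂ) (hA : MeasurableSet A) : Lp ℂ ∞ (leb Ω) :=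
  MemLp.toLp (A.indicator fun _ => (1 : ℂ)) ((memLp_top_const (1 : ℂ)).indicator hA)

/-- The difference quotient `Df(s,t) = (f(s) - f(t)) / (s - t)`; its value on the diagonal, which
is a null set, is irrelevant. -/
def diffQuot (f : Lp ℂ ∞ (leb Ω)) (p : ℂ × ℂ) : ℂ := (f p.1 - f p.2) / (p.1 - p.2)

/-- The essential supremum `‖Df‖_∞ ∈ [0, ∞]` over `Ω × Ω`. -/
def lipNorm (f : Lp ℂ ∞ (leb Ω)) : ℝ≥0∞ := eLpNorm (diffQuot f) ∞ ((leb Ω).prod (leb Ω))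

/-- The essentially Lipschitz functions `Λ(Ω)`: the `f ∈ L^∞(Ω)` with `Df ∈ L^∞(Ω × Ω)`. -/
def essLip (Ω : Set ℂ) : Set (Lp ℂ ∞ (leb Ω)) :=
  {f | MemLp (diffQuot f) ∞ ((leb Ω).prod (leb Ω))}

/-- `L(T) = sup { |[M_f, T]|₂ : f ∈ Λ(Ω), ‖Df‖_∞ ≤ 1 } ∈ [0, ∞]`. -/
def lipL (T : BL2 Ω) : ℝ≥0∞ :=
  ⨆ f ∈ {f : Lp ℂ ∞ (leb Ω) | f ∈ essLip Ω ∧ lipNorm f ≤ 1}, hsNorm (mulOp f * T - T * mulOp f)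

theorem hsNorm_le_lipL (T : BL2 Ω) (f : Lp ℂ ∞ (leb Ω)) (hf : f ∈ essLip Ω) (h1 : lipNorm f ≤ 1) :
    hsNorm (mulOp f * T - T * mulOp f) ≤ lipL T :=
  le_iSup₂ (f := fun f (_ : f ∈ {f : Lp ℂ ∞ (leb Ω) | f ∈ essLip Ω ∧ lipNorm f ≤ 1}) =>
    hsNorm (mulOp f * T - T * mulOp f)) f ⟨hf, h1⟩

theorem lipL_add_le (S T : BL2 Ω) : lipL (S + T) ≤ lipL S + lipL T := by
  refine iSup₂_le fun f hf => ?_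
  have e : mulOp f * (S + T) - (S + T) * mulOp f
      = (mulOp f * S - S * mulOp f) + (mulOp f * T - T * mulOp f) := by noncomm_ring
  rw [e]
  exact (hsNorm_add_le _ _).trans
    (add_le_add (hsNorm_le_lipL S f hf.1 hf.2) (hsNorm_le_lipL T f hf.1 hf.2))

theorem lipL_mul_le (S T : BL2 Ω) : lipL (S * T) ≤ lipL S * ‖T‖ₑ + ‖S‖ₑ * lipL T := by
  refine iSup₂_le fun f hf => ?_
  have e : mulOp f * (S * T) - (S * T) * mulOp f
      = (mulOp f * S - S * mulOp f) * T + S * (mulOp f * T - T * mulOp f) := by noncomm_ring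
  rw [e]
  refine (hsNorm_add_le _ _).trans (add_le_add ((hsNorm_mul_le' _ _).trans ?_)
    ((hsNorm_mul_le _ _).trans ?_))
  · gcongr
    exact hsNorm_le_lipL S f hf.1 hf.2
  · gcongr
    exact hsNorm_le_lipL T f hf.1 hf.2

theorem lipL_algebraMap (c : ℂ) : lipL (algebraMap ℂ (BL2 Ω) c) = 0 := by
  refine le_antisymm (iSup₂_le fun f _ => ?_) zero_le
  rw [(Algebra.commutes c (mulOp f)).symm, sub_self, hsNorm_zero]

theorem measurable_diffQuot (f : Lp ℂ ∞ (leb Ω)) : Measurable (diffQuot f) := by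
  have hf : Measurable (f : ℂ → ℂ) := (Lp.stronglyMeasurable f).measurable
  exact ((hf.comp measurable_fst).sub (hf.comp measurable_snd)).div
    (measurable_fst.sub measurable_snd)

theorem diffQuot_star_ae (f : Lp ℂ ∞ (leb Ω)) :
    ∀ᵐ p ∂((leb Ω).prod (leb Ω)), ‖diffQuot (star f) p‖ = ‖diffQuot f p‖ := by
  have h1 := Measure.quasiMeasurePreserving_fst (μ := leb Ω) (ν := leb Ω) |>.ae (Lp.coeFn_star f)
  have h2 := Measure.quasiMeasurePreserving_snd (μ := leb Ω) (ν := leb Ω) |>.ae (Lp.coeFn_star f)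
  filter_upwards [h1, h2] with p hp1 hp2
  rw [diffQuot, diffQuot, hp1, hp2, Pi.star_apply, Pi.star_apply, ← star_sub, norm_div, norm_star,
    ← norm_div]

theorem lipNorm_star (f : Lp ℂ ∞ (leb Ω)) : lipNorm (star f) = lipNorm f :=
  eLpNorm_congr_norm_ae (diffQuot_star_ae f)

theorem star_mem_essLip {f : Lp ℂ ∞ (leb Ω)} (hf : f ∈ essLip Ω) : star f ∈ essLip Ω :=
  ⟨(measurable_diffQuot _).aestronglyMeasurable, (lipNorm_star f).trans_lt hf.2⟩

theorem star_mulOp (f : Lp ℂ ∞ (leb Ω)) : star (mulOp f) = mulOp (star f) := by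
  rw [ContinuousLinearMap.star_eq_adjoint]
  symm
  rw [ContinuousLinearMap.eq_adjoint_iff]
  intro g h
  rw [L2.inner_def, L2.inner_def]
  refine integral_congr_ae ?_
  filter_upwards [mulOp_apply_ae (star f) g, mulOp_apply_ae f h, Lp.coeFn_star f] with z h1 h2 h3
  rw [h1, h2, h3]
  simp
  ring

theorem lipL_star_le (T : BL2 Ω) : lipL (star T) ≤ lipL T := by
  refine iSup₂_le fun f hf => ?_
  have e : mulOp f * star T - star T * mulOp f
      = -star (mulOp (star f) * T - T * mulOp (star f)) := by
    rw [star_sub, star_mul, star_mul, star_mulOp, star_star]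
    noncomm_ring
  rw [e, hsNorm_neg, hsNorm_star]
  exact hsNorm_le_lipL T _ (star_mem_essLip hf.1) ((lipNorm_star f).trans_le hf.2)

/-! ### The algebras `EΛ(Ω)` and `KΛ(Ω)` -/

/-- The `*`-subalgebra `EΛ(Ω) = {T : L(T) < ∞}` of the bounded operators on `L²(Ω)`. -/
def EAlg (Ω : Set ℂ) : StarSubalgebra ℂ (BL2 Ω) where
  carrier := {T | lipL T < ∞}
  mul_mem' {S T} hS hT := (lipL_mul_le S T).trans_lt
    (ENNReal.add_lt_top.2 ⟨ENNReal.mul_lt_top hS enorm_lt_top, ENNReal.mul_lt_top enorm_lt_top hT⟩)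
  add_mem' {S T} hS hT := (lipL_add_le S T).trans_lt (ENNReal.add_lt_top.2 ⟨hS, hT⟩)
  algebraMap_mem' c := (lipL_algebraMap c).trans_lt ENNReal.zero_lt_top
  star_mem' {T} hT := (lipL_star_le T).trans_lt hT

theorem mem_EAlg (T : BL2 Ω) : T ∈ EAlg Ω ↔ lipL T < ∞ := Iff.rfl

/-- The norm `|||T||| = ‖T‖ + L(T)` of `EΛ(Ω)`, as a (finite) element of `[0, ∞]`. -/
def triNorm (T : EAlg Ω) : ℝ≥0∞ := ‖(T : BL2 Ω)‖ₑ + lipL (T : BL2 Ω)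

theorem triNorm_lt_top (T : EAlg Ω) : triNorm T < ∞ :=
  ENNReal.add_lt_top.2 ⟨enorm_lt_top, T.2⟩

/-- The two-sided ideal `KΛ(Ω)` of `EΛ(Ω)` that consists of the compact operators in `EΛ(Ω)`. -/
def KIdeal (Ω : Set ℂ) : TwoSidedIdeal (EAlg Ω) :=
  TwoSidedIdeal.mk' {T : EAlg Ω | IsCompactOperator (T : BL2 Ω)}
    isCompactOperator_zero
    (fun {S T} hS hT => IsCompactOperator.add (f := ((S : BL2 Ω) : L2 Ω → L2 Ω))
      (g := ((T : BL2 Ω) : L2 Ω → L2 Ω)) hS hT)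
    (fun {S} hS => IsCompactOperator.neg (f := ((S : BL2 Ω) : L2 Ω → L2 Ω)) hS)
    (fun {S T} hT => IsCompactOperator.clm_comp (f := ((T : BL2 Ω) : L2 Ω → L2 Ω)) hT (S : BL2 Ω))
    (fun {S T} hS => IsCompactOperator.comp_clm (f := ((S : BL2 Ω) : L2 Ω → L2 Ω)) hS (T : BL2 Ω))

theorem mem_KIdeal (T : EAlg Ω) : T ∈ KIdeal Ω ↔ IsCompactOperator (T : BL2 Ω) :=
  TwoSidedIdeal.mem_mk' _ _ _ _ _ _ T

/-! ### The inclusion of operators on `L²(Ω₁)` into operators on `L²(Ω₂)` -/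

/-- The restriction map `L²(Ω₂) → L²(Ω₁)`, `f ↦ f|Ω₁`, for `Ω₁ ⊆ Ω₂`. -/
def restrictL2 {Ω₁ Ω₂ : Set ℂ} (h : Ω₁ ⊆ Ω₂) : L2 Ω₂ →L[ℂ] L2 Ω₁ :=
  LinearMap.mkContinuous
    { toFun := fun f => ((Lp.memLp f).mono_measure (Measure.restrict_mono h le_rfl)).toLp f
      map_add' := fun f g => by
        rw [← MemLp.toLp_add]
        exact MemLp.toLp_congr _ _ ((Measure.absolutelyContinuous_of_le
          (Measure.restrict_mono h le_rfl)).ae_le (Lp.coeFn_add f g))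
      map_smul' := fun c f => by
        rw [RingHom.id_apply, ← MemLp.toLp_const_smul]
        exact MemLp.toLp_congr _ _ ((Measure.absolutelyContinuous_of_le
          (Measure.restrict_mono h le_rfl)).ae_le (Lp.coeFn_smul c f)) }
    1 (fun f => by
      rw [one_mul, LinearMap.coe_mk, AddHom.coe_mk, Lp.norm_toLp, Lp.norm_def]
      exact ENNReal.toReal_mono (Lp.eLpNorm_ne_top f)
        (eLpNorm_mono_measure f (Measure.restrict_mono h le_rfl)))

theorem restrictL2_apply_ae {Ω₁ Ω₂ : Set ℂ} (h : Ω₁ ⊆ Ω₂) (f : L2 Ω₂) :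
    restrictL2 h f =ᵐ[leb Ω₁] f :=
  MemLp.coeFn_toLp ((Lp.memLp f).mono_measure (Measure.restrict_mono h le_rfl))

/-- Extension by zero `L²(Ω₁) → L²(Ω₂)`, as the adjoint of the restriction map. -/
def extendL2 {Ω₁ Ω₂ : Set ℂ} (h : Ω₁ ⊆ Ω₂) : L2 Ω₁ →L[ℂ] L2 Ω₂ :=
  ContinuousLinearMap.adjoint (restrictL2 h)

theorem extendL2_apply_ae {Ω₁ Ω₂ : Set ℂ} (h : Ω₁ ⊆ Ω₂) (h₁ : MeasurableSet Ω₁) (f : L2 Ω₁) :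
    extendL2 h f =ᵐ[leb Ω₂] Ω₁.indicator f := by
  have hr : (leb Ω₂).restrict Ω₁ = leb Ω₁ := Measure.restrict_restrict_of_subset h
  have hm : MemLp (Ω₁.indicator f) 2 (leb Ω₂) := by
    rw [memLp_indicator_iff_restrict h₁, hr]; exact Lp.memLp f
  have e : extendL2 h f = hm.toLp := by
    refine ext_inner_left ℂ fun g => ?_
    rw [extendL2, ContinuousLinearMap.adjoint_inner_right, L2.inner_def, L2.inner_def]
    have h2 : ∫ z, ⟪g z, (hm.toLp : L2 Ω₂) z⟫_ℂ ∂(leb Ω₂) =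
        ∫ z, Ω₁.indicator (fun z => ⟪g z, f z⟫_ℂ) z ∂(leb Ω₂) := by
      refine integral_congr_ae ?_
      filter_upwards [hm.coeFn_toLp] with z hz
      rw [hz]
      by_cases hz1 : z ∈ Ω₁ <;> simp [hz1]
    rw [h2, integral_indicator h₁, hr]
    refine integral_congr_ae ?_
    filter_upwards [restrictL2_apply_ae h g] with z hz
    rw [hz]
  rw [e]
  exact hm.coeFn_toLp

/-- The inclusion `i(Ω₂, Ω₁)(T) = T ⊕ 0` with respect to `L²(Ω₂) = L²(Ω₁) ⊕ L²(Ω₂ \ Ω₁)`. -/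
def inclOp {Ω₁ Ω₂ : Set ℂ} (h : Ω₁ ⊆ Ω₂) (T : BL2 Ω₁) : BL2 Ω₂ :=
  extendL2 h ∘L T ∘L restrictL2 h

end LipAlg

end

noncomputable section

namespace LipAlg

/-! ### Further properties of the Hilbert-Schmidt norm -/

section HilbertSchmidt

variable {H : Type*} [NormedAddCommGroup H] [InnerProductSpace ℂ H]

/-! Cut the plane into dyadic squares of side `2 ^ -j`, intersected with annuli of width one, and
let `p j` be the projection onto the step functions of level `j` on the ball of radius `n`. A
function with `‖Df‖_∞ ≤ 1` is within `2 / 2 ^ j` of a step function of level `j`, while `|p j|₂ =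
O(2 ^ j)` because the rank is `O(4 ^ j)`. Hence the commutators `[M_f, p j]` are bounded in
Hilbert-Schmidt norm, uniformly in `f`, but this count does not make them small: dimension two is
critical.

Smallness comes from averaging over scales. The corners `(1 - p i) M_f p l` decay like `2 ^ (l -
i)`, so a combination of `p 0, p 1, ...` whose coefficients drop from `1` to `0` in `K` steps of
size `O(1 / K)` has a commutator of size `O(1 / √K)`: each of the `K` orthogonal blocks contributes
`O(1 / K)` (`IsFlag.hsNorm_sum_corner_le`, `exists_flag_cutoff`). The result `A = cos² θ` is a
positive contraction and not a projection. To repair this, `exists_moving_isometry` gives a partial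
isometry `W` from `p N` to an orthogonal space. It keeps every function inside its cell of level
`N`, so it nearly commutes with `M_f` on coarse functions, and its range is spanned by functions
that each live in one cell of a far finer level `L`, so `W W*` nearly commutes with `M_f`. The
projection onto the range of `cos θ + W sin θ` then almost commutes with all `M_f` and dominates `p
n` (`exists_almost_commuting_projection`). Between these projections and the cell projections there
is domination both ways, so the levels can be chosen recursively to make the sequence increase to
`I` (`exists_projection_sequence`). The annuli make everything commute with the indicators of the
balls.

For the approximate unit, `[M_f, (P n - 1) T] = [M_f, P n] T + (P n - 1) [M_f, T]`. For a single `f`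
the last term tends to zero in Hilbert-Schmidt norm, because `[M_f, T]` is Hilbert-Schmidt and `P n
→ I` strongly; what is needed is uniformity in `f`. It follows from comparing all `f` with the
coordinate function (`hsNorm_commutator_le_coordinate`): heuristically `[M_f, X]` has the kernel
`(f(s) - f(t)) k(s, t)`, which is dominated by `(s - t) k(s, t)`. The operator `X` need not have a
kernel, but its blocks away from the diagonal are Hilbert-Schmidt, and the blocks of `[M_f, X]` near
the diagonal disappear under refinement. On an unbounded set the coordinate is truncated and
everything is compressed to large balls (`tendsto_lipL_mul_sub`). Compactness of `T` gives
convergence in operator norm, adjoints give the other side, and density follows by compressing `T`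
to `P n T P n`. -/

theorem norm_sum_sq_of_orthogonal {ι : Type*} (s : Finset ι) (v : ι → H)
    (h : ∀ i ∈ s, ∀ j ∈ s, i ≠ j → ⟪v i, v j⟫_ℂ = 0) :
    ‖∑ i ∈ s, v i‖ ^ 2 = ∑ i ∈ s, ‖v i‖ ^ 2 := by
  have e : ⟪∑ i ∈ s, v i, ∑ i ∈ s, v i⟫_ℂ = ∑ i ∈ s, ⟪v i, v i⟫_ℂ := by
    rw [sum_inner]
    refine Finset.sum_congr rfl fun i hi => ?_
    rw [inner_sum, Finset.sum_eq_single_of_mem i hi]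
    exact fun j hj hij => h i hi j hj hij.symm
  simp only [inner_self_eq_norm_sq_to_K] at e
  exact_mod_cast e

theorem enorm_sum_sq_of_orthogonal {ι : Type*} (s : Finset ι) (v : ι → H)
    (h : ∀ i ∈ s, ∀ j ∈ s, i ≠ j → ⟪v i, v j⟫_ℂ = 0) :
    ‖∑ i ∈ s, v i‖ₑ ^ 2 = ∑ i ∈ s, ‖v i‖ₑ ^ 2 := by
  have e := congrArg ENNReal.ofReal (norm_sum_sq_of_orthogonal s v h)
  rw [ENNReal.ofReal_sum_of_nonneg (fun i _ => by positivity)] at e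
  simpa [ENNReal.ofReal_pow, ofReal_norm] using e

theorem hsNorm_sq (T : H →L[ℂ] H) : hsNorm T ^ 2 = hsSq T := by
  rw [hsNorm, ← ENNReal.rpow_natCast, ← ENNReal.rpow_mul]; norm_num

theorem hsNorm_le_iff_hsSq_le (T : H →L[ℂ] H) (c : ℝ≥0∞) : hsNorm T ≤ c ↔ hsSq T ≤ c ^ 2 := by
  rw [← hsNorm_sq, ENNReal.pow_le_pow_left_iff two_ne_zero]

theorem hsNorm_lt_top_iff (T : H →L[ℂ] H) : hsNorm T < ∞ ↔ hsSq T < ∞ := by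
  rw [← hsNorm_sq]
  simp [lt_top_iff_ne_top]

variable [CompleteSpace H]

theorem hsNorm_sub_le (S T : H →L[ℂ] H) : hsNorm (S - T) ≤ hsNorm S + hsNorm T := by
  rw [sub_eq_add_neg, ← hsNorm_neg T]
  exact hsNorm_add_le _ _

theorem hsNorm_sum_le {ι : Type*} (s : Finset ι) (T : ι → H →L[ℂ] H) :
    hsNorm (∑ i ∈ s, T i) ≤ ∑ i ∈ s, hsNorm (T i) := by
  classical
  induction s using Finset.induction_on with
  | empty => simp [hsNorm_zero]
  | insert i s hi ih =>
    rw [Finset.sum_insert hi, Finset.sum_insert hi]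
    exact (hsNorm_add_le _ _).trans (add_le_add le_rfl ih)

theorem hsNorm_mul_le_of_norm_le {S : H →L[ℂ] H} {r : ℝ} (h : ‖S‖ ≤ r) (T : H →L[ℂ] H) :
    hsNorm (S * T) ≤ ENNReal.ofReal r * hsNorm T := by
  refine (hsNorm_mul_le S T).trans ?_
  rw [← ofReal_norm]
  gcongr

theorem hsNorm_mul_le_of_norm_le' {T : H →L[ℂ] H} {r : ℝ} (h : ‖T‖ ≤ r) (S : H →L[ℂ] H) :
    hsNorm (S * T) ≤ ENNReal.ofReal r * hsNorm S := by
  refine (hsNorm_mul_le' S T).trans ?_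
  rw [← ofReal_norm, mul_comm]
  gcongr

theorem hsNorm_mul_le_left {S : H →L[ℂ] H} (h : ‖S‖ ≤ 1) (T : H →L[ℂ] H) :
    hsNorm (S * T) ≤ hsNorm T := by
  simpa using hsNorm_mul_le_of_norm_le h T

theorem hsNorm_mul_le_right {T : H →L[ℂ] H} (h : ‖T‖ ≤ 1) (S : H →L[ℂ] H) :
    hsNorm (S * T) ≤ hsNorm S := by
  simpa using hsNorm_mul_le_of_norm_le' h S

theorem hsNorm_smul_le (c : ℂ) (T : H →L[ℂ] H) :
    hsNorm (c • T) ≤ ENNReal.ofReal ‖c‖ * hsNorm T := by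
  have e : c • T = (c • (1 : H →L[ℂ] H)) * T := by simp
  rw [e]
  refine hsNorm_mul_le_of_norm_le ?_ T
  refine (norm_smul_le _ _).trans (mul_le_of_le_one_right (norm_nonneg _) ?_)
  exact ContinuousLinearMap.norm_id_le

/-- The ranges are mutually orthogonal, so Pythagoras applies to the images of each basis vector.
The companion below treats orthogonal initial spaces by passing to adjoints. -/
theorem hsSq_sum_of_star_mul_eq_zero {ι : Type*} (s : Finset ι) (Y : ι → H →L[ℂ] H)
    (h : ∀ i ∈ s, ∀ j ∈ s, i ≠ j → star (Y i) * Y j = 0) :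
    hsSq (∑ i ∈ s, Y i) = ∑ i ∈ s, hsSq (Y i) := by
  obtain ⟨w, b, -⟩ := exists_hilbertBasis ℂ H
  simp only [hsSq_eq_tsum b]
  rw [← Summable.tsum_finsetSum (fun _ _ => ENNReal.summable)]
  refine tsum_congr fun k => ?_
  rw [sum_apply]
  refine enorm_sum_sq_of_orthogonal s _ fun i hi j hj hij => ?_
  rw [← ContinuousLinearMap.adjoint_inner_right, ← ContinuousLinearMap.star_eq_adjoint,
    ← mul_apply_eq_comp, h i hi j hj hij]
  simp

theorem hsSq_sum_of_mul_star_eq_zero {ι : Type*} (s : Finset ι) (Y : ι → H →L[ℂ] H)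
    (h : ∀ i ∈ s, ∀ j ∈ s, i ≠ j → Y i * star (Y j) = 0) :
    hsSq (∑ i ∈ s, Y i) = ∑ i ∈ s, hsSq (Y i) := by
  rw [← hsSq_star, star_sum, hsSq_sum_of_star_mul_eq_zero]
  · simp only [hsSq_star]
  · intro i hi j hj hij
    rw [star_star, h i hi j hj hij]

theorem hsSq_rankOne (x y : H) :
    hsSq (InnerProductSpace.rankOne ℂ x y) = ‖x‖ₑ ^ 2 * ‖y‖ₑ ^ 2 := by
  obtain ⟨w, b, -⟩ := exists_hilbertBasis ℂ H
  rw [hsSq_eq_tsum b, enorm_sq_eq_tsum b y, ← ENNReal.tsum_mul_left]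
  refine tsum_congr fun k => ?_
  rw [InnerProductSpace.rankOne_apply, enorm_smul, mul_pow, mul_comm, ← inner_conj_symm,
    RCLike.enorm_conj]

/-- A bounded sequence of operators that tends to zero strongly tends to zero in
Hilbert-Schmidt norm after multiplication with a Hilbert-Schmidt operator. -/
theorem tendsto_hsNorm_mul {Z : H →L[ℂ] H} (hZ : hsNorm Z < ∞) {q : ℕ → H →L[ℂ] H}
    (hq : ∀ n, ‖q n‖ ≤ 1) (h : ∀ x, Tendsto (fun n => q n x) atTop (𝓝 0)) :
    Tendsto (fun n => hsNorm (q n * Z)) atTop (𝓝 0) := by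
  obtain ⟨w, b, -⟩ := exists_hilbertBasis ℂ H
  rw [hsNorm_lt_top_iff, hsSq_eq_tsum b] at hZ
  have h1 : Tendsto (fun n => hsSq (q n * Z)) atTop (𝓝 0) := by
    simp only [hsSq_eq_tsum b]
    -- The sum over the basis is read as an integral for counting measure, so that dominated
    -- convergence applies with dominating function `‖Z (b i)‖ₑ ^ 2`.
    let _ : MeasurableSpace w := ⊤
    have e : ∀ T : H →L[ℂ] H, ∑' i, ‖T (b i)‖ₑ ^ 2
        = ∫⁻ i, ‖T (b i)‖ₑ ^ 2 ∂(Measure.count : Measure w) := fun T =>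
      (lintegral_count _).symm
    simp only [e]
    rw [e] at hZ
    rw [← lintegral_zero (μ := (Measure.count : Measure w))]
    refine tendsto_lintegral_filter_of_dominated_convergence _
      (Eventually.of_forall fun n => measurable_from_top)
      (Eventually.of_forall fun n => Eventually.of_forall fun i => ?_) hZ.ne
      (Eventually.of_forall fun i => ?_)
    · gcongr
      rw [mul_apply_eq_comp]
      refine ((q n).le_opENorm _).trans (mul_le_of_le_one_left' ?_)
      rw [← ofReal_norm]
      simpa using ENNReal.ofReal_le_ofReal (hq n)
    · have h2 : Tendsto (fun n => ‖q n (Z (b i))‖ₑ) atTop (𝓝 0) := by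
        simpa using (h (Z (b i))).enorm
      simpa using ENNReal.Tendsto.pow (n := 2) h2
  have h2 := h1.ennrpow_const (1 / 2 : ℝ)
  simpa [hsNorm] using h2

end HilbertSchmidt

end LipAlg

end

noncomputable section

namespace LipAlg

/-! ### Diagonal combinations of an increasing sequence of projections -/

section Flag

variable {H : Type*} [NormedAddCommGroup H] [InnerProductSpace ℂ H]

/-- The successive differences of the projections `p i`. -/
def flagBlock (p : ℕ → H →L[ℂ] H) : ℕ → H →L[ℂ] H
  | 0 => p 0
  | l + 1 => p (l + 1) - p l

/-- The operator `∑_{l ≤ K} a l (p l - p (l - 1))`. -/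
def flagDiag (p : ℕ → H →L[ℂ] H) (K : ℕ) (a : ℕ → ℝ) : H →L[ℂ] H :=
  ∑ l ∈ Finset.range (K + 1), (a l : ℂ) • flagBlock p l

theorem sum_flagBlock (p : ℕ → H →L[ℂ] H) (k : ℕ) :
    ∑ l ∈ Finset.range (k + 1), flagBlock p l = p k := by
  induction k with
  | zero => simp [flagBlock]
  | succ k ih => rw [Finset.sum_range_succ, ih]; simp [flagBlock]

/-- Abel summation. The condition `a K = 0` removes the boundary term, so only differences of
consecutive coefficients enter the commutator estimates. -/
theorem flagDiag_eq_sum (p : ℕ → H →L[ℂ] H) (K : ℕ) (a : ℕ → ℝ) (h : a K = 0) :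
    flagDiag p K a = ∑ i ∈ Finset.range K, ((a i - a (i + 1) : ℝ) : ℂ) • p i := by
  have e : ∀ k, flagDiag p k a
      = ∑ i ∈ Finset.range k, ((a i - a (i + 1) : ℝ) : ℂ) • p i + (a k : ℂ) • p k := by
    intro k
    induction k with
    | zero => simp [flagDiag, flagBlock]
    | succ k ih =>
      rw [flagDiag, Finset.sum_range_succ, ← flagDiag, ih, Finset.sum_range_succ, flagBlock]
      push_cast
      module
  rw [e, h]; simp

theorem hsNorm_le_ofReal_of_hsSq_le {T : H →L[ℂ] H} {r : ℝ} (hr : 0 ≤ r)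
    (h : hsSq T ≤ ENNReal.ofReal (r ^ 2)) : hsNorm T ≤ ENNReal.ofReal r := by
  rwa [hsNorm_le_iff_hsSq_le, ← ENNReal.ofReal_pow hr]

theorem hsSq_le_ofReal_of_hsNorm_le {T : H →L[ℂ] H} {r : ℝ} (hr : 0 ≤ r)
    (h : hsNorm T ≤ ENNReal.ofReal r) : hsSq T ≤ ENNReal.ofReal (r ^ 2) := by
  rwa [hsNorm_le_iff_hsSq_le, ← ENNReal.ofReal_pow hr] at h

variable [CompleteSpace H]

/-- An increasing sequence of self-adjoint projections. -/
structure IsFlag (p : ℕ → H →L[ℂ] H) : Prop where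
  star_eq : ∀ i, star (p i) = p i
  mul_left : ∀ i j, i ≤ j → p i * p j = p i
  mul_right : ∀ i j, i ≤ j → p j * p i = p i

variable {p : ℕ → H →L[ℂ] H}

theorem norm_le_one_of_idem {q : H →L[ℂ] H} (h1 : star q = q) (h2 : q * q = q) : ‖q‖ ≤ 1 :=
  IsStarProjection.norm_le q ⟨h2, h1⟩

namespace IsFlag

theorem shift (hp : IsFlag p) (n : ℕ) : IsFlag fun i => p (n + i) :=
  ⟨fun i => hp.star_eq _, fun i j h => hp.mul_left _ _ (by lia),
    fun i j h => hp.mul_right _ _ (by lia)⟩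

theorem star_block (hp : IsFlag p) (l : ℕ) : star (flagBlock p l) = flagBlock p l := by
  cases l <;> simp [flagBlock, hp.star_eq]

theorem mul_block (hp : IsFlag p) (i l : ℕ) :
    p i * flagBlock p l = if l ≤ i then flagBlock p l else 0 := by
  cases l with
  | zero => simp [flagBlock, hp.mul_right 0 i]
  | succ l =>
    simp only [flagBlock, mul_sub]
    split_ifs with h
    · rw [hp.mul_right _ _ h, hp.mul_right _ _ (by lia)]
    · rw [hp.mul_left _ _ (by lia), hp.mul_left _ _ (by lia), sub_self]

theorem block_mul (hp : IsFlag p) (i l : ℕ) :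
    flagBlock p l * p i = if l ≤ i then flagBlock p l else 0 := by
  have e := congrArg star (hp.mul_block i l)
  rw [star_mul, hp.star_block, hp.star_eq] at e
  rw [e]
  split_ifs <;> simp [hp.star_block]

theorem block_mul_block (hp : IsFlag p) (l m : ℕ) :
    flagBlock p l * flagBlock p m = if l = m then flagBlock p l else 0 := by
  cases m with
  | zero => cases l <;> simp [flagBlock, hp.mul_left, hp.mul_right, sub_mul]
  | succ m =>
    rw [flagBlock, mul_sub, hp.block_mul, hp.block_mul]
    split_ifs <;> first | lia | simp

theorem norm_block_le (hp : IsFlag p) (l : ℕ) : ‖flagBlock p l‖ ≤ 1 :=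
  norm_le_one_of_idem (hp.star_block l) (by simp [hp.block_mul_block])

theorem star_diag (hp : IsFlag p) (K : ℕ) (a : ℕ → ℝ) : star (flagDiag p K a) = flagDiag p K a := by
  simp [flagDiag, star_sum, star_smul, hp.star_block]

theorem diag_mul_diag (hp : IsFlag p) (K : ℕ) (a b : ℕ → ℝ) :
    flagDiag p K a * flagDiag p K b = flagDiag p K (fun l => a l * b l) := by
  rw [flagDiag, flagDiag, flagDiag, Finset.sum_mul]
  refine Finset.sum_congr rfl fun l hl => ?_
  rw [Finset.mul_sum, Finset.sum_eq_single_of_mem l hl]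
  · rw [smul_mul_smul_comm, hp.block_mul_block]; simp
  · intro m _ hm
    rw [smul_mul_smul_comm, hp.block_mul_block]; simp [hm.symm]

theorem mul_diag (hp : IsFlag p) (K : ℕ) (a : ℕ → ℝ) : p K * flagDiag p K a = flagDiag p K a := by
  rw [flagDiag, Finset.mul_sum]
  refine Finset.sum_congr rfl fun l hl => ?_
  rw [mul_smul_comm, hp.mul_block, if_pos (by simpa [Nat.lt_succ_iff] using hl)]

theorem diag_mul_zero (hp : IsFlag p) (K : ℕ) (a : ℕ → ℝ) :
    flagDiag p K a * p 0 = (a 0 : ℂ) • p 0 := by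
  rw [flagDiag, Finset.sum_mul, Finset.sum_eq_single_of_mem 0 (by simp)]
  · rw [smul_mul_assoc, hp.block_mul]; simp [flagBlock]
  · intro l _ hl
    rw [smul_mul_assoc, hp.block_mul]; simp [hl]

end IsFlag

/-- A slowly varying combination of the off-diagonal corners of `f` is small, because the
corners far from the diagonal decay geometrically. -/
theorem IsFlag.hsNorm_sum_corner_le (hp : IsFlag p) {f : H →L[ℂ] H} {c δ : ℝ} (hc : 0 ≤ c)
    (hδ : 0 ≤ δ) (h : ∀ l i, l ≤ i →
      hsNorm ((1 - p i) * f * p l) ≤ ENNReal.ofReal (c * (2 ^ l / 2 ^ i)))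
    (K : ℕ) (d : ℕ → ℝ) (hd : ∀ i < K, |d i| ≤ δ) :
    hsNorm (∑ i ∈ Finset.range K, (d i : ℂ) • ((1 - p i) * f * p i))
      ≤ ENNReal.ofReal (2 * c * δ * √K) := by
  set X := ∑ i ∈ Finset.range K, (d i : ℂ) • ((1 - p i) * f * p i) with hX
  -- The block `l` is killed by `p i` for `i < l`, and for `i ≥ l` both `p i` and `p l` fix it. This
  -- is where the decaying corners `(1 - p i) f p l` replace the merely bounded `(1 - p i) f p i`.
  have hXE : ∀ l, X * flagBlock p l
      = ∑ i ∈ Finset.Ico l K, (d i : ℂ) • (((1 - p i) * f * p l) * flagBlock p l) := by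
    intro l
    have e1 : ∀ i, ((1 - p i) * f * p i) * flagBlock p l
        = if l ≤ i then ((1 - p i) * f * p l) * flagBlock p l else 0 := by
      intro i
      rw [mul_assoc _ (p i), hp.mul_block, mul_assoc _ (p l), hp.mul_block]
      split_ifs <;> simp_all
    rw [hX, Finset.sum_mul]
    simp only [smul_mul_assoc, e1, smul_ite, smul_zero]
    rw [← Finset.sum_filter]
    refine Finset.sum_congr ?_ fun _ _ => rfl
    ext i; simp [and_comm]
  have hXs : X = ∑ l ∈ Finset.range K, X * flagBlock p l := by
    cases K with
    | zero => simp [hX]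
    | succ k =>
      rw [← Finset.mul_sum, sum_flagBlock, hX, Finset.sum_mul]
      refine Finset.sum_congr rfl fun i hi => ?_
      rw [smul_mul_assoc, mul_assoc _ (p i), hp.mul_left i k]
      simpa [Nat.lt_succ_iff] using hi
  have hbd : ∀ l, hsNorm (X * flagBlock p l) ≤ ENNReal.ofReal (2 * c * δ) := by
    intro l
    rw [hXE]
    refine (hsNorm_sum_le _ _).trans ?_
    have : ∀ i ∈ Finset.Ico l K,
        hsNorm ((d i : ℂ) • (((1 - p i) * f * p l) * flagBlock p l))
          ≤ ENNReal.ofReal (δ * c * 2 ^ l * (1 / 2) ^ i) := by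
      intro i hi
      rw [Finset.mem_Ico] at hi
      refine (hsNorm_smul_le _ _).trans ?_
      rw [Complex.norm_real, Real.norm_eq_abs]
      calc ENNReal.ofReal |d i| * hsNorm ((1 - p i) * f * p l * flagBlock p l)
          ≤ ENNReal.ofReal δ * ENNReal.ofReal (c * (2 ^ l / 2 ^ i)) := by
            gcongr
            · exact hd i hi.2
            · exact (hsNorm_mul_le_right (hp.norm_block_le l) _).trans (h l i hi.1)
        _ = _ := by
            rw [← ENNReal.ofReal_mul hδ]
            congr 1
            rw [one_div, inv_pow]
            ring
    refine (Finset.sum_le_sum this).trans ?_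
    rw [← ENNReal.ofReal_sum_of_nonneg (fun i _ => by positivity), ← Finset.mul_sum]
    refine ENNReal.ofReal_le_ofReal ?_
    have hg := geom_sum_Ico_le_of_lt_one (m := l) (n := K) (x := (1 / 2 : ℝ)) (by norm_num)
      (by norm_num)
    calc δ * c * 2 ^ l * ∑ i ∈ Finset.Ico l K, (1 / 2 : ℝ) ^ i
        ≤ δ * c * 2 ^ l * ((1 / 2) ^ l / (1 - 1 / 2)) := by gcongr
      _ = 2 * c * δ := by
        rw [one_div, inv_pow]
        field_simp
        norm_num
  refine hsNorm_le_ofReal_of_hsSq_le (by positivity) ?_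
  -- The pieces of `X` have orthogonal initial spaces, hence their squares add. This gives the
  -- factor `√K`; the triangle inequality would give a useless `K`.
  rw [hXs, hsSq_sum_of_mul_star_eq_zero]
  · refine (Finset.sum_le_sum fun l _ =>
      hsSq_le_ofReal_of_hsNorm_le (by positivity) (hbd l)).trans ?_
    rw [Finset.sum_const, Finset.card_range, nsmul_eq_mul, mul_pow _ (√(K : ℝ)),
      Real.sq_sqrt (by positivity), mul_comm, ENNReal.ofReal_mul (by positivity), ENNReal.ofReal_natCast]
  · intro i _ j _ hij
    rw [star_mul, hp.star_block, ← mul_assoc, mul_assoc X, hp.block_mul_block, if_neg hij]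
    simp

/-- Use `[f, p i] = (1 - p i) f p i - ((1 - p i) f* p i)*` after Abel summation. The second corner
is the reason for the hypothesis on `star f`. -/
theorem IsFlag.hsNorm_commutator_diag_le (hp : IsFlag p) {f : H →L[ℂ] H} {c δ : ℝ} (hc : 0 ≤ c)
    (hδ : 0 ≤ δ) (h : ∀ l i, l ≤ i →
      hsNorm ((1 - p i) * f * p l) ≤ ENNReal.ofReal (c * (2 ^ l / 2 ^ i)))
    (h' : ∀ l i, l ≤ i →
      hsNorm ((1 - p i) * star f * p l) ≤ ENNReal.ofReal (c * (2 ^ l / 2 ^ i)))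
    (K : ℕ) (a : ℕ → ℝ) (ha : a K = 0) (hd : ∀ i < K, |a i - a (i + 1)| ≤ δ) :
    hsNorm (f * flagDiag p K a - flagDiag p K a * f) ≤ ENNReal.ofReal (4 * c * δ * √K) := by
  have e : f * flagDiag p K a - flagDiag p K a * f
      = ∑ i ∈ Finset.range K, ((a i - a (i + 1) : ℝ) : ℂ) • ((1 - p i) * f * p i)
        - star (∑ i ∈ Finset.range K,
            ((a i - a (i + 1) : ℝ) : ℂ) • ((1 - p i) * star f * p i)) := by
    rw [flagDiag_eq_sum p K a ha, star_sum, Finset.mul_sum, Finset.sum_mul,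
      ← Finset.sum_sub_distrib, ← Finset.sum_sub_distrib]
    refine Finset.sum_congr rfl fun i _ => ?_
    rw [star_smul, star_mul, star_mul, star_star, star_sub, hp.star_eq, star_one, mul_smul_comm,
      smul_mul_assoc, Complex.star_def, Complex.conj_ofReal, ← smul_sub, ← smul_sub]
    congr 1
    noncomm_ring
  rw [e]
  refine (hsNorm_sub_le _ _).trans ?_
  rw [hsNorm_star]
  refine (add_le_add (hp.hsNorm_sum_corner_le hc hδ h K _ hd)
    (hp.hsNorm_sum_corner_le hc hδ h' K _ hd)).trans (le_of_eq ?_)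
  rw [← ENNReal.ofReal_add (by positivity) (by positivity)]
  congr 1; ring

end Flag

end LipAlg

end

noncomputable section

namespace LipAlg

/-! ### Rotating a slowly varying positive contraction into a projection -/

section Rotation

variable {H : Type*} [NormedAddCommGroup H] [InnerProductSpace ℂ H] [CompleteSpace H]

/-- With `A = cos² θ`, `B = cos θ sin θ` and a partial isometry `W` whose range is orthogonal to
its domain, this is the projection onto the range of `cos θ + W sin θ`. -/
def rotProj (A B W : H →L[ℂ] H) : H →L[ℂ] H :=
  A + B * star W + W * B + W * star W - W * A * star W

theorem mul_eq_self_of_star_mul_self {W p : H →L[ℂ] H} (h : star W * W = p) (hp : p * p = p) :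
    W * p = W := by
  have hs : star p = p := by rw [← h, star_mul, star_star]
  have e : star (W - W * p) * (W - W * p) = 0 := by
    rw [star_sub, star_mul, hs, sub_mul, mul_sub, mul_sub, h]
    simp only [mul_assoc]
    rw [← mul_assoc (star W), h]
    simp [hp]
  exact (sub_eq_zero.1 ((CStarRing.star_mul_self_eq_zero_iff _).1 e)).symm

theorem norm_le_one_of_star_mul_self {W p : H →L[ℂ] H} (h : star W * W = p) (hp : p * p = p) :
    ‖W‖ ≤ 1 := by
  have hs : star p = p := by rw [← h, star_mul, star_star]
  have h1 := norm_le_one_of_idem hs hp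
  rw [← h, CStarRing.norm_star_mul_self] at h1
  nlinarith [norm_nonneg W]

variable {A B W p : H →L[ℂ] H}

theorem star_rotProj (hA : star A = A) (hB : star B = B) :
    star (rotProj A B W) = rotProj A B W := by
  simp only [rotProj, star_add, star_sub, star_mul, star_star, hA, hB, mul_assoc]
  abel

/-- The operator `V = cos θ + W sin θ` on the range of `p` satisfies `V* V = cos² θ + sin² θ = p`,
since `p W = 0` removes the cross terms, and the projection is `V V*`. The proof never takes square
roots: `B * B = A - A * A` carries all the trigonometry that is needed. -/
theorem rotProj_mul_self (hA : star A = A) (hB : star B = B) (hW : star W * W = p)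
    (hp : p * p = p) (hpW : p * W = 0) (hpA : p * A = A) (hpB : p * B = B)
    (hBB : B * B = A - A * A) (hBA : B * A = A * B) :
    rotProj A B W * rotProj A B W = rotProj A B W := by
  have hs : star p = p := by rw [← hW, star_mul, star_star]
  have hWp : star W * p = 0 := by simpa [hs] using congrArg star hpW
  have hAp : A * p = A := by simpa [hs, hA] using congrArg star hpA
  have hBp : B * p = B := by simpa [hs, hB] using congrArg star hpB
  have hpW' : p * star W = star W := by
    simpa [hs] using congrArg star (mul_eq_self_of_star_mul_self hW hp)
  have hAW : A * W = 0 := by rw [← hAp, mul_assoc, hpW, mul_zero]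
  have hBW : B * W = 0 := by rw [← hBp, mul_assoc, hpW, mul_zero]
  have hWA : star W * A = 0 := by rw [← hpA, ← mul_assoc, hWp, zero_mul]
  have hWB : star W * B = 0 := by rw [← hpB, ← mul_assoc, hWp, zero_mul]
  have r1 : ∀ x, star W * (W * x) = p * x := fun x => by rw [← mul_assoc, hW]
  have r2 : ∀ x, A * (W * x) = 0 := fun x => by rw [← mul_assoc, hAW, zero_mul]
  have r3 : ∀ x, B * (W * x) = 0 := fun x => by rw [← mul_assoc, hBW, zero_mul]
  have r5 : ∀ x, star W * (B * x) = 0 := fun x => by rw [← mul_assoc, hWB, zero_mul]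
  have r6 : ∀ x, p * (A * x) = A * x := fun x => by rw [← mul_assoc, hpA]
  have r8 : ∀ x, B * (B * x) = A * x - A * (A * x) := fun x => by
    rw [← mul_assoc, hBB, sub_mul, mul_assoc]
  have r9 : ∀ x, B * (A * x) = A * (B * x) := fun x => by rw [← mul_assoc, hBA, mul_assoc]
  simp only [rotProj, mul_add, add_mul, mul_sub, sub_mul, mul_assoc, r1, r2, r3, r5, r6, r8,
    r9, hWA, hBB, hBA, hpB, hpW', mul_zero]
  abel

/-- The Leibniz rule applied to each summand. As `A` and `B` absorb `q`, the terms containing them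
only require `W` to intertwine `f` with itself on the range of `q`, which is much smaller than the
domain of `W`. The summand `W W*` has no such cutoff and is therefore estimated by a hypothesis of
its own. -/
theorem hsNorm_commutator_rotProj_le {f q : H →L[ℂ] H} {a b d e : ℝ≥0∞}
    (hA : star A = A) (hB : star B = B) (hAn : ‖A‖ ≤ 1) (hBn : ‖B‖ ≤ 1) (hWn : ‖W‖ ≤ 1)
    (hq : star q = q) (hqA : q * A = A) (hqB : q * B = B)
    (h1 : hsNorm (f * A - A * f) ≤ a) (h2 : hsNorm (f * B - B * f) ≤ b)
    (h3 : hsNorm (f * W * q - W * f * q) ≤ d) (h4 : hsNorm (star f * W * q - W * star f * q) ≤ d)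
    (h5 : hsNorm (f * (W * star W) - W * star W * f) ≤ e) :
    hsNorm (f * rotProj A B W - rotProj A B W * f) ≤ 2 * a + 2 * b + 4 * d + e := by
  have hWn' : ‖star W‖ ≤ 1 := by rwa [norm_star]
  have hAq : A * q = A := by simpa [hq, hA] using congrArg star hqA
  have hBq : B * q = B := by simpa [hq, hB] using congrArg star hqB
  set Y := f * W * q - W * f * q with hY
  set Y' := star f * W * q - W * star f * q with hY'
  -- Commuting `f` past `star W` is the adjoint of commuting `star f` past `W`, which explains `h4`.
  have eY' : star Y' = q * star W * f - q * f * star W := by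
    rw [hY']
    simp [star_sub, star_mul, hq, mul_assoc]
  have eB : B * star Y' = B * star W * f - B * f * star W := by
    simp only [eY', mul_sub, ← mul_assoc, hBq]
  have eA : W * A * star Y' = W * A * star W * f - W * A * f * star W := by
    rw [mul_assoc W A (star Y')]
    simp only [eY', mul_sub, ← mul_assoc]
    simp only [mul_assoc W A q, hAq]
  have c1 : f * (B * star W) - B * star W * f
      = (f * B - B * f) * star W - B * star Y' := by
    rw [eB]
    noncomm_ring
  have c2 : f * (W * B) - W * B * f = Y * B + W * (f * B - B * f) := by
    rw [hY, sub_mul, mul_assoc _ q, mul_assoc _ q, hqB]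
    noncomm_ring
  have c3 : f * (W * A * star W) - W * A * star W * f
      = Y * A * star W + W * (f * A - A * f) * star W - W * A * star Y' := by
    rw [eA, hY, sub_mul, mul_assoc _ q, mul_assoc _ q, hqA]
    noncomm_ring
  have e0 : f * rotProj A B W - rotProj A B W * f
      = (f * A - A * f) + ((f * B - B * f) * star W - B * star Y')
        + (Y * B + W * (f * B - B * f)) + (f * (W * star W) - W * star W * f)
        - (Y * A * star W + W * (f * A - A * f) * star W - W * A * star Y') := by
    rw [← c1, ← c2, ← c3, rotProj]
    noncomm_ring
  rw [e0]
  have s4 : hsNorm (star Y') ≤ d := by rwa [hsNorm_star]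
  have t1 : hsNorm ((f * B - B * f) * star W - B * star Y') ≤ b + d :=
    (hsNorm_sub_le _ _).trans (add_le_add ((hsNorm_mul_le_right hWn' _).trans h2)
      ((hsNorm_mul_le_left hBn _).trans s4))
  have t2 : hsNorm (Y * B + W * (f * B - B * f)) ≤ d + b :=
    (hsNorm_add_le _ _).trans (add_le_add ((hsNorm_mul_le_right hBn _).trans h3)
      ((hsNorm_mul_le_left hWn _).trans h2))
  have t3 : hsNorm (Y * A * star W + W * (f * A - A * f) * star W - W * A * star Y')
      ≤ d + a + d := by
    refine (hsNorm_sub_le _ _).trans (add_le_add ((hsNorm_add_le _ _).trans (add_le_add ?_ ?_)) ?_)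
    · exact (hsNorm_mul_le_right hWn' _).trans ((hsNorm_mul_le_right hAn _).trans h3)
    · exact (hsNorm_mul_le_right hWn' _).trans ((hsNorm_mul_le_left hWn _).trans h1)
    · rw [mul_assoc]
      exact (hsNorm_mul_le_left hWn _).trans ((hsNorm_mul_le_left hAn _).trans s4)
  refine (hsNorm_sub_le _ _).trans ((add_le_add ((hsNorm_add_le _ _).trans (add_le_add
    ((hsNorm_add_le _ _).trans (add_le_add ((hsNorm_add_le _ _).trans (add_le_add h1 t1)) t2))
    h5)) t3).trans (le_of_eq ?_))
  ring

/-- Pairing the identity with `x` gives `‖A x‖² + ‖B x‖² = ⟨A x, x⟩ ≤ ‖A x‖ ‖x‖`. -/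
theorem norm_le_one_of_sq_add_sq (hA : star A = A) (hB : star B = B)
    (h : A * A + B * B = A) : ‖A‖ ≤ 1 ∧ ‖B‖ ≤ 1 := by
  have key : ∀ x, ‖A x‖ ^ 2 + ‖B x‖ ^ 2 ≤ ‖A x‖ * ‖x‖ := by
    intro x
    have e1 : ∀ T : H →L[ℂ] H, star T = T → ‖T x‖ ^ 2 = (⟪(T * T) x, x⟫_ℂ).re := by
      intro T hT
      rw [mul_apply_eq_comp, ← ContinuousLinearMap.adjoint_inner_right,
        ← ContinuousLinearMap.star_eq_adjoint, hT, inner_self_eq_norm_sq_to_K]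
      norm_cast
    rw [e1 A hA, e1 B hB, ← Complex.add_re, ← inner_add_left, ← add_apply, h]
    exact (Complex.re_le_norm _).trans (norm_inner_le_norm _ _)
  have hAx : ∀ x, ‖A x‖ ≤ ‖x‖ := by
    intro x
    by_contra! hx
    nlinarith [key x, norm_nonneg x, sq_nonneg ‖B x‖]
  have hBx : ∀ x, ‖B x‖ ≤ ‖x‖ := fun x => by
    refine abs_le_of_sq_le_sq' ?_ (norm_nonneg x) |>.2
    nlinarith [key x, hAx x, norm_nonneg x, sq_nonneg ‖A x‖]
  exact ⟨A.opNorm_le_bound zero_le_one (by simpa using hAx),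
    B.opNorm_le_bound zero_le_one (by simpa using hBx)⟩

/-- The corner `(1 - Q) f S` is small if `f` is close to an operator that commutes with `Q`. -/
theorem hsNorm_corner_le {f g Q S χ : H →L[ℂ] H} {r s : ℝ} (hQ : ‖1 - Q‖ ≤ 1) (hr : 0 ≤ r)
    (hfg : ‖(f - g) * χ‖ ≤ r) (hg : Commute g Q) (hQS : Q * S = S) (hχ : χ * S = S)
    (hS : hsNorm S ≤ ENNReal.ofReal s) :
    hsNorm ((1 - Q) * f * S) ≤ ENNReal.ofReal (r * s) := by
  have e : (1 - Q) * f * S = (1 - Q) * (((f - g) * χ) * S) := by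
    have : (1 - Q) * (g * S) = 0 := by
      rw [sub_mul, one_mul, ← mul_assoc, ← hg.eq, mul_assoc, hQS, sub_self]
    rw [mul_assoc _ χ, hχ, sub_mul f g, mul_sub, this, sub_zero, mul_assoc]
  rw [e]
  refine (hsNorm_mul_le_left hQ _).trans ((hsNorm_mul_le_of_norm_le hfg _).trans ?_)
  rw [ENNReal.ofReal_mul hr]
  gcongr

end Rotation

end LipAlg

end

noncomputable section

namespace LipAlg

/-! ### Almost commuting projections above a given term of a flag. -/

section Existence

variable {H : Type*} [NormedAddCommGroup H] [InnerProductSpace ℂ H] [CompleteSpace H]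

theorem abs_cos_sq_sub_le (x y : ℝ) : |Real.cos x ^ 2 - Real.cos y ^ 2| ≤ |x - y| := by
  have e : Real.cos x ^ 2 - Real.cos y ^ 2 = (Real.cos (2 * x) - Real.cos (2 * y)) / 2 := by
    rw [Real.cos_two_mul, Real.cos_two_mul]; ring
  have h := Real.abs_cos_sub_cos_le (2 * x) (2 * y)
  rw [← mul_sub, abs_mul, abs_two] at h
  rw [e, abs_div, abs_two]
  linarith

theorem abs_cos_mul_sin_sub_le (x y : ℝ) :
    |Real.cos x * Real.sin x - Real.cos y * Real.sin y| ≤ |x - y| := by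
  have e : Real.cos x * Real.sin x - Real.cos y * Real.sin y
      = (Real.sin (2 * x) - Real.sin (2 * y)) / 2 := by
    rw [Real.sin_two_mul, Real.sin_two_mul]; ring
  have h := Real.abs_sin_sub_sin_le (2 * x) (2 * y)
  rw [← mul_sub, abs_mul, abs_two] at h
  rw [e, abs_div, abs_two]
  linarith

theorem norm_one_sub_le_one {q : H →L[ℂ] H} (h1 : star q = q) (h2 : q * q = q) :
    ‖1 - q‖ ≤ 1 :=
  norm_le_one_of_idem (by rw [star_sub, star_one, h1])
    (by simp only [sub_mul, mul_sub, h2, one_mul, mul_one, sub_self, sub_zero])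

/-- A slowly decreasing pair `A = cos² θ`, `B = cos θ sin θ` along a flag. -/
theorem exists_flag_cutoff {p : ℕ → H →L[ℂ] H} (hp : IsFlag p) (𝓕 : Set (H →L[ℂ] H))
    (hstar : ∀ f ∈ 𝓕, star f ∈ 𝓕) {c : ℝ} (hc : 0 ≤ c)
    (h : ∀ f ∈ 𝓕, ∀ l i, l ≤ i →
      hsNorm ((1 - p i) * f * p l) ≤ ENNReal.ofReal (c * (2 ^ l / 2 ^ i)))
    {ε : ℝ} (hε : 0 < ε) :
    ∃ (K : ℕ) (A B : H →L[ℂ] H), star A = A ∧ star B = B ∧ p K * A = A ∧ p K * B = B ∧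
      B * B = A - A * A ∧ B * A = A * B ∧ A * p 0 = p 0 ∧ B * p 0 = 0 ∧
      (∀ T, (∀ i, Commute T (p i)) → Commute T A ∧ Commute T B) ∧
      ∀ f ∈ 𝓕, hsNorm (f * A - A * f) ≤ ENNReal.ofReal ε ∧
        hsNorm (f * B - B * f) ≤ ENNReal.ofReal ε := by
  -- With steps of size at most `2 / K` the commutator bound is `4 c (2 / K) √K = 8 c / √K`.
  obtain ⟨K, hK⟩ := exists_nat_gt ((8 * c / ε) ^ 2)
  have hK0 : 0 < (K : ℝ) := lt_of_le_of_lt (by positivity) hK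
  have hbd : 4 * c * (2 / K) * √K ≤ ε := by
    have h1 : 8 * c / ε ≤ √K := Real.le_sqrt_of_sq_le hK.le
    rw [div_le_iff₀ hε] at h1
    have h2 : √(K : ℝ) * √K = K := Real.mul_self_sqrt hK0.le
    have h3 : 0 < √(K : ℝ) := Real.sqrt_pos.2 hK0
    have e : 4 * c * (2 / K) * √K = 8 * c / √K := by
      field_simp
      rw [sq, h2]; ring
    rw [e, div_le_iff₀ h3]
    linarith
  -- At `i = 0` the pair `(cos² θ, cos θ sin θ)` is `(1, 0)`, so the cutoff fixes `p 0`; at `i = K`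
  -- both entries vanish, as Abel summation requires.
  set θ : ℕ → ℝ := fun i => Real.pi / 2 * (i / K) with hθ
  have hθK : θ K = Real.pi / 2 := by simp [hθ, div_self hK0.ne']
  have hθ0 : θ 0 = 0 := by simp [hθ]
  have hstep : ∀ i, |θ i - θ (i + 1)| ≤ 2 / K := by
    intro i
    have e : θ i - θ (i + 1) = -(Real.pi / 2 / K) := by
      simp only [hθ]; push_cast; field_simp; ring
    rw [e, abs_neg, abs_of_nonneg (by positivity)]
    gcongr
    linarith [Real.pi_le_four]
  have hcomm : ∀ (a : ℕ → ℝ) (T : H →L[ℂ] H), (∀ i, Commute T (p i)) →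
      Commute T (flagDiag p K a) := by
    intro a T hT
    refine Commute.sum_right _ _ _ fun l _ => Commute.smul_right ?_ _
    cases l with
    | zero => exact hT 0
    | succ l => exact (hT _).sub_right (hT _)
  refine ⟨K, flagDiag p K fun i => Real.cos (θ i) ^ 2,
    flagDiag p K fun i => Real.cos (θ i) * Real.sin (θ i), hp.star_diag _ _, hp.star_diag _ _,
    hp.mul_diag _ _, hp.mul_diag _ _, ?_, ?_, ?_, ?_, fun T hT => ⟨hcomm _ T hT, hcomm _ T hT⟩,
    fun f hf => ⟨?_, ?_⟩⟩
  · rw [hp.diag_mul_diag, hp.diag_mul_diag, flagDiag, flagDiag, flagDiag,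
      ← Finset.sum_sub_distrib]
    refine Finset.sum_congr rfl fun l _ => ?_
    rw [← sub_smul, ← Complex.ofReal_sub]
    congr 2
    have := Real.sin_sq_add_cos_sq (θ l)
    have e : Real.sin (θ l) ^ 2 = 1 - Real.cos (θ l) ^ 2 := by linarith
    linear_combination Real.cos (θ l) ^ 2 * e
  · rw [hp.diag_mul_diag, hp.diag_mul_diag]
    congr 1; ext l; ring
  · rw [hp.diag_mul_zero]; simp [hθ0]
  · rw [hp.diag_mul_zero]; simp [hθ0]
  · refine (hp.hsNorm_commutator_diag_le hc (δ := 2 / K) (by positivity) (h f hf)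
      (h _ (hstar f hf)) K _ (by simp [hθK]) fun i _ => ?_).trans (ENNReal.ofReal_le_ofReal hbd)
    exact (abs_cos_sq_sub_le _ _).trans (hstep i)
  · refine (hp.hsNorm_commutator_diag_le hc (δ := 2 / K) (by positivity) (h f hf)
      (h _ (hstar f hf)) K _ (by simp [hθK]) fun i _ => ?_).trans (ENNReal.ofReal_le_ofReal hbd)
    exact (abs_cos_mul_sin_sub_le _ _).trans (hstep i)

theorem exists_div_two_pow_lt (a : ℝ) {ε : ℝ} (hε : 0 < ε) : ∃ N : ℕ, ∀ M, N ≤ M →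
    a / 2 ^ M ≤ ε := by
  have h : Tendsto (fun N : ℕ => a / 2 ^ N) atTop (𝓝 0) := by
    have := tendsto_pow_atTop_nhds_zero_of_lt_one (r := (1 / 2 : ℝ)) (by norm_num) (by norm_num)
    have h2 := this.const_mul a
    rw [mul_zero] at h2
    refine h2.congr fun N => ?_
    rw [one_div, inv_pow, div_eq_mul_inv]
  obtain ⟨N, hN⟩ := eventually_atTop.1 (h.eventually_le_const hε)
  exact ⟨N, hN⟩

/-- The main construction, for abstract operators: `p` is an increasing sequence of
projections of rank `O(4 ^ i)`, and the operators in `𝓕` are, up to `O(2 ^ -i)`, given by operators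
in `𝒟 i`, which commute with `p i`. If all `p N` can be moved to an orthogonal place by a partial
isometry that almost commutes with `𝓕`, then some finite projection above `p n` almost commutes
with `𝓕`. -/
theorem exists_almost_commuting_projection {p : ℕ → H →L[ℂ] H} (hp : IsFlag p)
    {χ : H →L[ℂ] H} (hχ : ∀ i, χ * p i = p i) (𝓕 : Set (H →L[ℂ] H))
    (hstar : ∀ f ∈ 𝓕, star f ∈ 𝓕) (𝒟 : ℕ → Set (H →L[ℂ] H))
    (happrox : ∀ f ∈ 𝓕, ∀ i, ∃ g ∈ 𝒟 i, ‖(f - g) * χ‖ ≤ 2 / 2 ^ i)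
    (hcomm : ∀ i, ∀ g ∈ 𝒟 i, Commute g (p i)) {c : ℝ} (hc : 0 ≤ c)
    (hHS : ∀ i, hsNorm (p i) ≤ ENNReal.ofReal (c * 2 ^ i)) (𝒞 : Set (H →L[ℂ] H))
    (h𝒞 : ∀ T ∈ 𝒞, star T = T) (h𝒞p : ∀ T ∈ 𝒞, ∀ i, Commute T (p i))
    (hW : ∀ N L : ℕ, ∃ (W : H →L[ℂ] H) (M : ℕ), N ≤ M ∧ star W * W = p N ∧ p N * W = 0 ∧
      p M * W = W ∧ (∀ g ∈ 𝒟 N, Commute g W) ∧ (∀ g ∈ 𝒟 L, Commute g (W * star W)) ∧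
      ∀ T ∈ 𝒞, Commute T W)
    (n : ℕ) {ε : ℝ} (hε : 0 < ε) :
    ∃ (P : H →L[ℂ] H) (M : ℕ), n ≤ M ∧ star P = P ∧ P * P = P ∧ P * p n = p n ∧ p M * P = P ∧
      (∀ f ∈ 𝓕, hsNorm (f * P - P * f) ≤ ENNReal.ofReal ε) ∧ ∀ T ∈ 𝒞, Commute T P := by
  have hone : ∀ i, ‖1 - p i‖ ≤ 1 := fun i =>
    norm_one_sub_le_one (hp.star_eq i) (hp.mul_left i i le_rfl)
  -- The flag is restarted at level `n`, so that the cutoff equals `1` on `p n`. The corners are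
  -- bounded by `(2 / 2 ^ (n + i)) (c 2 ^ (n + l))`, whence the constant `2 * c`.
  obtain ⟨K, A, B, hA, hB, hKA, hKB, hBB, hBA, hA0, hB0, hAB, hcut⟩ :=
    exists_flag_cutoff (hp.shift n) 𝓕 hstar (c := 2 * c) (by positivity) (fun f hf l i hli => by
      obtain ⟨g, hg, hfg⟩ := happrox f hf (n + i)
      have := hsNorm_corner_le (hone (n + i)) (by positivity) hfg (hcomm _ g hg)
        (hp.mul_right (n + l) (n + i) (by lia)) (hχ (n + l)) (hHS _)
      convert this using 2
      rw [pow_add, pow_add]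
      field_simp) (ε := ε / 8) (by positivity)
  set j := n + K with hj
  -- The order of the choices matters: `A` and `B` live at level `j`; then `N` is so fine that the
  -- error `2 ^ -N` beats the size `2 ^ j` of `p j`; then `L` is so fine that `2 ^ -L` beats the
  -- size `2 ^ N` of the range of `W`.
  obtain ⟨N0, hN0⟩ := exists_div_two_pow_lt (4 * c * 2 ^ j) (ε := ε / 16) (by positivity)
  set N := max N0 j with hN
  obtain ⟨L, hL⟩ := exists_div_two_pow_lt (4 * c * 2 ^ N) (ε := ε / 4) (by positivity)
  obtain ⟨W, M, hNM, hWW, hpW, hMW, hWD, hWD', hWC⟩ := hW N L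
  have hpN := hp.mul_left N N le_rfl
  have hjN : j ≤ N := le_max_right _ _
  have hWn : ‖W‖ ≤ 1 := norm_le_one_of_star_mul_self hWW hpN
  have hWn' : ‖star W‖ ≤ 1 := by rwa [norm_star]
  have hWp : W * p N = W := mul_eq_self_of_star_mul_self hWW hpN
  have hNA : p N * A = A := by
    rw [← hKA, ← mul_assoc]
    exact congrArg (· * A) (hp.mul_right _ _ hjN)
  have hNB : p N * B = B := by
    rw [← hKB, ← mul_assoc]
    exact congrArg (· * B) (hp.mul_right _ _ hjN)
  have hχW : χ * W = W := by rw [← hMW, ← mul_assoc, hχ]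
  obtain ⟨hAn, hBn⟩ := norm_le_one_of_sq_add_sq hA hB (by rw [hBB]; abel)
  -- Replace `f` by an element of `𝒟 N`, which commutes with `W` exactly. The two errors are each at
  -- most `(2 / 2 ^ N) (c 2 ^ j)`.
  have hintertwine : ∀ f ∈ 𝓕, hsNorm (f * W * p j - W * f * p j) ≤ ENNReal.ofReal (ε / 16) := by
    intro f hf
    obtain ⟨g, hg, hfg⟩ := happrox f hf N
    have e : f * W * p j - W * f * p j
        = ((f - g) * χ) * (W * p j) - W * (((f - g) * χ) * p j) := by
      rw [mul_assoc _ χ (p j), hχ, mul_assoc _ χ, ← mul_assoc χ, hχW, sub_mul, sub_mul, mul_sub,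
        ← mul_assoc g, (hWD g hg).eq]
      noncomm_ring
    rw [e]
    have b1 : hsNorm (W * p j) ≤ ENNReal.ofReal (c * 2 ^ j) :=
      (hsNorm_mul_le_left hWn _).trans (hHS j)
    refine (hsNorm_sub_le _ _).trans ((add_le_add
      ((hsNorm_mul_le_of_norm_le hfg _).trans (mul_le_mul_right b1 _))
      ((hsNorm_mul_le_left hWn _).trans ((hsNorm_mul_le_of_norm_le hfg _).trans
        (mul_le_mul_right (hHS j) _)))).trans ?_)
    rw [← ENNReal.ofReal_mul (by positivity), ← ENNReal.ofReal_add (by positivity) (by positivity)]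
    refine ENNReal.ofReal_le_ofReal (le_of_eq_of_le ?_ (hN0 N (le_max_left _ _)))
    ring
  have hrange : ∀ f ∈ 𝓕, hsNorm (f * (W * star W) - W * star W * f) ≤ ENNReal.ofReal (ε / 4) := by
    set Q := W * star W with hQ
    have hQs : star Q = Q := by rw [hQ, star_mul, star_star]
    have hQQ : Q * Q = Q := by
      rw [hQ, mul_assoc, ← mul_assoc (star W), hWW, ← mul_assoc, hWp]
    have hQ1 := norm_one_sub_le_one hQs hQQ
    have hQHS : hsNorm Q ≤ ENNReal.ofReal (c * 2 ^ N) := by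
      rw [hQ, ← hWp]
      refine (hsNorm_mul_le_right ?_ _).trans ((hsNorm_mul_le_left hWn _).trans (hHS N))
      rwa [hWp]
    have corner : ∀ f ∈ 𝓕, hsNorm ((1 - Q) * f * Q) ≤ ENNReal.ofReal (ε / 8) := by
      intro f hf
      obtain ⟨g, hg, hfg⟩ := happrox f hf L
      refine (hsNorm_corner_le hQ1 (by positivity) hfg (hWD' g hg) hQQ
        (by rw [hQ, ← mul_assoc, hχW]) hQHS).trans (ENNReal.ofReal_le_ofReal ?_)
      have := hL L le_rfl
      have e : 2 / 2 ^ L * (c * 2 ^ N) = 4 * c * 2 ^ N / 2 ^ L / 2 := by ring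
      linarith
    intro f hf
    have e : f * Q - Q * f = (1 - Q) * f * Q - star ((1 - Q) * star f * Q) := by
      rw [star_mul, hQs, star_mul, star_star, star_sub, hQs, star_one]
      noncomm_ring
    rw [e]
    refine (hsNorm_sub_le _ _).trans ?_
    rw [hsNorm_star]
    refine (add_le_add (corner f hf) (corner _ (hstar f hf))).trans ?_
    rw [← ENNReal.ofReal_add (by positivity) (by positivity)]
    exact ENNReal.ofReal_le_ofReal (by linarith)
  have hpnW : star W * p n = 0 := by
    have h1 : star W * p N = 0 := by simpa [hp.star_eq] using congrArg star hpW
    rw [← hp.mul_right n N (by lia), ← mul_assoc, h1, zero_mul]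
  have hA0' : A * p n = p n := by simpa using hA0
  have hB0' : B * p n = 0 := by simpa using hB0
  refine ⟨rotProj A B W, M, by lia, star_rotProj hA hB,
    rotProj_mul_self hA hB hWW hpN hpW hNA hNB hBB hBA, ?_, ?_, fun f hf => ?_, fun T hT => ?_⟩
  · simp only [rotProj, add_mul, sub_mul, mul_assoc, hpnW, hA0', hB0', mul_zero]
    simp
  · have hMA : p M * A = A := by rw [← hNA, ← mul_assoc, hp.mul_right _ _ hNM]
    have hMB : p M * B = B := by rw [← hNB, ← mul_assoc, hp.mul_right _ _ hNM]
    simp only [rotProj, mul_add, mul_sub, ← mul_assoc, hMA, hMB, hMW]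
  -- The budget is `2 (ε / 8) + 2 (ε / 8) + 4 (ε / 16) + ε / 4 = ε`.
  · refine (hsNorm_commutator_rotProj_le hA hB hAn hBn hWn (hp.star_eq j) hKA hKB
      (hcut f hf).1 (hcut f hf).2 (hintertwine f hf) (hintertwine _ (hstar f hf))
      (hrange f hf)).trans ?_
    rw [← ENNReal.ofReal_ofNat 2, ← ENNReal.ofReal_ofNat 4, ← ENNReal.ofReal_mul (by positivity),
      ← ENNReal.ofReal_mul (by positivity), ← ENNReal.ofReal_add (by positivity) (by positivity),
      ← ENNReal.ofReal_add (by positivity) (by positivity),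
      ← ENNReal.ofReal_add (by positivity) (by positivity)]
    exact ENNReal.ofReal_le_ofReal (by linarith)
  · obtain ⟨hTA, hTB⟩ := hAB T fun i => h𝒞p T hT (n + i)
    have hTW := hWC T hT
    have hTW' : Commute T (star W) := by simpa [h𝒞 T hT] using hTW.star_star
    exact (((hTA.add_right (hTB.mul_right hTW')).add_right (hTW.mul_right hTB)).add_right
      (hTW.mul_right hTW')).sub_right ((hTW.mul_right hTA).mul_right hTW')

end Existence

end LipAlg

end

noncomputable section

namespace LipAlg

/-! ### Projections and partial isometries given by finite orthogonal families -/

section OrthogonalFamilies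

open InnerProductSpace (rankOne)

variable {H : Type*} [NormedAddCommGroup H] [InnerProductSpace ℂ H]

/-- The unit vector in the direction of `x`, or `0` if `x = 0`. -/
def unitize (x : H) : H := ((‖x‖⁻¹ : ℝ) : ℂ) • x

@[simp] theorem unitize_zero : unitize (0 : H) = 0 := by simp [unitize]

theorem norm_unitize {x : H} (hx : x ≠ 0) : ‖unitize x‖ = 1 := by
  rw [unitize, norm_smul, Complex.norm_real, norm_inv, norm_norm]
  exact inv_mul_cancel₀ (norm_ne_zero_iff.2 hx)

theorem norm_unitize_le (x : H) : ‖unitize x‖ ≤ 1 := by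
  by_cases hx : x = 0
  · simp [hx]
  · exact (norm_unitize hx).le

theorem inner_unitize_eq_zero {x y : H} (h : ⟪x, y⟫_ℂ = 0) : ⟪unitize x, unitize y⟫_ℂ = 0 := by
  rw [unitize, unitize, inner_smul_left, inner_smul_right, h, mul_zero, mul_zero]

theorem unitize_mem_of_apply_eq {T : H →L[ℂ] H} {x : H} {κ : ℂ} (h : T x = κ • x) :
    T (unitize x) = κ • unitize x := by
  rw [unitize, map_smul, h, smul_comm]

/-- The partial isometry that maps the direction of `x a` to the direction of `y a`. -/
def transfer {ι : Type*} (s : Finset ι) (y x : ι → H) : H →L[ℂ] H :=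
  ∑ a ∈ s, rankOne ℂ (unitize (y a)) (unitize (x a))

variable {ι : Type*} {s : Finset ι} {x y z : ι → H}

/-- Zero vectors must be admitted in the families, because a cell may meet `Ω` in a null set. The
condition `h0` ensures that no direction is lost in the middle factor. -/
theorem transfer_mul_transfer
    (hy : ∀ a ∈ s, ∀ b ∈ s, a ≠ b → ⟪y a, y b⟫_ℂ = 0) (h0 : ∀ a ∈ s, y a = 0 → x a = 0) :
    transfer s z y * transfer s y x = transfer s z x := by
  rw [transfer, transfer, transfer, Finset.sum_mul]
  refine Finset.sum_congr rfl fun a ha => ?_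
  rw [Finset.mul_sum, Finset.sum_eq_single_of_mem a ha]
  · rw [ContinuousLinearMap.mul_def, InnerProductSpace.rankOne_comp_rankOne]
    by_cases hya : y a = 0
    · simp [hya, h0 a ha hya]
    · rw [inner_self_eq_norm_sq_to_K, norm_unitize hya]
      simp
  · intro b hb hab
    rw [ContinuousLinearMap.mul_def, InnerProductSpace.rankOne_comp_rankOne,
      inner_unitize_eq_zero (hy a ha b hb hab.symm), zero_smul]

theorem transfer_mul_transfer_eq_zero {x' y' : ι → H} {s' : Finset ι}
    (h : ∀ a ∈ s', ∀ b ∈ s, ⟪x' a, y b⟫_ℂ = 0) : transfer s' y' x' * transfer s y x = 0 := by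
  rw [transfer, transfer, Finset.sum_mul]
  refine Finset.sum_eq_zero fun a ha => ?_
  rw [Finset.mul_sum]
  refine Finset.sum_eq_zero fun b hb => ?_
  rw [ContinuousLinearMap.mul_def, InnerProductSpace.rankOne_comp_rankOne,
    inner_unitize_eq_zero (h a ha b hb), zero_smul]

theorem mul_transfer_of_fix {T : H →L[ℂ] H} (h : ∀ a ∈ s, T (y a) = y a) :
    T * transfer s y x = transfer s y x := by
  rw [transfer, Finset.mul_sum]
  refine Finset.sum_congr rfl fun a ha => ?_
  rw [ContinuousLinearMap.mul_def, InnerProductSpace.comp_rankOne,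
    unitize_mem_of_apply_eq (κ := 1) (by rw [one_smul, h a ha]), one_smul]

theorem transfer_apply_self (hx : ∀ a ∈ s, ∀ b ∈ s, a ≠ b → ⟪x a, x b⟫_ℂ = 0) {a : ι}
    (ha : a ∈ s) : transfer s x x (x a) = x a := by
  rw [transfer, sum_apply, Finset.sum_eq_single_of_mem a ha]
  · by_cases hxa : x a = 0
    · simp [hxa]
    · have : (‖x a‖ : ℂ) ≠ 0 := by exact_mod_cast norm_ne_zero_iff.2 hxa
      rw [InnerProductSpace.rankOne_apply, unitize, inner_smul_left, inner_self_eq_norm_sq_to_K,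
        smul_smul, Complex.conj_ofReal]
      have e : (((‖x a‖⁻¹ : ℝ) : ℂ) * ((‖x a‖ : ℝ) : ℂ) ^ 2 * ((‖x a‖⁻¹ : ℝ) : ℂ)) = 1 := by
        push_cast; field_simp
      exact (congrArg (· • x a) e).trans (one_smul _ _)
  · intro b hb hab
    rw [InnerProductSpace.rankOne_apply, unitize, inner_smul_left, hx b hb a ha hab]
    simp

theorem finiteDimensional_range_transfer : FiniteDimensional ℂ (transfer s y x).range := by
  have hle : (transfer s y x).range
      ≤ Submodule.span ℂ ((fun a => unitize (y a)) '' (s : Set ι)) := by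
    rintro _ ⟨v, rfl⟩
    have e : transfer s y x v = ∑ a ∈ s, ⟪unitize (x a), v⟫_ℂ • unitize (y a) := by
      simp [transfer, sum_apply]
    change transfer s y x v ∈ _
    rw [e]
    exact Submodule.sum_mem _ fun a ha => Submodule.smul_mem _ _
      (Submodule.subset_span ⟨a, ha, rfl⟩)
  have : FiniteDimensional ℂ (Submodule.span ℂ ((fun a => unitize (y a)) '' (s : Set ι))) :=
    FiniteDimensional.span_of_finite ℂ (s.finite_toSet.image _)
  exact Submodule.finiteDimensional_of_le hle

variable [CompleteSpace H]

theorem star_transfer : star (transfer s y x) = transfer s x y := by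
  rw [transfer, star_sum]
  refine Finset.sum_congr rfl fun a _ => ?_
  rw [ContinuousLinearMap.star_eq_adjoint, InnerProductSpace.adjoint_rankOne]

/-- Each rank one summand commutes with `T` because its two vectors are eigenvectors for the same
eigenvalue; `κ` is real, so acting from the right gives no conjugate. -/
theorem commute_transfer {T : H →L[ℂ] H} (hT : star T = T)
    (h : ∀ a ∈ s, ∃ κ : ℝ, T (x a) = (κ : ℂ) • x a ∧ T (y a) = (κ : ℂ) • y a) :
    Commute T (transfer s y x) := by
  refine Commute.sum_right _ _ _ fun a ha => ?_
  obtain ⟨κ, h1, h2⟩ := h a ha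
  rw [Commute, SemiconjBy, ContinuousLinearMap.mul_def, ContinuousLinearMap.mul_def,
    InnerProductSpace.comp_rankOne, InnerProductSpace.rankOne_comp,
    ← ContinuousLinearMap.star_eq_adjoint, hT, unitize_mem_of_apply_eq h1,
    unitize_mem_of_apply_eq h2]
  ext v
  rw [InnerProductSpace.rankOne_apply, InnerProductSpace.rankOne_apply, inner_smul_left,
    Complex.conj_ofReal, smul_comm, smul_smul]

theorem hsSq_transfer_self_le (hx : ∀ a ∈ s, ∀ b ∈ s, a ≠ b → ⟪x a, x b⟫_ℂ = 0) :
    hsSq (transfer s x x) ≤ s.card := by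
  rw [transfer, hsSq_sum_of_star_mul_eq_zero]
  · have h1 : ∀ a, ‖unitize (x a)‖ₑ ≤ 1 := fun a => by
      rw [← ofReal_norm]; simpa using ENNReal.ofReal_le_ofReal (norm_unitize_le (x a))
    refine (Finset.sum_le_card_nsmul s _ 1 fun a _ => ?_).trans (by simp)
    rw [hsSq_rankOne]
    exact mul_le_one' (pow_le_one' (h1 a) 2) (pow_le_one' (h1 a) 2)
  · intro a ha b hb hab
    rw [ContinuousLinearMap.star_eq_adjoint, InnerProductSpace.adjoint_rankOne,
      ContinuousLinearMap.mul_def, InnerProductSpace.rankOne_comp_rankOne,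
      inner_unitize_eq_zero (hx a ha b hb hab), zero_smul]

end OrthogonalFamilies

end LipAlg

end

noncomputable section

namespace LipAlg

/-! ### Multiplication operators and essentially Lipschitz functions -/

section Multiplication

variable {Ω : Set ℂ}

theorem mulOp_mul_comm (f g : Lp ℂ ∞ (leb Ω)) : mulOp f * mulOp g = mulOp g * mulOp f := by
  ext1 x
  refine Lp.ext ?_
  rw [mul_apply_eq_comp, mul_apply_eq_comp]
  filter_upwards [mulOp_apply_ae f (mulOp g x), mulOp_apply_ae g (mulOp f x), mulOp_apply_ae f x,
    mulOp_apply_ae g x] with z h1 h2 h3 h4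
  rw [h1, h2, h3, h4]; ring

/-- Multiplication by the indicator function of a measurable set. -/
def chi (Ω : Set ℂ) {A : Set ℂ} (hA : MeasurableSet A) : BL2 Ω := mulOp (indLinf Ω A hA)

variable {A B : Set ℂ} (hA : MeasurableSet A) (hB : MeasurableSet B)

theorem chi_apply_ae (x : L2 Ω) : chi Ω hA x =ᵐ[leb Ω] A.indicator x := by
  have h : (indLinf Ω A hA) =ᵐ[leb Ω] A.indicator fun _ => (1 : ℂ) := MemLp.coeFn_toLp _
  filter_upwards [mulOp_apply_ae (indLinf Ω A hA) x, h] with z h1 h2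
  rw [chi, h1, h2]
  by_cases hz : z ∈ A <;> simp [hz]

theorem chi_mul_chi : chi Ω hA * chi Ω hB = chi Ω (hA.inter hB) := by
  ext1 x
  refine Lp.ext ?_
  rw [mul_apply_eq_comp]
  filter_upwards [chi_apply_ae hA (chi Ω hB x), chi_apply_ae hB x,
    chi_apply_ae (hA.inter hB) x] with z h1 h2 h3
  rw [h1, h3, ← Set.indicator_indicator]
  by_cases hz : z ∈ A <;> simp [hz, h2]

theorem chi_mul_self : chi Ω hA * chi Ω hA = chi Ω hA := by
  rw [chi_mul_chi]
  congr 1; simp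

theorem commute_chi_mulOp (f : Lp ℂ ∞ (leb Ω)) : Commute (chi Ω hA) (mulOp f) :=
  mulOp_mul_comm _ _

theorem star_chi : star (chi Ω hA) = chi Ω hA := by
  rw [chi, star_mulOp]
  congr 1
  refine Lp.ext ?_
  have h : (indLinf Ω A hA) =ᵐ[leb Ω] A.indicator fun _ => (1 : ℂ) := MemLp.coeFn_toLp _
  filter_upwards [Lp.coeFn_star (indLinf Ω A hA), h] with z h1 h2
  rw [h1, Pi.star_apply, h2]
  by_cases hz : z ∈ A <;> simp [hz]

theorem norm_chi_le : ‖chi Ω hA‖ ≤ 1 := norm_le_one_of_idem (star_chi hA) (chi_mul_self hA)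

theorem chi_mul_chi_of_subset (h : A ⊆ B) : chi Ω hA * chi Ω hB = chi Ω hA := by
  rw [chi_mul_chi]
  congr 1; exact Set.inter_eq_left.2 h

theorem chi_mul_chi_of_subset' (h : A ⊆ B) : chi Ω hB * chi Ω hA = chi Ω hA := by
  rw [chi_mul_chi]
  congr 1; exact Set.inter_eq_right.2 h

theorem chi_mul_chi_of_disjoint (h : Disjoint A B) : chi Ω hA * chi Ω hB = 0 := by
  rw [chi_mul_chi]
  ext1 x
  refine Lp.ext ?_
  filter_upwards [chi_apply_ae (hA.inter hB) x, Lp.coeFn_zero ℂ 2 (leb Ω)] with z h1 h2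
  rw [h1, zero_apply, h2]
  simp [h.inter_eq]

theorem Lp_finset_sum_ae {ι : Type*} (s : Finset ι) (v : ι → L2 Ω) :
    ((∑ i ∈ s, v i : L2 Ω) : ℂ → ℂ) =ᵐ[leb Ω] fun z => ∑ i ∈ s, v i z := by
  classical
  induction s using Finset.induction_on with
  | empty =>
    filter_upwards [Lp.coeFn_zero ℂ 2 (leb Ω)] with z h
    simp only [Finset.sum_empty]
    exact h
  | insert i s hi ih =>
    rw [Finset.sum_insert hi]
    filter_upwards [Lp.coeFn_add (v i) (∑ j ∈ s, v j), ih] with z h1 h2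
    rw [h1, Pi.add_apply, h2, Finset.sum_insert hi]

theorem sum_chi {ι : Type*} (s : Finset ι) {C : ι → Set ℂ} (hC : ∀ i, MeasurableSet (C i))
    (h : ∀ z, ∑ i ∈ s, (C i).indicator (1 : ℂ → ℂ) z = B.indicator 1 z) :
    ∑ i ∈ s, chi Ω (hC i) = chi Ω hB := by
  ext1 x
  refine Lp.ext ?_
  rw [sum_apply]
  have h1 : ∀ᵐ z ∂leb Ω, ∀ i ∈ s, chi Ω (hC i) x z = (C i).indicator x z :=
    (Filter.eventually_all_finset s).2 fun i _ => chi_apply_ae (hC i) x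
  filter_upwards [Lp_finset_sum_ae s fun i => chi Ω (hC i) x, h1, chi_apply_ae hB x]
    with z h2 h3 h4
  rw [h2, h4, Finset.sum_congr rfl h3]
  have e : ∀ D : Set ℂ, D.indicator x z = D.indicator (1 : ℂ → ℂ) z * x z := fun D => by
    by_cases hz : z ∈ D <;> simp [hz]
  simp only [e]
  rw [← Finset.sum_mul, h z]

theorem enorm_sq_eq_lintegral (x : L2 Ω) : ‖x‖ₑ ^ 2 = ∫⁻ z, ‖x z‖ₑ ^ 2 ∂leb Ω := by
  rw [Lp.enorm_def, eLpNorm_eq_lintegral_rpow_enorm_toReal (by norm_num) (by norm_num),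
    ← ENNReal.rpow_natCast, ← ENNReal.rpow_mul]
  norm_num

theorem enorm_chi_apply_sq (x : L2 Ω) :
    ‖chi Ω hA x‖ₑ ^ 2 = ∫⁻ z in A, ‖x z‖ₑ ^ 2 ∂leb Ω := by
  rw [enorm_sq_eq_lintegral, ← lintegral_indicator hA]
  refine lintegral_congr_ae ?_
  filter_upwards [chi_apply_ae hA x] with z h
  rw [h]
  by_cases hz : z ∈ A <;> simp [hz]

theorem tendsto_chi_ball (x : L2 Ω) :
    Tendsto (fun n : ℕ => chi Ω (measurableSet_ball (x := (0 : ℂ)) (ε := n)) x) atTop (𝓝 x) := by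
  have h0 : Tendsto (fun n : ℕ => ∫⁻ z, (Metric.ball (0 : ℂ) n)ᶜ.indicator (fun z => ‖x z‖ₑ ^ 2) z
      ∂leb Ω) atTop (𝓝 0) := by
    rw [← lintegral_zero (μ := leb Ω)]
    refine tendsto_lintegral_of_dominated_convergence' (fun z => ‖x z‖ₑ ^ 2) (fun n => ?_)
      (fun n => Eventually.of_forall fun z => Set.indicator_le_self _ _ z) ?_
      (Eventually.of_forall fun z => ?_)
    · exact (((Lp.stronglyMeasurable x).measurable.enorm.pow_const 2).indicator
        measurableSet_ball.compl).aemeasurable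
    · rw [← enorm_sq_eq_lintegral]; simp
    · obtain ⟨N, hN⟩ := exists_nat_gt ‖z‖
      refine tendsto_const_nhds.congr' (eventually_atTop.2 ⟨N, fun n hn => ?_⟩)
      have : ‖z‖ < n := hN.trans_le (by exact_mod_cast hn)
      simp [this]
  have h1 : ∀ n : ℕ, ‖chi Ω (measurableSet_ball (x := (0 : ℂ)) (ε := n)) x - x‖ₑ ^ 2
      = ∫⁻ z, (Metric.ball (0 : ℂ) n)ᶜ.indicator (fun z => ‖x z‖ₑ ^ 2) z ∂leb Ω := by
    intro n
    rw [enorm_sq_eq_lintegral]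
    refine lintegral_congr_ae ?_
    filter_upwards [Lp.coeFn_sub (chi Ω (measurableSet_ball (x := (0 : ℂ)) (ε := n)) x) x,
      chi_apply_ae (measurableSet_ball (x := (0 : ℂ)) (ε := n)) x] with z h2 h3
    rw [h2, Pi.sub_apply, h3]
    by_cases hz : z ∈ Metric.ball (0 : ℂ) n
    · simp [hz]
    · rw [Set.indicator_of_notMem hz, Set.indicator_of_mem (by exact hz)]; simp
  rw [tendsto_iff_edist_tendsto_0]
  simp only [edist_eq_enorm_sub]
  have h2 := (h0.congr fun n => (h1 n).symm).ennrpow_const (1 / 2 : ℝ)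
  rw [ENNReal.zero_rpow_of_pos (by norm_num)] at h2
  refine h2.congr fun n => ?_
  rw [← ENNReal.rpow_natCast, ← ENNReal.rpow_mul]
  norm_num

/-- The bound is put in iterated form so that a good point `s` can be fixed first, after which
almost every `t` is admissible. -/
theorem ae_prod_lipschitz {f : Lp ℂ ∞ (leb Ω)} (h : lipNorm f ≤ 1) :
    ∀ᵐ s ∂leb Ω, ∀ᵐ t ∂leb Ω, ‖f s - f t‖ ≤ ‖s - t‖ := by
  refine Measure.ae_ae_of_ae_prod (p := fun p : ℂ × ℂ => ‖f p.1 - f p.2‖ ≤ ‖p.1 - p.2‖) ?_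
  have h1 := ae_le_eLpNormEssSup (f := diffQuot f) (μ := (leb Ω).prod (leb Ω))
  filter_upwards [h1] with p hp
  have h2 : ‖diffQuot f p‖ₑ ≤ 1 := hp.trans (by rwa [lipNorm, eLpNorm_exponent_top] at h)
  have h3 : ‖diffQuot f p‖ ≤ 1 := by
    rwa [← ofReal_norm, ENNReal.ofReal_le_one] at h2
  by_cases hp2 : p.1 = p.2
  · simp [hp2]
  · rwa [diffQuot, norm_div, div_le_one (norm_pos_iff.2 (sub_ne_zero.2 hp2))] at h3

/-- On a set of diameter `≤ r` an essentially Lipschitz function is constant up to `r`. -/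
theorem exists_ae_near_const {f : Lp ℂ ∞ (leb Ω)} (h : lipNorm f ≤ 1) {r : ℝ}
    (hr : ∀ s ∈ A, ∀ t ∈ A, ‖s - t‖ ≤ r) :
    ∃ c : ℂ, ∀ᵐ z ∂leb Ω, z ∈ A → ‖f z - c‖ ≤ r := by
  by_cases hA0 : leb Ω A = 0
  · refine ⟨0, ?_⟩
    filter_upwards [measure_eq_zero_iff_ae_notMem.1 hA0] with z hz hz'
    exact absurd hz' hz
  -- The constant is the value at a generic point of `A`; such a point exists because `A` has
  -- positive measure in `Ω`.
  · obtain ⟨s, hsA, hs⟩ := ((frequently_ae_mem_iff.2 hA0).and_eventually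
      (ae_prod_lipschitz h)).exists
    refine ⟨f s, ?_⟩
    filter_upwards [hs] with t ht htA
    rw [norm_sub_rev]
    exact ht.trans (hr s hsA t htA)

/-- If `f` is within `r` of `c` on `A`, then `(M_f - c) χ_A` has norm at most `r`. -/
theorem norm_mulOp_sub_smul_mul_chi_le {f : Lp ℂ ∞ (leb Ω)} {r : ℝ} (hr : 0 ≤ r) {c : ℂ}
    (h : ∀ᵐ z ∂leb Ω, z ∈ A → ‖f z - c‖ ≤ r) :
    ‖(mulOp f - c • (1 : BL2 Ω)) * chi Ω hA‖ ≤ r := by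
  refine ContinuousLinearMap.opNorm_le_bound _ hr fun x => ?_
  refine Lp.norm_le_mul_norm_of_ae_le_mul ?_
  have e : ((mulOp f - c • (1 : BL2 Ω)) * chi Ω hA) x
      = mulOp f (chi Ω hA x) - c • chi Ω hA x := by
    simp [mul_apply_eq_comp]
  rw [e]
  filter_upwards [h, Lp.coeFn_sub (mulOp f (chi Ω hA x)) (c • chi Ω hA x),
    mulOp_apply_ae f (chi Ω hA x), Lp.coeFn_smul c (chi Ω hA x), chi_apply_ae hA x]
    with z h1 h2 h3 h4 h5
  rw [h2, Pi.sub_apply, h3, h4, Pi.smul_apply, h5, smul_eq_mul, ← sub_mul]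
  by_cases hz : z ∈ A
  · rw [Set.indicator_of_mem hz, norm_mul]
    exact mul_le_mul_of_nonneg_right (h1 hz) (norm_nonneg _)
  · rw [Set.indicator_of_notMem hz, mul_zero, norm_zero]
    positivity

/-- A bounded Lipschitz function defines an element of `Λ(Ω)`. -/
theorem exists_essLip_of_lipschitz {F : ℂ → ℂ} {C : ℝ} (hC : ∀ z, ‖F z‖ ≤ C)
    (hF : ∀ s t, ‖F s - F t‖ ≤ ‖s - t‖) :
    ∃ f : Lp ℂ ∞ (leb Ω), f ∈ essLip Ω ∧ lipNorm f ≤ 1 ∧ f =ᵐ[leb Ω] F := by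
  have hcont : Continuous F := by
    have : LipschitzWith 1 F := LipschitzWith.of_dist_le_mul fun s t => by
      simpa [dist_eq_norm] using hF s t
    exact this.continuous
  have hm : MemLp F ∞ (leb Ω) := memLp_top_of_bound hcont.aestronglyMeasurable C
    (Eventually.of_forall hC)
  have hle : lipNorm hm.toLp ≤ 1 := by
    have hb : ∀ᵐ p ∂(leb Ω).prod (leb Ω), ‖diffQuot hm.toLp p‖ ≤ 1 := by
      filter_upwards [(Measure.quasiMeasurePreserving_fst (μ := leb Ω) (ν := leb Ω)).ae
        hm.coeFn_toLp, (Measure.quasiMeasurePreserving_snd (μ := leb Ω) (ν := leb Ω)).ae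
        hm.coeFn_toLp] with p h1 h2
      rw [diffQuot, h1, h2, norm_div]
      exact div_le_one_of_le₀ (hF _ _) (norm_nonneg _)
    rw [lipNorm, eLpNorm_exponent_top]
    simpa using eLpNormEssSup_le_of_ae_bound hb
  exact ⟨hm.toLp, ⟨(measurable_diffQuot _).aestronglyMeasurable, hle.trans_lt ENNReal.one_lt_top⟩,
    hle, hm.coeFn_toLp⟩

end Multiplication

end LipAlg

end

noncomputable section

namespace LipAlg

/-! ### Cells: dyadic squares intersected with annuli -/

section Cells

/-- The annulus of width one and the dyadic square of side `2 ^ -j` that contain `z`. -/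
def lab (j : ℕ) (z : ℂ) : ℕ × ℤ × ℤ := (⌊‖z‖⌋₊, ⌊2 ^ j * z.re⌋, ⌊2 ^ j * z.im⌋)

theorem measurable_lab (j : ℕ) : Measurable (lab j) :=
  (Nat.measurable_floor.comp measurable_norm).prodMk
    ((Int.measurable_floor.comp (Complex.measurable_re.const_mul _)).prodMk
      (Int.measurable_floor.comp (Complex.measurable_im.const_mul _)))

/-- The cells of level `j`. -/
def cell (j : ℕ) (a : ℕ × ℤ × ℤ) : Set ℂ := lab j ⁻¹' {a}

theorem measurableSet_cell (j : ℕ) (a : ℕ × ℤ × ℤ) : MeasurableSet (cell j a) :=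
  measurable_lab j (measurableSet_singleton a)

theorem disjoint_cell {j : ℕ} {a b : ℕ × ℤ × ℤ} (h : a ≠ b) : Disjoint (cell j a) (cell j b) :=
  Disjoint.preimage _ (Set.disjoint_singleton.2 h)

/-- The labels of the cells of level `j` in the ball of radius `n`. -/
def index (n j : ℕ) : Finset (ℕ × ℤ × ℤ) :=
  Finset.range n ×ˢ Finset.Icc (-(n * 2 ^ j : ℤ)) (n * 2 ^ j) ×ˢ
    Finset.Icc (-(n * 2 ^ j : ℤ)) (n * 2 ^ j)

theorem lab_mem_index {n : ℕ} {z : ℂ} (hz : ‖z‖ < n) (j : ℕ) : lab j z ∈ index n j := by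
  have key : ∀ x : ℝ, |x| ≤ ‖z‖ → ⌊2 ^ j * x⌋ ∈ Finset.Icc (-(n * 2 ^ j : ℤ)) (n * 2 ^ j) := by
    intro x hx
    have h1 := abs_le.1 (hx.trans hz.le)
    have hp : (0 : ℝ) < 2 ^ j := by positivity
    rw [Finset.mem_Icc]
    constructor
    · rw [Int.le_floor]
      push_cast
      nlinarith [h1.1]
    · have : ((⌊2 ^ j * x⌋ : ℤ) : ℝ) ≤ ((n * 2 ^ j : ℤ) : ℝ) := by
        refine (Int.floor_le _).trans ?_
        push_cast
        nlinarith [h1.2]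
      exact_mod_cast this
  rw [index, Finset.mem_product, Finset.mem_product]
  refine ⟨?_, key _ (Complex.abs_re_le_norm z), key _ (Complex.abs_im_le_norm z)⟩
  rw [Finset.mem_range]
  exact (Nat.floor_lt (norm_nonneg z)).2 hz

theorem cell_subset_ball {n j : ℕ} {a : ℕ × ℤ × ℤ} (ha : a ∈ index n j) :
    cell j a ⊆ Metric.ball (0 : ℂ) n := by
  intro z hz
  rw [index, Finset.mem_product, Finset.mem_range] at ha
  have h : lab j z = a := hz
  rw [← h] at ha
  rw [mem_ball_zero_iff]
  exact (Nat.floor_lt (norm_nonneg z)).1 ha.1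

/-- The bound is crude in `n` and is written as a square, since the Hilbert-Schmidt norm of a
projection is the square root of its rank. Only the growth `4 ^ j` matters. -/
theorem card_index_le (n j : ℕ) : (index n j).card ≤ ((2 * n + 1) ^ 2 * 2 ^ j) ^ 2 := by
  have h1 : ((n * 2 ^ j : ℤ) + 1 - -(n * 2 ^ j : ℤ)).toNat = 2 * n * 2 ^ j + 1 := by
    have : ((n * 2 ^ j : ℤ) + 1 - -(n * 2 ^ j : ℤ)) = ((2 * n * 2 ^ j + 1 : ℕ) : ℤ) := by
      push_cast; ring
    rw [this, Int.toNat_natCast]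
  rw [index, Finset.card_product, Finset.card_product, Finset.card_range, Int.card_Icc, h1]
  have h2 : 2 * n * 2 ^ j + 1 ≤ (2 * n + 1) * 2 ^ j := by
    have := Nat.one_le_two_pow (n := j)
    nlinarith
  have h3 : n ≤ (2 * n + 1) ^ 2 := by nlinarith
  calc n * ((2 * n * 2 ^ j + 1) * (2 * n * 2 ^ j + 1))
      ≤ (2 * n + 1) ^ 2 * (((2 * n + 1) * 2 ^ j) * ((2 * n + 1) * 2 ^ j)) := by gcongr
    _ = _ := by ring

theorem abs_sub_le_of_floor_eq {x y : ℝ} {j : ℕ} (h : ⌊2 ^ j * x⌋ = ⌊2 ^ j * y⌋) :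
    |x - y| ≤ 1 / 2 ^ j := by
  have h1 := Int.abs_sub_lt_one_of_floor_eq_floor h
  rw [← mul_sub, abs_mul, abs_of_pos (by positivity)] at h1
  rw [le_div_iff₀ (by positivity), mul_comm]
  exact h1.le

theorem norm_sub_le_of_lab_eq {j : ℕ} {s t : ℂ} (h : lab j s = lab j t) :
    ‖s - t‖ ≤ 2 / 2 ^ j := by
  simp only [lab, Prod.mk.injEq] at h
  have h1 := abs_sub_le_of_floor_eq h.2.1
  have h2 := abs_sub_le_of_floor_eq h.2.2
  have h3 := Complex.norm_le_abs_re_add_abs_im (s - t)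
  rw [Complex.sub_re, Complex.sub_im] at h3
  have e : (2 : ℝ) / 2 ^ j = 1 / 2 ^ j + 1 / 2 ^ j := by ring
  linarith

/-- The coarser floor is the integer quotient of the finer one by `2 ^ (j - i)`, and the annulus
does not depend on the level. -/
theorem lab_eq_of_le {i j : ℕ} (hij : i ≤ j) {s t : ℂ} (h : lab j s = lab j t) :
    lab i s = lab i t := by
  have key : ∀ x y : ℝ, ⌊2 ^ j * x⌋ = ⌊2 ^ j * y⌋ → ⌊2 ^ i * x⌋ = ⌊2 ^ i * y⌋ := by
    intro x y hxy
    have e : ∀ x : ℝ, ⌊2 ^ i * x⌋ = ⌊2 ^ j * x⌋ / ((2 ^ (j - i) : ℕ) : ℤ) := by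
      intro x
      rw [← Int.floor_div_natCast]
      congr 1
      push_cast
      rw [eq_div_iff (by positivity), mul_right_comm, ← pow_add, Nat.add_sub_cancel' hij]
    rw [e, e, hxy]
  simp only [lab, Prod.mk.injEq] at h ⊢
  exact ⟨h.1, key _ _ h.2.1, key _ _ h.2.2⟩

/-- The sets that are unions of cells of level `j`. -/
def Saturated (j : ℕ) (A : Set ℂ) : Prop := ∀ s t, lab j s = lab j t → s ∈ A → t ∈ A

theorem saturated_cell {i j : ℕ} (hij : i ≤ j) (a : ℕ × ℤ × ℤ) : Saturated j (cell i a) :=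
  fun _ _ h hs => (lab_eq_of_le hij h).symm.trans hs

/-- This is the purpose of the annuli in the labels: balls of integer radius are unions of cells at
every level, so their indicators commute with all operators built cell by cell. -/
theorem saturated_ball (j m : ℕ) : Saturated j (Metric.ball (0 : ℂ) m) := by
  intro s t h hs
  simp only [lab, Prod.mk.injEq] at h
  rw [mem_ball_zero_iff] at hs ⊢
  rw [← Nat.floor_lt (norm_nonneg _)] at hs ⊢
  rwa [← h.1]

theorem Saturated.inter {j : ℕ} {A B : Set ℂ} (hA : Saturated j A) (hB : Saturated j B) :
    Saturated j (A ∩ B) := fun s t h hs => ⟨hA s t h hs.1, hB s t h hs.2⟩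

theorem Saturated.diff {j : ℕ} {A B : Set ℂ} (hA : Saturated j A) (hB : Saturated j B) :
    Saturated j (A \ B) := fun s t h hs => ⟨hA s t h hs.1, fun ht => hs.2 (hB t s h.symm ht)⟩

theorem Saturated.mono {i j : ℕ} (hij : i ≤ j) {A : Set ℂ} (hA : Saturated i A) :
    Saturated j A := fun s t h hs => hA s t (lab_eq_of_le hij h) hs

theorem Saturated.cell_subset_or_disjoint {j : ℕ} {A : Set ℂ} (hA : Saturated j A)
    (a : ℕ × ℤ × ℤ) : cell j a ⊆ A ∨ Disjoint (cell j a) A := by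
  by_cases h : ∃ z ∈ cell j a, z ∈ A
  · obtain ⟨z, hz, hzA⟩ := h
    refine Or.inl fun t ht => hA z t ?_ hzA
    rw [show lab j z = a from hz, show lab j t = a from ht]
  · push Not at h
    exact Or.inr (Set.disjoint_left.2 h)

theorem exists_volume_cell_lt (N : ℕ) {ε : ℝ≥0∞} (hε : 0 < ε) :
    ∃ M, N ≤ M ∧ ∀ a, volume (cell M a) < ε := by
  have hb : ∀ M a, volume (cell M a) ≤ ENNReal.ofReal (2 / 2 ^ M) ^ 2 * NNReal.pi := by
    intro M a
    by_cases h : (cell M a).Nonempty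
    · obtain ⟨z, hz⟩ := h
      rw [← Complex.volume_closedBall z]
      refine measure_mono fun t ht => ?_
      rw [Metric.mem_closedBall, dist_eq_norm]
      refine norm_sub_le_of_lab_eq ?_
      rw [show lab M z = a from hz, show lab M t = a from ht]
    · rw [Set.not_nonempty_iff_eq_empty.1 h, measure_empty]; exact zero_le
  have ht : Tendsto (fun M : ℕ => ENNReal.ofReal (2 / 2 ^ M) ^ 2 * (NNReal.pi : ℝ≥0∞)) atTop
      (𝓝 0) := by
    have h1 : Tendsto (fun M : ℕ => (2 : ℝ) / 2 ^ M) atTop (𝓝 0) :=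
      tendsto_const_nhds.div_atTop (tendsto_pow_atTop_atTop_of_one_lt (by norm_num))
    have h2 := ENNReal.Tendsto.mul_const (b := (NNReal.pi : ℝ≥0∞))
      (ENNReal.Tendsto.pow (n := 2) (ENNReal.tendsto_ofReal h1)) (Or.inr ENNReal.coe_ne_top)
    simpa using h2
  obtain ⟨M, hM, hNM⟩ := ((ht.eventually_lt_const hε).and (eventually_ge_atTop N)).exists
  exact ⟨M, hNM, fun a => (hb M a).trans_lt hM⟩

end Cells

/-! ### Projections onto step functions. -/

section CellProjections

variable {Ω : Set ℂ}

theorem inner_chi_chi_of_disjoint {A B : Set ℂ} (hA : MeasurableSet A) (hB : MeasurableSet B)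
    (h : Disjoint A B) (x y : L2 Ω) : ⟪chi Ω hA x, chi Ω hB y⟫_ℂ = 0 := by
  rw [← ContinuousLinearMap.adjoint_inner_right, ← ContinuousLinearMap.star_eq_adjoint, star_chi,
    ← mul_apply_eq_comp, chi_mul_chi_of_disjoint hA hB h]
  simp

theorem inner_chi_left {A : Set ℂ} (hA : MeasurableSet A) (x y : L2 Ω) :
    ⟪chi Ω hA x, y⟫_ℂ = ⟪x, chi Ω hA y⟫_ℂ := by
  rw [← ContinuousLinearMap.adjoint_inner_right, ← ContinuousLinearMap.star_eq_adjoint, star_chi]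

/-- The indicator function of the ball of radius `n`, as an element of `L²(Ω)`. -/
def ballVec (Ω : Set ℂ) (n : ℕ) : L2 Ω :=
  indicatorConstLp 2 (measurableSet_ball (x := (0 : ℂ)) (ε := n))
    ((Measure.restrict_apply_le _ _).trans_lt measure_ball_lt_top).ne 1

theorem ballVec_ae (n : ℕ) :
    ballVec Ω n =ᵐ[leb Ω] (Metric.ball (0 : ℂ) n).indicator fun _ => 1 := indicatorConstLp_coeFn

theorem chi_ballVec {A : Set ℂ} (hA : MeasurableSet A) {n m : ℕ}
    (hn : A ⊆ Metric.ball (0 : ℂ) n) (hm : A ⊆ Metric.ball (0 : ℂ) m) :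
    chi Ω hA (ballVec Ω n) = chi Ω hA (ballVec Ω m) := by
  refine Lp.ext ?_
  filter_upwards [chi_apply_ae hA (ballVec Ω n), chi_apply_ae hA (ballVec Ω m),
    ballVec_ae (Ω := Ω) n, ballVec_ae (Ω := Ω) m] with z h1 h2 h3 h4
  rw [h1, h2]
  by_cases hz : z ∈ A
  · rw [Set.indicator_of_mem hz, Set.indicator_of_mem hz, h3, h4, Set.indicator_of_mem (hn hz),
      Set.indicator_of_mem (hm hz)]
  · rw [Set.indicator_of_notMem hz, Set.indicator_of_notMem hz]

theorem enorm_chi_ballVec_sq_le {A : Set ℂ} (hA : MeasurableSet A) (n : ℕ) :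
    ‖chi Ω hA (ballVec Ω n)‖ₑ ^ 2 ≤ volume A := by
  rw [enorm_chi_apply_sq]
  calc ∫⁻ z in A, ‖ballVec Ω n z‖ₑ ^ 2 ∂leb Ω ≤ ∫⁻ _ in A, 1 ∂leb Ω := by
        refine lintegral_mono_ae (ae_restrict_of_ae ?_)
        filter_upwards [ballVec_ae (Ω := Ω) n] with z h
        rw [h]
        by_cases hz : z ∈ Metric.ball (0 : ℂ) n
        · rw [Set.indicator_of_mem hz]; simp
        · rw [Set.indicator_of_notMem hz]; simp
    _ ≤ volume A := by
        rw [setLIntegral_one]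
        exact Measure.restrict_apply_le _ _

theorem sum_chi_cell_inter {A : Set ℂ} (hA : MeasurableSet A) {n : ℕ}
    (hn : A ⊆ Metric.ball (0 : ℂ) n) (j : ℕ) :
    ∑ a ∈ index n j, chi Ω ((measurableSet_cell j a).inter hA) = chi Ω hA := by
  refine sum_chi hA _ _ fun z => ?_
  by_cases hz : z ∈ A
  · rw [Finset.sum_eq_single_of_mem (lab j z) (lab_mem_index (mem_ball_zero_iff.1 (hn hz)) j)]
    · rw [Set.indicator_of_mem (show z ∈ cell j (lab j z) ∩ A from ⟨rfl, hz⟩),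
        Set.indicator_of_mem hz]
    · intro b _ hb
      exact Set.indicator_of_notMem (fun h => hb (show lab j z = b from h.1).symm) _
  · rw [Set.indicator_of_notMem hz]
    exact Finset.sum_eq_zero fun b _ => Set.indicator_of_notMem (fun h => hz h.2) _

theorem exists_chi_cell_inter_ne_zero {A : Set ℂ} (hA : MeasurableSet A) {n : ℕ}
    (hn : A ⊆ Metric.ball (0 : ℂ) n) (j : ℕ) {x : L2 Ω} (hx : chi Ω hA x ≠ 0) :
    ∃ a ∈ index n j, chi Ω ((measurableSet_cell j a).inter hA) x ≠ 0 := by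
  by_contra! h
  refine hx ?_
  rw [← sum_chi_cell_inter hA hn j, sum_apply]
  exact Finset.sum_eq_zero h

theorem chi_empty_apply {A : Set ℂ} (hA : MeasurableSet A) (h : A = ∅) (x : L2 Ω) :
    chi Ω hA x = 0 := by
  have := chi_mul_chi_of_disjoint (Ω := Ω) hA hA (by simp [h])
  rw [← chi_mul_self, this]; rfl

/-- The (unnormalised) indicator function of a cell. -/
def cellVec (Ω : Set ℂ) (n j : ℕ) (a : ℕ × ℤ × ℤ) : L2 Ω :=
  chi Ω (measurableSet_cell j a) (ballVec Ω n)

/-- The projection onto the functions that vanish outside the ball of radius `n` and are constant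
on the cells of level `j`. -/
def cellProj (Ω : Set ℂ) (n j : ℕ) : BL2 Ω :=
  transfer (index n j) (cellVec Ω n j) (cellVec Ω n j)

theorem cellVec_orthogonal (n j : ℕ) : ∀ a ∈ index n j, ∀ b ∈ index n j, a ≠ b →
    ⟪cellVec Ω n j a, cellVec Ω n j b⟫_ℂ = 0 := fun _ _ _ _ h =>
  inner_chi_chi_of_disjoint _ _ (disjoint_cell h) _ _

theorem chi_cell_cellVec (n j : ℕ) (a : ℕ × ℤ × ℤ) :
    chi Ω (measurableSet_cell j a) (cellVec Ω n j a) = cellVec Ω n j a := by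
  rw [cellVec, ← mul_apply_eq_comp, chi_mul_self]

/-- A union of cells inside the ball has an indicator that is a sum of cell vectors. The second
radius `m` makes it possible to compare cell projections for different balls. -/
theorem cellProj_chi_ballVec {n m j : ℕ} {A : Set ℂ} (hA : MeasurableSet A)
    (hn : A ⊆ Metric.ball (0 : ℂ) n) (hm : A ⊆ Metric.ball (0 : ℂ) m) (hs : Saturated j A) :
    cellProj Ω n j (chi Ω hA (ballVec Ω m)) = chi Ω hA (ballVec Ω m) := by
  rw [chi_ballVec hA hm hn, ← sum_chi_cell_inter hA hn j, sum_apply, map_sum]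
  refine Finset.sum_congr rfl fun a ha => ?_
  rcases hs.cell_subset_or_disjoint a with h | h
  · have e : chi Ω ((measurableSet_cell j a).inter hA) (ballVec Ω n) = cellVec Ω n j a := by
      rw [cellVec]
      congr 2
      exact Set.inter_eq_left.2 h
    rw [e]
    exact transfer_apply_self (cellVec_orthogonal n j) ha
  · rw [chi_empty_apply _ h.inter_eq, map_zero]

theorem star_cellProj (n j : ℕ) : star (cellProj Ω n j) = cellProj Ω n j := star_transfer

theorem cellProj_mul_cellProj {n m i j : ℕ} (hnm : n ≤ m) (hij : i ≤ j) :
    cellProj Ω m j * cellProj Ω n i = cellProj Ω n i := by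
  refine mul_transfer_of_fix fun a ha => ?_
  have h := cell_subset_ball ha
  exact cellProj_chi_ballVec _ (h.trans (Metric.ball_subset_ball (by exact_mod_cast hnm))) h
    (saturated_cell hij a)

theorem isFlag_cellProj (Ω : Set ℂ) (n : ℕ) : IsFlag (cellProj Ω n) where
  star_eq i := star_cellProj n i
  mul_right i j h := cellProj_mul_cellProj le_rfl h
  mul_left i j h := by
    simpa [star_cellProj] using congrArg star (cellProj_mul_cellProj (Ω := Ω) (le_refl n) h)

theorem chi_ball_mul_cellProj (n j : ℕ) :
    chi Ω (measurableSet_ball (x := (0 : ℂ)) (ε := n)) * cellProj Ω n j = cellProj Ω n j := by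
  refine mul_transfer_of_fix fun a ha => ?_
  rw [cellVec, ← mul_apply_eq_comp, chi_mul_chi_of_subset' _ _ (cell_subset_ball ha)]

theorem hsNorm_cellProj_le (n j : ℕ) :
    hsNorm (cellProj Ω n j) ≤ ENNReal.ofReal ((2 * n + 1) ^ 2 * 2 ^ j) := by
  refine hsNorm_le_ofReal_of_hsSq_le (by positivity)
    ((hsSq_transfer_self_le (cellVec_orthogonal n j)).trans ?_)
  have h := card_index_le n j
  have e : ((((2 * n + 1) ^ 2 * 2 ^ j) ^ 2 : ℕ) : ℝ) = ((2 * n + 1) ^ 2 * 2 ^ j : ℝ) ^ 2 := by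
    push_cast; ring
  rw [← e, ENNReal.ofReal_natCast]
  exact_mod_cast h

end CellProjections

end LipAlg

end

noncomputable section

namespace LipAlg

/-! ### Almost commuting projections above the cell projections -/

section Step

variable {Ω : Set ℂ}

/-- The step multiplication operators of level `j` on the ball of radius `n`. -/
def stepOps (Ω : Set ℂ) (n j : ℕ) : Set (BL2 Ω) :=
  {T | ∃ c : ℕ × ℤ × ℤ → ℂ, T = ∑ a ∈ index n j, c a • chi Ω (measurableSet_cell j a)}

theorem commute_of_mem_stepOps {n j : ℕ} {T S : BL2 Ω} (hT : T ∈ stepOps Ω n j)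
    (h : ∀ a ∈ index n j, Commute (chi Ω (measurableSet_cell j a)) S) : Commute T S := by
  obtain ⟨c, rfl⟩ := hT
  exact Commute.sum_left _ _ _ fun a ha => (h a ha).smul_left _

/-- Only small oscillation on each cell is assumed, because the statement serves both for Lipschitz
functions and for the continuous functions in the density argument. -/
theorem exists_stepOps_near_of_ae {f : Lp ℂ ∞ (leb Ω)} {r : ℝ} (hr : 0 ≤ r) (n j : ℕ)
    (h0 : ∀ a, ∃ c : ℂ, ∀ᵐ z ∂leb Ω, z ∈ cell j a → ‖f z - c‖ ≤ r) :
    ∃ g ∈ stepOps Ω n j,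
      ‖(mulOp f - g) * chi Ω (measurableSet_ball (x := (0 : ℂ)) (ε := n))‖ ≤ r := by
  choose c hc using h0
  refine ⟨_, ⟨c, rfl⟩, ContinuousLinearMap.opNorm_le_bound _ hr fun x => ?_⟩
  refine Lp.norm_le_mul_norm_of_ae_le_mul ?_
  set y := chi Ω (measurableSet_ball (x := (0 : ℂ)) (ε := n)) x with hy
  have e : ((mulOp f - ∑ a ∈ index n j, c a • chi Ω (measurableSet_cell j a))
      * chi Ω (measurableSet_ball (x := (0 : ℂ)) (ε := n))) x
      = mulOp f y - ∑ a ∈ index n j, c a • chi Ω (measurableSet_cell j a) y := by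
    simp [mul_apply_eq_comp, sum_apply, hy]
  rw [e]
  have h1 : ∀ᵐ z ∂leb Ω, ∀ a, z ∈ cell j a → ‖f z - c a‖ ≤ r := ae_all_iff.2 hc
  have h2 : ∀ᵐ z ∂leb Ω, ∀ a, (c a • chi Ω (measurableSet_cell j a) y : L2 Ω) z
      = c a * (cell j a).indicator y z := by
    refine ae_all_iff.2 fun a => ?_
    filter_upwards [Lp.coeFn_smul (c a) (chi Ω (measurableSet_cell j a) y),
      chi_apply_ae (measurableSet_cell j a) y] with z h3 h4
    rw [h3, Pi.smul_apply, h4, smul_eq_mul]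
  filter_upwards [h1, h2, Lp.coeFn_sub (mulOp f y)
    (∑ a ∈ index n j, c a • chi Ω (measurableSet_cell j a) y), mulOp_apply_ae f y,
    Lp_finset_sum_ae (index n j) (fun a => c a • chi Ω (measurableSet_cell j a) y),
    chi_apply_ae (measurableSet_ball (x := (0 : ℂ)) (ε := n)) x] with z g1 g2 g3 g4 g5 g6
  rw [g3, Pi.sub_apply, g4, g5]
  simp only [g2]
  by_cases hz : z ∈ Metric.ball (0 : ℂ) n
  · rw [Finset.sum_eq_single_of_mem (lab j z) (lab_mem_index (mem_ball_zero_iff.1 hz) j)]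
    · rw [Set.indicator_of_mem (show z ∈ cell j (lab j z) from rfl), ← sub_mul, norm_mul, hy, g6,
        Set.indicator_of_mem hz]
      exact mul_le_mul_of_nonneg_right (g1 _ rfl) (norm_nonneg _)
    · intro b _ hb
      have hzb : z ∉ cell j b := fun h => hb (show lab j z = b from h).symm
      rw [Set.indicator_of_notMem hzb, mul_zero]
  · have hy0 : y z = 0 := by rw [hy, g6, Set.indicator_of_notMem hz]
    have : ∀ a, (cell j a).indicator y z = 0 := fun a => by
      by_cases h : z ∈ cell j a <;> simp [h, hy0]
    simp only [this, hy0, mul_zero, Finset.sum_const_zero, sub_zero, norm_zero]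
    positivity

theorem exists_stepOps_near {f : Lp ℂ ∞ (leb Ω)} (hf : lipNorm f ≤ 1) (n j : ℕ) :
    ∃ g ∈ stepOps Ω n j,
      ‖(mulOp f - g) * chi Ω (measurableSet_ball (x := (0 : ℂ)) (ε := n))‖ ≤ 2 / 2 ^ j :=
  exists_stepOps_near_of_ae (by positivity) n j fun a =>
    exists_ae_near_const hf fun s hs t ht => norm_sub_le_of_lab_eq <| by
      rw [show lab j s = a from hs, show lab j t = a from ht]

/-- A vector concentrated on a set is an eigenvector for the indicator functions of the sets
that contain or avoid this set. -/
theorem exists_chi_eq_smul {A B : Set ℂ} (hA : MeasurableSet A) (hB : MeasurableSet B)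
    (h : A ⊆ B ∨ Disjoint A B) :
    ∃ κ : ℝ, ∀ x : L2 Ω, chi Ω hA x = x → chi Ω hB x = (κ : ℂ) • x := by
  rcases h with h | h
  · refine ⟨1, fun x hx => ?_⟩
    rw [← hx, ← mul_apply_eq_comp, chi_mul_chi_of_subset' hA hB h]; simp
  · refine ⟨0, fun x hx => ?_⟩
    rw [← hx, ← mul_apply_eq_comp, chi_mul_chi_of_disjoint hB hA h.symm]; simp

/-- In every cell of positive measure there is a step function with mean zero that is
concentrated on a single cell of any prescribed level. -/
theorem exists_mean_zero_step {n N : ℕ} (L : ℕ) {a : ℕ × ℤ × ℤ} (ha : a ∈ index n N)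
    (h : cellVec Ω n N a ≠ 0) :
    ∃ (M : ℕ) (y : L2 Ω), y ≠ 0 ∧ (∃ b, chi Ω (measurableSet_cell L b) y = y) ∧
      chi Ω (measurableSet_cell N a) y = y ∧ ⟪cellVec Ω n N a, y⟫_ℂ = 0 ∧
      ∀ M', M ≤ M' → cellProj Ω n M' y = y := by
  set v := ballVec Ω n with hv
  have hQ := measurableSet_cell N a
  have hQn := cell_subset_ball ha
  -- The function to be built will live on `R`, a piece of the cell `a` of positive measure in `Ω`
  -- and contained in one cell of level `L`.
  obtain ⟨b, -, hb⟩ := exists_chi_cell_inter_ne_zero hQ hQn (max L N) h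
  set R := cell (max L N) b ∩ cell N a with hR
  have hRm : MeasurableSet R := (measurableSet_cell _ b).inter hQ
  have hRQ : R ⊆ cell N a := Set.inter_subset_right
  have hRs : Saturated (max L N) R :=
    (saturated_cell le_rfl b).inter (saturated_cell (le_max_right _ _) a)
  -- No cell of level `M` can carry all the mass of `R ∩ Ω`. So a cell `d` that carries some of it
  -- splits `R` into two parts of positive measure.
  obtain ⟨M, hM, hvol⟩ := exists_volume_cell_lt (max L N)
    (ε := ‖chi Ω hRm v‖ₑ ^ 2) (by
      have : ‖chi Ω hRm v‖ₑ ≠ 0 := by simpa using hb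
      exact pos_iff_ne_zero.2 (pow_ne_zero 2 this))
  obtain ⟨d, -, hd⟩ := exists_chi_cell_inter_ne_zero hRm (hRQ.trans hQn) M hb
  have hDm := measurableSet_cell M d
  set v1 := chi Ω (hDm.inter hRm) v with hv1
  set v2 := chi Ω (hRm.diff hDm) v with hv2
  have hsum : v1 + v2 = chi Ω hRm v := by
    have hs := sum_chi (Ω := Ω) (s := Finset.univ) hRm
      (C := fun i : Bool => bif i then cell M d ∩ R else R \ cell M d)
      (fun i => by cases i; exacts [hRm.diff hDm, hDm.inter hRm]) (fun z => by
        by_cases h1 : z ∈ R <;> by_cases h2 : z ∈ cell M d <;> simp [h1, h2])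
    rw [Fintype.sum_bool] at hs
    rw [← hs]; rfl
  have hv2ne : v2 ≠ 0 := by
    intro h2
    rw [h2, add_zero] at hsum
    have h3 := (enorm_chi_ballVec_sq_le (Ω := Ω) (hDm.inter hRm) n).trans
      (measure_mono (μ := volume) Set.inter_subset_left)
    rw [← hv, ← hv1, hsum] at h3
    exact absurd (hvol d) (not_lt.2 h3)
  have horth : ⟪v1, v2⟫_ℂ = 0 :=
    inner_chi_chi_of_disjoint _ _ (Set.disjoint_left.2 fun z hz hz' => hz'.2 hz.1) _ _
  -- The squared norms are the measures of the two parts, so these weights make the mean zero, that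
  -- is, `y` is orthogonal to the indicator of the cell.
  set y : L2 Ω := ((‖v2‖ ^ 2 : ℝ) : ℂ) • v1 - ((‖v1‖ ^ 2 : ℝ) : ℂ) • v2 with hy
  have fixB : ∀ {B : Set ℂ} (hB : MeasurableSet B), R ⊆ B → chi Ω hB y = y := by
    intro B hB hRB
    rw [hy, map_sub, map_smul, map_smul, hv1, hv2, ← mul_apply_eq_comp, ← mul_apply_eq_comp,
      chi_mul_chi_of_subset' _ _ (Set.inter_subset_right.trans hRB),
      chi_mul_chi_of_subset' _ _ (Set.sdiff_subset.trans hRB)]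
  have hRne : R.Nonempty := by
    by_contra hne
    exact hb (chi_empty_apply hRm (Set.not_nonempty_iff_eq_empty.1 hne) v)
  obtain ⟨z, hz⟩ := hRne
  refine ⟨M, y, ?_, ⟨lab L z, fixB _ fun t ht => ?_⟩, fixB hQ hRQ, ?_, fun M' hM' => ?_⟩
  · intro h0
    have h1 : ⟪v1, y⟫_ℂ = 0 := by rw [h0, inner_zero_right]
    rw [hy, inner_sub_right, inner_smul_right, inner_smul_right, horth, mul_zero, sub_zero,
      mul_eq_zero] at h1
    rcases h1 with h1 | h1
    · have : ‖v2‖ ^ 2 = 0 := by exact_mod_cast h1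
      exact hv2ne (norm_eq_zero.1 (pow_eq_zero_iff two_ne_zero |>.1 this))
    · exact hd (inner_self_eq_zero.1 h1)
  · exact lab_eq_of_le (le_max_left L N) ((show lab _ t = b from ht.1).trans
      (show lab _ z = b from hz.1).symm)
  · have e : ∀ {B : Set ℂ} (hB : MeasurableSet B), B ⊆ cell N a →
        ⟪cellVec Ω n N a, chi Ω hB v⟫_ℂ = ((‖chi Ω hB v‖ ^ 2 : ℝ) : ℂ) := by
      intro B hB hBQ
      rw [cellVec, inner_chi_left, ← mul_apply_eq_comp, chi_mul_chi_of_subset' _ _ hBQ]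
      nth_rw 1 [← chi_mul_self hB]
      rw [mul_apply_eq_comp, ← inner_chi_left, inner_self_eq_norm_sq_to_K]
      norm_cast
    rw [hy, inner_sub_right, inner_smul_right, inner_smul_right, hv1, hv2,
      e _ (Set.inter_subset_right.trans hRQ), e _ (Set.sdiff_subset.trans hRQ)]
    ring
  · have e : ∀ {B : Set ℂ} (hB : MeasurableSet B), B ⊆ R → Saturated M B →
        cellProj Ω n M' (chi Ω hB v) = chi Ω hB v := fun hB hBR hs =>
      cellProj_chi_ballVec _ (hBR.trans (hRQ.trans hQn)) (hBR.trans (hRQ.trans hQn)) (hs.mono hM')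
    rw [hy, map_sub, map_smul, map_smul, hv1, hv2,
      e _ Set.inter_subset_right ((saturated_cell le_rfl d).inter (hRs.mono hM)),
      e _ Set.sdiff_subset ((hRs.mono hM).diff (saturated_cell le_rfl d))]

/-- The partial isometries that move the cell projections to an orthogonal place. -/
theorem exists_moving_isometry (Ω : Set ℂ) (n N L : ℕ) : ∃ (W : BL2 Ω) (M : ℕ), N ≤ M ∧
    star W * W = cellProj Ω n N ∧ cellProj Ω n N * W = 0 ∧ cellProj Ω n M * W = W ∧
    (∀ g ∈ stepOps Ω n N, Commute g W) ∧ (∀ g ∈ stepOps Ω n L, Commute g (W * star W)) ∧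
    ∀ m : ℕ, Commute (chi Ω (measurableSet_ball (x := (0 : ℂ)) (ε := m))) W := by
  -- Cells that are null in `Ω` receive the zero vector, so that the cell vector and its image
  -- vanish simultaneously; both implications are used, one for `W* W` and one for `W W*`.
  have key : ∀ a, ∃ (M : ℕ) (y : L2 Ω), a ∈ index n N → ((y = 0 → cellVec Ω n N a = 0) ∧
      (cellVec Ω n N a = 0 → y = 0) ∧ (∃ b, chi Ω (measurableSet_cell L b) y = y) ∧
      chi Ω (measurableSet_cell N a) y = y ∧ ⟪cellVec Ω n N a, y⟫_ℂ = 0 ∧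
      ∀ M', M ≤ M' → cellProj Ω n M' y = y) := by
    intro a
    by_cases ha : a ∈ index n N
    · by_cases h : cellVec Ω n N a = 0
      · exact ⟨0, 0, fun _ => ⟨fun _ => h, fun _ => rfl, ⟨a, map_zero _⟩, map_zero _,
          inner_zero_right _, fun _ _ => map_zero _⟩⟩
      · obtain ⟨M, y, h1, h2, h3, h4, h5⟩ := exists_mean_zero_step L ha h
        exact ⟨M, y, fun _ => ⟨fun h0 => absurd h0 h1, fun h0 => absurd h0 h, h2, h3, h4, h5⟩⟩
    · exact ⟨0, 0, fun h => absurd h ha⟩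
  choose M y hy using key
  have hyorth : ∀ a ∈ index n N, ∀ b ∈ index n N, a ≠ b → ⟪y a, y b⟫_ℂ = 0 := by
    intro a ha b hb hab
    rw [← (hy a ha).2.2.2.1, ← (hy b hb).2.2.2.1]
    exact inner_chi_chi_of_disjoint _ _ (disjoint_cell hab) _ _
  have hxy : ∀ a ∈ index n N, ∀ b ∈ index n N, ⟪cellVec Ω n N a, y b⟫_ℂ = 0 := by
    intro a ha b hb
    by_cases hab : a = b
    · rw [← hab]; exact (hy a ha).2.2.2.2.1
    · rw [← (hy b hb).2.2.2.1]
      exact inner_chi_chi_of_disjoint _ _ (disjoint_cell hab) _ _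
  have hcomm : ∀ {B : Set ℂ} (hB : MeasurableSet B), Saturated N B →
      Commute (chi Ω hB) (transfer (index n N) y (cellVec Ω n N)) := by
    intro B hB hs
    refine commute_transfer (star_chi hB) fun a ha => ?_
    obtain ⟨κ, hκ⟩ := exists_chi_eq_smul (Ω := Ω) (measurableSet_cell N a) hB
      (hs.cell_subset_or_disjoint a)
    exact ⟨κ, hκ _ (chi_cell_cellVec n N a), hκ _ (hy a ha).2.2.2.1⟩
  refine ⟨transfer (index n N) y (cellVec Ω n N), max N ((index n N).sup M), le_max_left _ _,
    ?_, transfer_mul_transfer_eq_zero hxy, mul_transfer_of_fix fun a ha => ?_, fun g hg => ?_,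
    fun g hg => ?_, fun m => hcomm _ (saturated_ball N m)⟩
  · rw [star_transfer]
    exact transfer_mul_transfer hyorth fun a ha => (hy a ha).1
  · exact (hy a ha).2.2.2.2.2 _ ((Finset.le_sup ha).trans (le_max_right _ _))
  · exact commute_of_mem_stepOps hg fun a _ => hcomm _ (saturated_cell le_rfl a)
  -- `W W*` projects onto the span of the `y a`. Each of them sits in a single cell of level `L`,
  -- hence is an eigenvector of every step multiplication of that level.
  · rw [star_transfer, transfer_mul_transfer (cellVec_orthogonal n N) fun a ha => (hy a ha).2.1]
    refine commute_of_mem_stepOps hg fun c _ => commute_transfer (star_chi _) fun a ha => ?_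
    obtain ⟨b, hb⟩ := (hy a ha).2.2.1
    obtain ⟨κ, hκ⟩ := exists_chi_eq_smul (Ω := Ω) (measurableSet_cell L b)
      (measurableSet_cell L c) ((saturated_cell le_rfl c).cell_subset_or_disjoint b)
    exact ⟨κ, hκ _ hb, hκ _ hb⟩

theorem commute_chi_cellProj {B : Set ℂ} (hB : MeasurableSet B) {n j : ℕ} (hs : Saturated j B) :
    Commute (chi Ω hB) (cellProj Ω n j) := by
  refine commute_transfer (star_chi hB) fun a ha => ?_
  obtain ⟨κ, hκ⟩ := exists_chi_eq_smul (Ω := Ω) (measurableSet_cell j a) hB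
    (hs.cell_subset_or_disjoint a)
  exact ⟨κ, hκ _ (chi_cell_cellVec n j a), hκ _ (chi_cell_cellVec n j a)⟩

/-- Above every cell projection there is an almost commuting projection, which is in turn
dominated by a cell projection. -/
theorem exists_almost_commuting_above_cellProj (Ω : Set ℂ) (n j : ℕ) {ε : ℝ} (hε : 0 < ε) :
    ∃ (P : BL2 Ω) (M : ℕ), j ≤ M ∧ star P = P ∧ P * P = P ∧
      P * cellProj Ω n j = cellProj Ω n j ∧ cellProj Ω n M * P = P ∧
      lipL P ≤ ENNReal.ofReal ε ∧
      ∀ m : ℕ, Commute (chi Ω (measurableSet_ball (x := (0 : ℂ)) (ε := m))) P := by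
  obtain ⟨P, M, h1, h2, h3, h4, h5, h6, h7⟩ := exists_almost_commuting_projection
    (isFlag_cellProj Ω n) (chi_ball_mul_cellProj n)
    {T | ∃ f : Lp ℂ ∞ (leb Ω), f ∈ essLip Ω ∧ lipNorm f ≤ 1 ∧ T = mulOp f}
    (by
      rintro _ ⟨f, hf, hf1, rfl⟩
      exact ⟨star f, star_mem_essLip hf, (lipNorm_star f).trans_le hf1, star_mulOp f⟩)
    (stepOps Ω n)
    (by
      rintro _ ⟨f, hf, hf1, rfl⟩ i
      exact exists_stepOps_near hf1 n i)
    (fun i g hg => commute_of_mem_stepOps hg fun a _ =>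
      commute_chi_cellProj _ (saturated_cell le_rfl a))
    (c := (2 * n + 1) ^ 2) (by positivity) (hsNorm_cellProj_le n)
    {T | ∃ m : ℕ, T = chi Ω (measurableSet_ball (x := (0 : ℂ)) (ε := m))}
    (by rintro _ ⟨m, rfl⟩; exact star_chi _)
    (by rintro _ ⟨m, rfl⟩ i; exact commute_chi_cellProj _ (saturated_ball i m))
    (fun N L => by
      obtain ⟨W, M, g1, g2, g3, g4, g5, g6, g7⟩ := exists_moving_isometry Ω n N L
      exact ⟨W, M, g1, g2, g3, g4, g5, g6, by rintro _ ⟨m, rfl⟩; exact g7 m⟩) j hε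
  exact ⟨P, M, h1, h2, h3, h4, h5, iSup₂_le fun f hf => h6 _ ⟨f, hf.1, hf.2, rfl⟩,
    fun m => h7 _ ⟨m, rfl⟩⟩

end Step

end LipAlg

end

noncomputable section

namespace LipAlg

/-! ### Operators of finite rank -/

section FiniteRank

variable {H : Type*} [NormedAddCommGroup H] [InnerProductSpace ℂ H]

theorem isCompactOperator_of_finiteDimensional_range {T : H →L[ℂ] H}
    (h : FiniteDimensional ℂ T.range) : IsCompactOperator T := by
  have h1 : IsCompactOperator (T.rangeRestrict : H →L[ℂ] T.range) := by
    have : ProperSpace T.range := FiniteDimensional.proper ℂ _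
    exact isCompactOperator_of_locallyCompactSpace_dom T.rangeRestrict
  exact h1.clm_comp T.range.subtypeL

theorem finiteDimensional_range_of_comp {H' : Type*} [NormedAddCommGroup H']
    [InnerProductSpace ℂ H'] {T : H →L[ℂ] H} (h : FiniteDimensional ℂ T.range)
    (A : H →L[ℂ] H') (B : H' →L[ℂ] H) : FiniteDimensional ℂ (A ∘L T ∘L B).range := by
  have hle : (A ∘L T ∘L B).range ≤ T.range.map (A : H →ₗ[ℂ] H') := by
    rintro _ ⟨v, rfl⟩
    exact ⟨T (B v), ⟨B v, rfl⟩, rfl⟩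
  exact Submodule.finiteDimensional_of_le hle

variable [CompleteSpace H]

theorem hsNorm_lt_top_of_finiteDimensional_range {T : H →L[ℂ] H}
    (h : FiniteDimensional ℂ T.range) : hsNorm T < ∞ := by
  have e : T = T.range.starProjection * T := by
    ext1 x
    rw [mul_apply_eq_comp]
    exact (Submodule.starProjection_eq_self_iff.2
      (LinearMap.mem_range_self (T : H →ₗ[ℂ] H) x)).symm
  rw [e]
  refine (hsNorm_mul_le' _ _).trans_lt (ENNReal.mul_lt_top ?_ enorm_lt_top)
  let b := stdOrthonormalBasis ℂ T.range
  rw [b.starProjection_eq_sum_rankOne]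
  refine (hsNorm_sum_le _ _).trans_lt (ENNReal.sum_lt_top.2 fun i _ => ?_)
  rw [hsNorm_lt_top_iff, hsSq_rankOne]
  exact ENNReal.mul_lt_top (ENNReal.pow_lt_top enorm_lt_top) (ENNReal.pow_lt_top enorm_lt_top)

end FiniteRank

/-! ### Density of the step functions and the choice of the projections. -/

section Sequence

variable {Ω : Set ℂ}

/-- Hilbert-Schmidt operators that are supported in a ball belong to `EΛ(Ω)`. -/
theorem lipL_lt_top_of_hsNorm_lt_top {T : BL2 Ω} (hT : hsNorm T < ∞) {n : ℕ}
    (h1 : chi Ω (measurableSet_ball (x := (0 : ℂ)) (ε := n)) * T = T)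
    (h2 : T * chi Ω (measurableSet_ball (x := (0 : ℂ)) (ε := n)) = T) : lipL T < ∞ := by
  set χ := chi Ω (measurableSet_ball (x := (0 : ℂ)) (ε := n)) with hχ
  have key : lipL T ≤ ENNReal.ofReal (2 * n) * hsNorm T + ENNReal.ofReal (2 * n) * hsNorm T := by
    refine iSup₂_le fun f hf => ?_
    obtain ⟨c, hc⟩ := exists_ae_near_const (A := Metric.ball (0 : ℂ) n) hf.2 (r := 2 * n)
      fun s hs t ht => by
        rw [mem_ball_zero_iff] at hs ht
        linarith [norm_sub_le s t]
    have hn := norm_mulOp_sub_smul_mul_chi_le (measurableSet_ball (x := (0 : ℂ)) (ε := n))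
      (by positivity) hc
    have hcomm : χ * (mulOp f - c • (1 : BL2 Ω)) = (mulOp f - c • (1 : BL2 Ω)) * χ :=
      ((commute_chi_mulOp _ f).sub_right ((Commute.one_right _).smul_right c)).eq
    -- Commutators ignore the constant `c`, and `f - c` is bounded by the diameter `2 n` of the
    -- ball, independently of `f`.
    have e : mulOp f * T - T * mulOp f = ((mulOp f - c • (1 : BL2 Ω)) * χ) * T
        - T * ((mulOp f - c • (1 : BL2 Ω)) * χ) := by
      rw [mul_assoc, h1, ← hcomm, ← mul_assoc, h2, sub_mul, mul_sub, smul_mul_assoc,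
        mul_smul_comm, one_mul, mul_one]
      abel
    rw [e]
    exact (hsNorm_sub_le _ _).trans (add_le_add (hsNorm_mul_le_of_norm_le hn _)
      (hsNorm_mul_le_of_norm_le' hn _))
  exact key.trans_lt (ENNReal.add_lt_top.2 ⟨ENNReal.mul_lt_top ENNReal.ofReal_lt_top hT,
    ENNReal.mul_lt_top ENNReal.ofReal_lt_top hT⟩)

theorem norm_sub_proj_le {H : Type*} [NormedAddCommGroup H] [InnerProductSpace ℂ H]
    [CompleteSpace H] {P : H →L[ℂ] H} (h1 : star P = P) (h2 : P * P = P) {x y : H}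
    (hy : P y = y) : ‖x - P x‖ ≤ ‖x - y‖ := by
  have e : x - P x = (1 - P) (x - y) := by simp [hy]
  rw [e]
  simpa using (1 - P).le_of_opNorm_le (norm_one_sub_le_one h1 h2) (x - y)

/-- Approximate `x` by a continuous function of compact support, and this by a step function using
uniform continuity; the projection does at least as well as any vector in its range. -/
theorem exists_cellProj_near (x : L2 Ω) {ε : ℝ} (hε : 0 < ε) :
    ∃ n j : ℕ, ‖x - cellProj Ω n j x‖ ≤ ε := by
  obtain ⟨g, hgs, hgx, hgc, hgm⟩ := (Lp.memLp x).exists_hasCompactSupport_eLpNorm_sub_le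
    (by norm_num) (ε := ENNReal.ofReal (ε / 2)) (by simpa using hε)
  obtain ⟨R, hR⟩ := hgs.isCompact.isBounded.subset_ball 0
  obtain ⟨n, hn⟩ := exists_nat_ge R
  have hsupp : ∀ z, z ∉ Metric.ball (0 : ℂ) n → g z = 0 := fun z hz =>
    image_eq_zero_of_notMem_tsupport fun h => hz (Metric.ball_subset_ball hn (hR h))
  obtain ⟨C, hC⟩ := hgs.exists_bound_of_continuous hgc
  have hgi : MemLp g ∞ (leb Ω) :=
    memLp_top_of_bound hgc.aestronglyMeasurable C (Eventually.of_forall hC)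
  -- A uniform error `r` on the ball becomes an error of at most `r ‖ballVec Ω n‖ ≤ ε / 2` in `L²`.
  set r : ℝ := ε / (2 * (‖ballVec Ω n‖ + 1)) with hr
  have hr0 : 0 < r := by positivity
  obtain ⟨δ, hδ, hgδ⟩ := Metric.uniformContinuous_iff.1
    (hgc.uniformContinuous_of_tendsto_cocompact hgs.is_zero_at_infty) r hr0
  obtain ⟨j, hj⟩ := exists_div_two_pow_lt 2 (half_pos hδ)
  obtain ⟨T, ⟨c, rfl⟩, hT⟩ := exists_stepOps_near_of_ae (f := hgi.toLp) hr0.le n j fun a => by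
    by_cases ha : (cell j a).Nonempty
    · obtain ⟨t, ht⟩ := ha
      refine ⟨g t, ?_⟩
      filter_upwards [hgi.coeFn_toLp] with z hz hza
      rw [hz, ← dist_eq_norm]
      refine (hgδ ?_).le
      rw [dist_eq_norm]
      refine (norm_sub_le_of_lab_eq ?_).trans_lt ((hj j le_rfl).trans_lt (half_lt_self hδ))
      rw [show lab j z = a from hza, show lab j t = a from ht]
    · refine ⟨0, Eventually.of_forall fun z hz => absurd ⟨z, hz⟩ ha⟩
  set y : L2 Ω := ∑ a ∈ index n j, c a • cellVec Ω n j a with hy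
  refine ⟨n, j, (norm_sub_proj_le (star_cellProj n j) ((isFlag_cellProj Ω n).mul_left j j le_rfl)
    (y := y) ?_).trans ?_⟩
  · rw [hy, map_sum]
    refine Finset.sum_congr rfl fun a ha => ?_
    rw [map_smul, cellProj, transfer_apply_self (cellVec_orthogonal n j) ha]
  · have hgB : mulOp hgi.toLp (ballVec Ω n) = hgm.toLp := by
      refine Lp.ext ?_
      filter_upwards [mulOp_apply_ae hgi.toLp (ballVec Ω n), hgi.coeFn_toLp, hgm.coeFn_toLp,
        ballVec_ae (Ω := Ω) n] with z h1 h2 h3 h4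
      rw [h1, h2, h3, h4]
      by_cases hz : z ∈ Metric.ball (0 : ℂ) n
      · rw [Set.indicator_of_mem hz, mul_one]
      · rw [hsupp z hz, zero_mul]
    have hBB : chi Ω (measurableSet_ball (x := (0 : ℂ)) (ε := n)) (ballVec Ω n) = ballVec Ω n := by
      refine Lp.ext ?_
      filter_upwards [chi_apply_ae (measurableSet_ball (x := (0 : ℂ)) (ε := n)) (ballVec Ω n),
        ballVec_ae (Ω := Ω) n] with z h1 h2
      rw [h1]
      by_cases hz : z ∈ Metric.ball (0 : ℂ) n
      · rw [Set.indicator_of_mem hz]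
      · rw [Set.indicator_of_notMem hz, h2, Set.indicator_of_notMem hz]
    have h1 : ‖hgm.toLp - y‖ ≤ ε / 2 := by
      have h2 := ContinuousLinearMap.le_of_opNorm_le _ hT (ballVec Ω n)
      rw [mul_apply_eq_comp, hBB, sub_apply, hgB, sum_apply] at h2
      refine h2.trans ?_
      rw [hr, div_mul_eq_mul_div, div_le_div_iff₀ (by positivity) (by positivity)]
      nlinarith [norm_nonneg (ballVec Ω n)]
    have h2 : ‖x - hgm.toLp‖ ≤ ε / 2 := by
      rw [Lp.norm_def]
      refine ENNReal.toReal_le_of_le_ofReal (by positivity) (le_trans (le_of_eq ?_) hgx)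
      refine eLpNorm_congr_ae ?_
      filter_upwards [Lp.coeFn_sub x hgm.toLp, hgm.coeFn_toLp] with z h3 h4
      rw [h3, Pi.sub_apply, h4, Pi.sub_apply]
    calc ‖x - y‖ = ‖(x - hgm.toLp) + (hgm.toLp - y)‖ := by congr 1; abel
      _ ≤ ε := (norm_add_le _ _).trans (by linarith)

theorem tendsto_cellProj (x : L2 Ω) {j : ℕ → ℕ} (hj : ∀ n, n ≤ j n) :
    Tendsto (fun n => cellProj Ω n (j n) x) atTop (𝓝 x) := by
  rw [Metric.tendsto_atTop]
  intro ε hε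
  obtain ⟨n, i, h⟩ := exists_cellProj_near x (half_pos hε)
  refine ⟨max n i, fun m hm => ?_⟩
  rw [dist_comm, dist_eq_norm]
  refine lt_of_le_of_lt ?_ (half_lt_self hε)
  refine (norm_sub_proj_le (star_cellProj m _) ((isFlag_cellProj Ω m).mul_left _ _ le_rfl)
    (y := cellProj Ω n i x) ?_).trans h
  rw [← mul_apply_eq_comp, cellProj_mul_cellProj ((le_max_left _ _).trans hm)
    (((le_max_right _ _).trans hm).trans (hj m))]

/-- The increasing sequence of almost commuting projections of finite rank. -/
theorem exists_projection_sequence (Ω : Set ℂ) : ∃ P : ℕ → BL2 Ω,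
    (∀ n, star (P n) = P n) ∧ (∀ n, P n * P n = P n) ∧
    (∀ n, FiniteDimensional ℂ (P n).range) ∧ (∀ n, P (n + 1) * P n = P n) ∧
    (∀ x, Tendsto (fun n => P n x) atTop (𝓝 x)) ∧
    (∀ n : ℕ, lipL (P n) ≤ ENNReal.ofReal (1 / (n + 1))) ∧
    (∀ n : ℕ, chi Ω (measurableSet_ball (x := (0 : ℂ)) (ε := n)) * P n = P n) ∧
    ∀ n m : ℕ, Commute (chi Ω (measurableSet_ball (x := (0 : ℂ)) (ε := m))) (P n) := by
  choose Q M hM hs hi hfix hdom hL hcomm using fun n j : ℕ =>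
    exists_almost_commuting_above_cellProj Ω n j (ε := 1 / (n + 1)) (by positivity)
  -- The next projection is built above a cell projection that dominates the present one, so the
  -- sequence increases. The summand `1` forces `n ≤ lvl n`, which strong convergence needs.
  let lvl : ℕ → ℕ := fun n => Nat.rec 0 (fun n l => M n l + 1) n
  have hlvl : ∀ n, lvl (n + 1) = M n (lvl n) + 1 := fun n => rfl
  have hge : ∀ n, n ≤ lvl n := by
    intro n
    induction n with
    | zero => exact Nat.zero_le _
    | succ n ih => rw [hlvl]; have := hM n (lvl n); lia
  refine ⟨fun n => Q n (lvl n), fun n => hs _ _, fun n => hi _ _, fun n => ?_, fun n => ?_,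
    fun x => ?_, fun n => hL _ _, fun n => ?_, fun n m => hcomm _ _ _⟩
  · have hle : (Q n (lvl n)).range ≤ (cellProj Ω n (M n (lvl n))).range := by
      rintro _ ⟨v, rfl⟩
      exact ⟨Q n (lvl n) v, congrArg (fun T : BL2 Ω => T v) (hdom n (lvl n))⟩
    have : FiniteDimensional ℂ (cellProj Ω n (M n (lvl n))).range :=
      finiteDimensional_range_transfer
    exact Submodule.finiteDimensional_of_le hle
  · have e := cellProj_mul_cellProj (Ω := Ω) (n := n) (m := n + 1) (i := M n (lvl n))
      (j := lvl (n + 1)) (Nat.le_succ n) (by rw [hlvl]; lia)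
    change Q (n + 1) (lvl (n + 1)) * Q n (lvl n) = Q n (lvl n)
    rw [← hdom n (lvl n), ← e, mul_assoc, ← mul_assoc, hfix]
  · rw [tendsto_iff_norm_sub_tendsto_zero]
    have h0 := tendsto_iff_norm_sub_tendsto_zero.1 (tendsto_cellProj x hge)
    refine squeeze_zero (fun _ => norm_nonneg _) (fun n => ?_) h0
    rw [norm_sub_rev, norm_sub_rev _ x]
    refine norm_sub_proj_le (hs _ _) (hi _ _) ?_
    rw [← mul_apply_eq_comp, hfix]
  · change _ * Q n (lvl n) = Q n (lvl n)
    rw [← hdom n (lvl n), ← mul_assoc, chi_ball_mul_cellProj]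

end Sequence

end LipAlg

end

noncomputable section

namespace LipAlg

/-! ### Blocks with respect to the cells -/

section Blocks

open scoped Classical in
/-- The sum of the blocks `χ_a Z χ_b` over the pairs of cells of level `j` in the ball of radius
`n` that satisfy `q a b`. -/
def blockPart {Ω : Set ℂ} (n j : ℕ) (q : ℕ × ℤ × ℤ → ℕ × ℤ × ℤ → Prop) (Z : BL2 Ω) : BL2 Ω :=
  ∑ a ∈ index n j, ∑ b ∈ (index n j).filter (q a),
    chi Ω (measurableSet_cell j a) * Z * chi Ω (measurableSet_cell j b)

variable {Ω : Set ℂ} {n j : ℕ} {q : ℕ × ℤ × ℤ → ℕ × ℤ × ℤ → Prop}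

-- Distinct blocks have orthogonal ranges or orthogonal initial spaces. Thus block parts behave like
-- restrictions of an `L²` kernel to sets of pairs of cells.
open scoped Classical in
theorem hsSq_blockPart (Z : BL2 Ω) : hsSq (blockPart n j q Z) =
    ∑ a ∈ index n j, ∑ b ∈ (index n j).filter (q a),
      hsSq (chi Ω (measurableSet_cell j a) * Z * chi Ω (measurableSet_cell j b)) := by
  rw [blockPart, hsSq_sum_of_star_mul_eq_zero]
  · refine Finset.sum_congr rfl fun a _ => hsSq_sum_of_mul_star_eq_zero _ _ fun b _ c _ hbc => ?_
    rw [star_mul, star_chi, ← mul_assoc,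
      mul_assoc _ (chi Ω (measurableSet_cell j b)) (chi Ω (measurableSet_cell j c)),
      chi_mul_chi_of_disjoint _ _ (disjoint_cell hbc), mul_zero, zero_mul]
  · intro a _ c _ hac
    rw [star_sum, Finset.sum_mul]
    refine Finset.sum_eq_zero fun b _ => ?_
    rw [Finset.mul_sum]
    refine Finset.sum_eq_zero fun d _ => ?_
    rw [star_mul, star_mul, star_chi, star_chi]
    simp only [mul_assoc]
    rw [← mul_assoc (chi Ω (measurableSet_cell j a)) (chi Ω (measurableSet_cell j c)),
      chi_mul_chi_of_disjoint _ _ (disjoint_cell hac)]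
    simp

theorem sum_chi_cell (n j : ℕ) : ∑ a ∈ index n j, chi Ω (measurableSet_cell j a)
    = chi Ω (measurableSet_ball (x := (0 : ℂ)) (ε := n)) := by
  rw [← sum_chi_cell_inter (measurableSet_ball (x := (0 : ℂ)) (ε := n)) subset_rfl j]
  refine Finset.sum_congr rfl fun a ha => ?_
  congr 1
  exact (Set.inter_eq_left.2 (cell_subset_ball ha)).symm

theorem blockPart_true (Z : BL2 Ω) : blockPart n j (fun _ _ => True) Z
    = chi Ω (measurableSet_ball (x := (0 : ℂ)) (ε := n)) * Z
      * chi Ω (measurableSet_ball (x := (0 : ℂ)) (ε := n)) := by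
  simp only [blockPart, Finset.filter_true, ← Finset.mul_sum, ← Finset.sum_mul, sum_chi_cell]

theorem hsSq_blockPart_add (Z : BL2 Ω) : hsSq (blockPart n j q Z)
    + hsSq (blockPart n j (fun a b => ¬ q a b) Z)
    = hsSq (chi Ω (measurableSet_ball (x := (0 : ℂ)) (ε := n)) * Z
      * chi Ω (measurableSet_ball (x := (0 : ℂ)) (ε := n))) := by
  classical
  rw [← blockPart_true (j := j), hsSq_blockPart, hsSq_blockPart, hsSq_blockPart,
    ← Finset.sum_add_distrib]
  refine Finset.sum_congr rfl fun a _ => ?_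
  rw [Finset.filter_true]
  convert Finset.sum_filter_add_sum_filter_not (index n j) (q a) _

theorem hsNorm_blockPart_le (Z : BL2 Ω) : hsNorm (blockPart n j q Z) ≤ hsNorm Z := by
  have h : hsNorm (blockPart n j q Z) ≤ hsNorm (chi Ω (measurableSet_ball (x := (0 : ℂ))
      (ε := n)) * Z * chi Ω (measurableSet_ball (x := (0 : ℂ)) (ε := n))) := by
    rw [hsNorm_le_iff_hsSq_le, hsNorm_sq, ← hsSq_blockPart_add (q := q) (j := j)]
    exact le_self_add
  exact h.trans ((hsNorm_mul_le_right (norm_chi_le _) _).trans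
    (hsNorm_mul_le_left (norm_chi_le _) _))

theorem blockPart_add (Y Z : BL2 Ω) :
    blockPart n j q (Y + Z) = blockPart n j q Y + blockPart n j q Z := by
  simp only [blockPart, mul_add, add_mul, Finset.sum_add_distrib]

theorem blockPart_sum {ι : Type*} (s : Finset ι) (Z : ι → BL2 Ω) :
    blockPart n j q (∑ i ∈ s, Z i) = ∑ i ∈ s, blockPart n j q (Z i) := by
  classical
  induction s using Finset.induction_on with
  | empty => simp [blockPart]
  | insert i s hi ih => rw [Finset.sum_insert hi, Finset.sum_insert hi, blockPart_add, ih]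

/-- Two cells of level `j` are near if they have points at distance less than `20 / 2 ^ j`. -/
def Near (j : ℕ) (a b : ℕ × ℤ × ℤ) : Prop :=
  ∃ s ∈ cell j a, ∃ t ∈ cell j b, ‖s - t‖ < 20 / 2 ^ j

theorem sum_enorm_chi_cell_sq_le (s : Finset (ℕ × ℤ × ℤ)) (j : ℕ) (x : L2 Ω) :
    ∑ a ∈ s, ‖chi Ω (measurableSet_cell j a) x‖ₑ ^ 2 ≤ ‖x‖ₑ ^ 2 := by
  have hm : MeasurableSet (lab j ⁻¹' (s : Set (ℕ × ℤ × ℤ))) :=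
    measurable_lab j s.measurableSet
  rw [← enorm_sum_sq_of_orthogonal s _ fun a _ b _ hab =>
    inner_chi_chi_of_disjoint _ _ (disjoint_cell hab) _ _, ← sum_apply,
    sum_chi hm s (C := cell j) (measurableSet_cell j) fun z => ?_]
  · gcongr
    rw [← ofReal_norm, ← ofReal_norm]
    exact ENNReal.ofReal_le_ofReal (by simpa using (chi Ω hm).le_of_opNorm_le (norm_chi_le hm) x)
  · by_cases hz : lab j z ∈ s
    · rw [Finset.sum_eq_single_of_mem _ hz, Set.indicator_of_mem (show z ∈ cell j _ from rfl),
        Set.indicator_of_mem (show z ∈ lab j ⁻¹' (s : Set (ℕ × ℤ × ℤ)) from hz)]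
      intro b _ hb
      exact Set.indicator_of_notMem (s := cell j b)
        (fun h => hb (show lab j z = b from h).symm) _
    · have hz' : z ∉ lab j ⁻¹' (s : Set (ℕ × ℤ × ℤ)) := hz
      rw [Set.indicator_of_notMem hz']
      refine Finset.sum_eq_zero fun b hb => Set.indicator_of_notMem (s := cell j b) (fun h => hz ?_) _
      rwa [show lab j z = b from h]

open InnerProductSpace (rankOne) in
theorem hsSq_chi_mul_rankOne_mul_chi {A B : Set ℂ} (hA : MeasurableSet A) (hB : MeasurableSet B)
    (g h : L2 Ω) : hsSq (chi Ω hA * rankOne ℂ g h * chi Ω hB)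
      = ‖chi Ω hA g‖ₑ ^ 2 * ‖chi Ω hB h‖ₑ ^ 2 := by
  rw [ContinuousLinearMap.mul_def, ContinuousLinearMap.mul_def, InnerProductSpace.comp_rankOne,
    InnerProductSpace.rankOne_comp, ← ContinuousLinearMap.star_eq_adjoint, star_chi, hsSq_rankOne]

-- For a kernel of the form `g(s) conj(h(t))`, the cells near a given cell lie in a disc whose area
-- tends to zero, and there the integral of `|h|²` is small uniformly in the position of the disc.
-- Summing over the rows leaves the factor `‖g‖²`.
open InnerProductSpace (rankOne) in
theorem tendsto_blockPart_near_rankOne (n : ℕ) (g h : L2 Ω) :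
    Tendsto (fun j => hsNorm (blockPart n j (Near j) (rankOne ℂ g h))) atTop (𝓝 0) := by
  classical
  have key : Tendsto (fun j => hsSq (blockPart n j (Near j) (rankOne ℂ g h))) atTop (𝓝 0) := by
    rw [ENNReal.tendsto_nhds_zero]
    intro ε hε
    obtain ⟨η, hη, hηε⟩ : ∃ η : ℝ≥0∞, 0 < η ∧ ‖g‖ₑ ^ 2 * η ≤ ε := by
      have ht : Tendsto (fun x : ℝ≥0∞ => ‖g‖ₑ ^ 2 * x) (𝓝[>] 0) (𝓝 0) := by
        have := ENNReal.Tendsto.const_mul (a := ‖g‖ₑ ^ 2) (tendsto_id (α := ℝ≥0∞) (x := 𝓝 0))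
          (Or.inr (by simp))
        rw [mul_zero] at this
        exact this.mono_left nhdsWithin_le_nhds
      obtain ⟨x, hx, hx0⟩ := ((ht.eventually_le_const hε).and self_mem_nhdsWithin).exists
      exact ⟨x, hx0, hx⟩
    obtain ⟨δ, hδ, hδη⟩ := exists_pos_setLIntegral_lt_of_measure_lt (μ := leb Ω)
      (f := fun z => ‖h z‖ₑ ^ 2) (by rw [← enorm_sq_eq_lintegral]; simp) hη.ne'
    -- The radius is `24 = 20 + 2 + 2` in units of `2 ^ -j`: the distance allowed by `Near` and the
    -- diameters of the two cells.
    have hvol : Tendsto (fun j : ℕ => ENNReal.ofReal (24 / 2 ^ j) ^ 2 * (NNReal.pi : ℝ≥0∞)) atTop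
        (𝓝 0) := by
      have h1 : Tendsto (fun M : ℕ => (24 : ℝ) / 2 ^ M) atTop (𝓝 0) :=
        tendsto_const_nhds.div_atTop (tendsto_pow_atTop_atTop_of_one_lt (by norm_num))
      have h2 := ENNReal.Tendsto.mul_const (b := (NNReal.pi : ℝ≥0∞))
        (ENNReal.Tendsto.pow (n := 2) (ENNReal.tendsto_ofReal h1)) (Or.inr ENNReal.coe_ne_top)
      simpa using h2
    filter_upwards [hvol.eventually_lt_const hδ] with j hj
    rw [hsSq_blockPart]
    have hrow : ∀ a ∈ index n j, ∑ b ∈ (index n j).filter (Near j a),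
        hsSq (chi Ω (measurableSet_cell j a) * rankOne ℂ g h * chi Ω (measurableSet_cell j b))
          ≤ ‖chi Ω (measurableSet_cell j a) g‖ₑ ^ 2 * η := by
      intro a _
      simp only [hsSq_chi_mul_rankOne_mul_chi]
      rw [← Finset.mul_sum]
      refine mul_le_mul_right ?_ _
      by_cases ha : (cell j a).Nonempty
      · obtain ⟨s, hs⟩ := ha
        have hB := measurableSet_closedBall (x := s) (ε := 24 / 2 ^ j)
        have hsub : ∀ b ∈ (index n j).filter (Near j a),
            cell j b ⊆ Metric.closedBall s (24 / 2 ^ j) := by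
          intro b hb t ht
          obtain ⟨s', hs', t', ht', hst⟩ := (Finset.mem_filter.1 hb).2
          rw [Metric.mem_closedBall, dist_eq_norm]
          have e1 : ‖t - t'‖ ≤ 2 / 2 ^ j := norm_sub_le_of_lab_eq (by
            rw [show lab j t = b from ht, show lab j t' = b from ht'])
          have e2 : ‖s' - s‖ ≤ 2 / 2 ^ j := norm_sub_le_of_lab_eq (by
            rw [show lab j s' = a from hs', show lab j s = a from hs])
          have e3 : t - s = (t - t') - (s' - t') + (s' - s) := by ring
          have e4 : (24 : ℝ) / 2 ^ j = 2 / 2 ^ j + 20 / 2 ^ j + 2 / 2 ^ j := by ring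
          rw [e3, e4]
          refine (norm_add_le _ _).trans (add_le_add ((norm_sub_le _ _).trans ?_) e2)
          exact add_le_add e1 hst.le
        have e : ∀ b ∈ (index n j).filter (Near j a), ‖chi Ω (measurableSet_cell j b) h‖ₑ ^ 2
            = ‖chi Ω (measurableSet_cell j b) (chi Ω hB h)‖ₑ ^ 2 := by
          intro b hb
          rw [← mul_apply_eq_comp, chi_mul_chi_of_subset _ _ (hsub b hb)]
        rw [Finset.sum_congr rfl e]
        refine (sum_enorm_chi_cell_sq_le _ j _).trans ?_
        rw [enorm_chi_apply_sq]
        refine (hδη _ (lt_of_le_of_lt ?_ hj)).le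
        rw [← Complex.volume_closedBall s]
        exact Measure.restrict_apply_le _ _
      · have : (index n j).filter (Near j a) = ∅ := by
          refine Finset.filter_eq_empty_iff.2 fun b _ hb => ?_
          obtain ⟨s, hs, -⟩ := hb
          exact ha ⟨s, hs⟩
        rw [this, Finset.sum_empty]
        exact zero_le
    refine (Finset.sum_le_sum hrow).trans ?_
    rw [← Finset.sum_mul]
    exact (mul_le_mul_left (sum_enorm_chi_cell_sq_le _ j g) _).trans hηε
  have h2 := key.ennrpow_const (1 / 2 : ℝ)
  simpa [hsNorm] using h2

open InnerProductSpace (rankOne) in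
/-- A Hilbert-Schmidt operator is approximated by operators of finite rank. -/
theorem exists_sum_rankOne_near {H : Type*} [NormedAddCommGroup H] [InnerProductSpace ℂ H]
    [CompleteSpace H] {Z : H →L[ℂ] H} (hZ : hsNorm Z < ∞) {ε : ℝ≥0∞} (hε : 0 < ε) :
    ∃ (w : Set H) (s : Finset w) (x y : w → H),
      hsNorm (Z - ∑ i ∈ s, rankOne ℂ (x i) (y i)) ≤ ε := by
  classical
  obtain ⟨w, b, -⟩ := exists_hilbertBasis ℂ H
  rw [hsNorm_lt_top_iff, hsSq_eq_tsum b] at hZ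
  have h0 := ENNReal.tendsto_tsum_compl_atTop_zero hZ.ne
  obtain ⟨s, hs⟩ := (h0.eventually_le_const (u := ε ^ 2) (by positivity)).exists
  refine ⟨w, s, fun i => Z (b i), b, ?_⟩
  rw [hsNorm_le_iff_hsSq_le, hsSq_eq_tsum b]
  refine le_trans (le_of_eq ?_) hs
  have e : ∀ i, (Z - ∑ k ∈ s, rankOne ℂ (Z (b k)) (b k)) (b i)
      = if i ∈ s then 0 else Z (b i) := by
    intro i
    have e1 : ∑ k ∈ s, ⟪b k, b i⟫_ℂ • Z (b k) = if i ∈ s then Z (b i) else 0 := by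
      simp only [orthonormal_iff_ite.1 b.orthonormal, ite_smul, one_smul, zero_smul,
        Finset.sum_ite_eq']
    rw [sub_apply, sum_apply]
    simp only [InnerProductSpace.rankOne_apply]
    rw [e1]
    split_ifs <;> simp
  simp only [e]
  refine Eq.trans ?_ (tsum_subtype {x | x ∉ s} fun i => ‖Z (b i)‖ₑ ^ 2).symm
  refine tsum_congr fun i => ?_
  by_cases hi : i ∈ s <;> simp [hi]

/-- The blocks near the diagonal of a Hilbert-Schmidt operator vanish in the limit. -/
theorem tendsto_blockPart_near {Z : BL2 Ω} (hZ : hsNorm Z < ∞) (n : ℕ) :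
    Tendsto (fun j => hsNorm (blockPart n j (Near j) Z)) atTop (𝓝 0) := by
  rw [ENNReal.tendsto_nhds_zero]
  intro ε hε
  have hε2 : 0 < ε / 2 := ENNReal.half_pos hε.ne'
  obtain ⟨w, s, x, y, hxy⟩ := exists_sum_rankOne_near hZ hε2
  have h1 : Tendsto (fun j => ∑ i ∈ s, hsNorm (blockPart n j (Near j)
      (InnerProductSpace.rankOne ℂ (x i) (y i)))) atTop (𝓝 0) := by
    have := tendsto_finsetSum s fun i _ => tendsto_blockPart_near_rankOne n (x i) (y i)
    simpa using this
  filter_upwards [h1.eventually_le_const hε2] with j hj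
  set Z' := ∑ i ∈ s, InnerProductSpace.rankOne ℂ (x i) (y i) with hZ'
  have e : Z = (Z - Z') + Z' := by abel
  rw [e, blockPart_add]
  refine (hsNorm_add_le _ _).trans ?_
  rw [← ENNReal.add_halves ε]
  refine add_le_add ((hsNorm_blockPart_le _).trans hxy) ?_
  rw [hZ', blockPart_sum]
  exact (hsNorm_sum_le _ _).trans hj

end Blocks

end LipAlg

end

noncomputable section

namespace LipAlg

/-! ### Comparison of commutators with Lipschitz functions and with the coordinate -/

section Comparison

variable {Ω : Set ℂ}

theorem ofReal_norm_mul_hsNorm_le {H : Type*} [NormedAddCommGroup H] [InnerProductSpace ℂ H]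
    [CompleteSpace H] (c : ℂ) (T : H →L[ℂ] H) :
    ENNReal.ofReal ‖c‖ * hsNorm T ≤ hsNorm (c • T) := by
  by_cases hc : c = 0
  · simp [hc]
  · have h := hsNorm_smul_le c⁻¹ (c • T)
    rw [smul_smul, inv_mul_cancel₀ hc, one_smul] at h
    refine (mul_le_mul_right h _).trans (le_of_eq ?_)
    rw [← mul_assoc, ← ENNReal.ofReal_mul (norm_nonneg _), ← norm_mul, mul_inv_cancel₀ hc,
      norm_one, ENNReal.ofReal_one, one_mul]

theorem chi_eq_zero_of_measure_eq_zero {A : Set ℂ} (hA : MeasurableSet A) (h : leb Ω A = 0) :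
    chi Ω hA = 0 := by
  ext1 x
  refine Lp.ext ?_
  filter_upwards [chi_apply_ae hA x, measure_eq_zero_iff_ae_notMem.1 h,
    Lp.coeFn_zero ℂ 2 (leb Ω)] with z h1 h2 h3
  rw [h1, Set.indicator_of_notMem h2, zero_apply, h3]
  rfl

/-- A block of a commutator is, up to a small error, a multiple of the block of the operator. -/
theorem hsNorm_block_commutator_sub_le {A B : Set ℂ} (hA : MeasurableSet A)
    (hB : MeasurableSet B) {f : Lp ℂ ∞ (leb Ω)} {r : ℝ} (hr : 0 ≤ r) {c d : ℂ}
    (hc : ∀ᵐ z ∂leb Ω, z ∈ A → ‖f z - c‖ ≤ r) (hd : ∀ᵐ z ∂leb Ω, z ∈ B → ‖f z - d‖ ≤ r)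
    (X : BL2 Ω) :
    hsNorm (chi Ω hA * (mulOp f * X - X * mulOp f) * chi Ω hB
      - (c - d) • (chi Ω hA * X * chi Ω hB))
      ≤ ENNReal.ofReal (2 * r) * hsNorm (chi Ω hA * X * chi Ω hB) := by
  set Y := chi Ω hA * X * chi Ω hB with hY
  have e1 : chi Ω hA * (mulOp f * X) * chi Ω hB = (mulOp f * chi Ω hA) * Y := by
    rw [hY, ← mul_assoc (chi Ω hA) (mulOp f), (commute_chi_mulOp hA f).eq]
    nth_rw 1 [← chi_mul_self hA]
    simp only [mul_assoc]
  have e2 : chi Ω hA * (X * mulOp f) * chi Ω hB = Y * (mulOp f * chi Ω hB) := by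
    rw [hY, ← (commute_chi_mulOp hB f).eq]
    simp only [mul_assoc]
    rw [← mul_assoc (chi Ω hB) (chi Ω hB), chi_mul_self, (commute_chi_mulOp hB f).eq]
  have hAY : chi Ω hA * Y = Y := by rw [hY, ← mul_assoc, ← mul_assoc, chi_mul_self]
  have hYB : Y * chi Ω hB = Y := by rw [hY, mul_assoc _ _ (chi Ω hB), chi_mul_self]
  have e : chi Ω hA * (mulOp f * X - X * mulOp f) * chi Ω hB - (c - d) • Y
      = ((mulOp f - c • (1 : BL2 Ω)) * chi Ω hA) * Y
        - Y * ((mulOp f - d • (1 : BL2 Ω)) * chi Ω hB) := by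
    rw [mul_sub, sub_mul, e1, e2]
    simp only [sub_mul, mul_sub, smul_mul_assoc, mul_smul_comm, one_mul, hAY, hYB, sub_smul]
    abel
  rw [e]
  refine (hsNorm_sub_le _ _).trans ((add_le_add
    (hsNorm_mul_le_of_norm_le (norm_mulOp_sub_smul_mul_chi_le hA hr hc) _)
    (hsNorm_mul_le_of_norm_le' (norm_mulOp_sub_smul_mul_chi_le hB hr hd) _)).trans (le_of_eq ?_))
  rw [← add_mul, ← ENNReal.ofReal_add hr hr, two_mul]

/-- The blocks of `T ∈ EΛ(Ω)` away from the diagonal are Hilbert-Schmidt operators. -/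
theorem hsNorm_block_lt_top {A B : Set ℂ} (hA : MeasurableSet A) (hB : MeasurableSet B)
    (hne : A.Nonempty) {r : ℝ} (hr : 0 < r) (hAB : ∀ s ∈ A, ∀ t ∈ B, r ≤ ‖s - t‖) {X : BL2 Ω}
    (hX : lipL X < ∞) : hsNorm (chi Ω hA * X * chi Ω hB) < ∞ := by
  -- The truncated distance to `A` is `0` on `A` and `r` on `B`, so the block of its commutator is
  -- exactly `-r` times the block of `X`.
  obtain ⟨f, hf, hf1, hfF⟩ := exists_essLip_of_lipschitz (Ω := Ω)
    (F := fun z => ((min r (Metric.infDist z A) : ℝ) : ℂ)) (C := r)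
    (fun z => by
      rw [Complex.norm_real, Real.norm_of_nonneg (le_min hr.le Metric.infDist_nonneg)]
      exact min_le_left _ _)
    (fun s t => by
      rw [← Complex.ofReal_sub, Complex.norm_real, Real.norm_eq_abs]
      have h1 := abs_min_sub_min_le_max r (Metric.infDist s A) r (Metric.infDist t A)
      have h2 := (Metric.lipschitz_infDist_pt A).dist_le_mul s t
      rw [Real.dist_eq, dist_eq_norm, NNReal.coe_one, one_mul] at h2
      rw [sub_self, abs_zero, max_eq_right (abs_nonneg _)] at h1
      exact h1.trans h2)
  have hc : ∀ᵐ z ∂leb Ω, z ∈ A → ‖f z - 0‖ ≤ 0 := by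
    filter_upwards [hfF] with z hz hzA
    rw [hz, Metric.infDist_zero_of_mem hzA, min_eq_right hr.le]; simp
  have hd : ∀ᵐ z ∂leb Ω, z ∈ B → ‖f z - (r : ℂ)‖ ≤ 0 := by
    filter_upwards [hfF] with z hz hzB
    have : r ≤ Metric.infDist z A := (Metric.le_infDist hne).2 fun {s} hs => by
      rw [dist_comm, dist_eq_norm]; exact hAB s hs z hzB
    rw [hz, min_eq_left this]; simp
  have h := hsNorm_block_commutator_sub_le hA hB le_rfl hc hd X
  rw [mul_zero, ENNReal.ofReal_zero, zero_mul, nonpos_iff_eq_zero] at h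
  set Y := chi Ω hA * X * chi Ω hB
  set Z := chi Ω hA * (mulOp f * X - X * mulOp f) * chi Ω hB with hZ
  have hZtop : hsNorm Z < ∞ := ((hsNorm_mul_le_right (norm_chi_le _) _).trans
    ((hsNorm_mul_le_left (norm_chi_le _) _).trans (hsNorm_le_lipL X f hf hf1))).trans_lt hX
  have h2 : hsNorm ((0 - (r : ℂ)) • Y) < ∞ := by
    have e : (0 - (r : ℂ)) • Y = Z - (Z - (0 - (r : ℂ)) • Y) := by abel
    rw [e]
    refine (hsNorm_sub_le _ _).trans_lt ?_
    rw [h, add_zero]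
    exact hZtop
  have h3 := (ofReal_norm_mul_hsNorm_le (0 - (r : ℂ)) Y).trans_lt h2
  by_contra htop
  rw [not_lt, top_le_iff] at htop
  rw [htop, ENNReal.mul_top] at h3
  · exact lt_irrefl _ h3
  · simpa using hr.ne'

/-- `ζ` is a bounded Lipschitz function that is the identity on the ball of radius `n`. -/
def IsCoordinate (n : ℕ) (ζ : Lp ℂ ∞ (leb Ω)) : Prop :=
  ζ ∈ essLip Ω ∧ lipNorm ζ ≤ 1 ∧ ∀ᵐ z ∂leb Ω, z ∈ Metric.ball (0 : ℂ) n → ζ z = z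

theorem exists_isCoordinate (Ω : Set ℂ) (n : ℕ) :
    ∃ ζ : Lp ℂ ∞ (leb Ω), IsCoordinate n ζ := by
  -- Clamping the real and imaginary parts separately is bounded and `1`-Lipschitz, as the
  -- coordinate itself need not be bounded on `Ω`.
  let p : ℝ → ℝ := fun x => max (-n) (min n x)
  have hp : ∀ x y, |p x - p y| ≤ |x - y| := by
    intro x y
    have h1 := abs_max_sub_max_le_max (-n : ℝ) (min n x) (-n) (min n y)
    have h2 := abs_min_sub_min_le_max (n : ℝ) x n y
    rw [sub_self, abs_zero, max_eq_right (abs_nonneg (min (n : ℝ) x - min (n : ℝ) y))] at h1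
    rw [sub_self, abs_zero, max_eq_right (abs_nonneg (x - y))] at h2
    exact h1.trans h2
  have hpb : ∀ x, |p x| ≤ n := fun x =>
    abs_le.2 ⟨le_max_left _ _, max_le (by linarith [n.cast_nonneg (α := ℝ)]) (min_le_left _ _)⟩
  have hpid : ∀ x : ℝ, |x| ≤ n → p x = x := fun x hx => by
    obtain ⟨h1, h2⟩ := abs_le.1 hx
    simp only [p]
    rw [min_eq_right h2, max_eq_right h1]
  obtain ⟨ζ, h1, h2, h3⟩ := exists_essLip_of_lipschitz (Ω := Ω)
    (F := fun z => ⟨p z.re, p z.im⟩) (C := n + n)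
    (fun z => (Complex.norm_le_abs_re_add_abs_im _).trans (add_le_add (hpb _) (hpb _)))
    (fun s t => by
      refine abs_le_of_sq_le_sq' ?_ (norm_nonneg _) |>.2
      rw [Complex.sq_norm, Complex.sq_norm, Complex.normSq_apply, Complex.normSq_apply,
        Complex.sub_re, Complex.sub_im, Complex.sub_re, Complex.sub_im]
      have g1 := sq_le_sq.2 (hp s.re t.re)
      have g2 := sq_le_sq.2 (hp s.im t.im)
      nlinarith)
  refine ⟨ζ, h1, h2, ?_⟩
  filter_upwards [h3] with z hz hzn
  rw [mem_ball_zero_iff] at hzn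
  rw [hz, hpid _ ((Complex.abs_re_le_norm z).trans hzn.le),
    hpid _ ((Complex.abs_im_le_norm z).trans hzn.le)]

/-- On a pair of cells both commutators are nearly scalar multiples of the block `Y` of `X`: the
scalar for `f` has modulus at most `‖s - t‖ + 2 d`, the one for `ζ` is `s - t`. The cells are at
distance at least `10 d`, which absorbs all errors into the factor `2`. -/
theorem hsNorm_far_block_le {n j : ℕ} {a b : ℕ × ℤ × ℤ} (ha : a ∈ index n j) (hb : b ∈ index n j)
    (hab : ¬ Near j a b) {X : BL2 Ω} (hX : lipL X < ∞) {f ζ : Lp ℂ ∞ (leb Ω)}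
    (hf : lipNorm f ≤ 1) (hζ : IsCoordinate n ζ) :
    hsNorm (chi Ω (measurableSet_cell j a) * (mulOp f * X - X * mulOp f)
      * chi Ω (measurableSet_cell j b)) ≤
    2 * hsNorm (chi Ω (measurableSet_cell j a) * (mulOp ζ * X - X * mulOp ζ)
      * chi Ω (measurableSet_cell j b)) := by
  have hA := measurableSet_cell j a
  have hB := measurableSet_cell j b
  by_cases hA0 : leb Ω (cell j a) = 0
  · rw [chi_eq_zero_of_measure_eq_zero hA hA0]; simp [hsNorm_zero]
  by_cases hB0 : leb Ω (cell j b) = 0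
  · rw [chi_eq_zero_of_measure_eq_zero hB hB0]; simp [hsNorm_zero]
  set d : ℝ := 2 / 2 ^ j with hd
  have hd0 : 0 < d := by positivity
  have hdiam : ∀ c, ∀ s ∈ cell j c, ∀ t ∈ cell j c, ‖s - t‖ ≤ d := fun c s hs t ht =>
    norm_sub_le_of_lab_eq (by rw [show lab j s = c from hs, show lab j t = c from ht])
  have hfar : ∀ s ∈ cell j a, ∀ t ∈ cell j b, 10 * d ≤ ‖s - t‖ := fun s hs t ht => by
    by_contra! h
    exact hab ⟨s, hs, t, ht, h.trans_le (le_of_eq (by rw [hd]; ring))⟩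
  obtain ⟨ca, hca⟩ := exists_ae_near_const hf (hdiam a)
  obtain ⟨cb, hcb⟩ := exists_ae_near_const hf (hdiam b)
  obtain ⟨s, hsA, hs, hsc⟩ := ((frequently_ae_mem_iff.2 hA0).and_eventually
    ((ae_prod_lipschitz hf).and hca)).exists
  obtain ⟨t, htB, ht, htc⟩ := ((frequently_ae_mem_iff.2 hB0).and_eventually (hs.and hcb)).exists
  have hcab : ‖ca - cb‖ ≤ ‖s - t‖ + 2 * d := by
    have e : ca - cb = (f s - f t) - (f s - ca) + (f t - cb) := by ring
    rw [e]
    have := hsc hsA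
    have := htc htB
    refine (norm_add_le _ _).trans ?_
    have := norm_sub_le (f s - f t) (f s - ca)
    linarith
  have hza : ∀ᵐ z ∂leb Ω, z ∈ cell j a → ‖ζ z - s‖ ≤ d := by
    filter_upwards [hζ.2.2] with z hz hza
    rw [hz (cell_subset_ball ha hza)]
    exact hdiam a z hza s hsA
  have hzb : ∀ᵐ z ∂leb Ω, z ∈ cell j b → ‖ζ z - t‖ ≤ d := by
    filter_upwards [hζ.2.2] with z hz hzb
    rw [hz (cell_subset_ball hb hzb)]
    exact hdiam b z hzb t htB
  have hYtop := hsNorm_block_lt_top hA hB ⟨s, hsA⟩ (by positivity) hfar hX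
  have b1 := hsNorm_block_commutator_sub_le hA hB hd0.le hca hcb X
  have b2 := hsNorm_block_commutator_sub_le hA hB hd0.le hza hzb X
  set Y := chi Ω hA * X * chi Ω hB with hY
  set U := chi Ω hA * (mulOp f * X - X * mulOp f) * chi Ω hB
  set V := chi Ω hA * (mulOp ζ * X - X * mulOp ζ) * chi Ω hB
  have c1 : hsNorm U ≤ ENNReal.ofReal (‖s - t‖ + 4 * d) * hsNorm Y := by
    have e : U = (U - (ca - cb) • Y) + (ca - cb) • Y := by abel
    rw [e]
    refine (hsNorm_add_le _ _).trans ((add_le_add b1 (hsNorm_smul_le _ _)).trans ?_)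
    rw [← add_mul, ← ENNReal.ofReal_add (by positivity) (norm_nonneg _)]
    exact mul_le_mul_left (ENNReal.ofReal_le_ofReal (by linarith)) _
  have c2 : ENNReal.ofReal ‖s - t‖ * hsNorm Y ≤ hsNorm V + ENNReal.ofReal (2 * d) * hsNorm Y := by
    refine (ofReal_norm_mul_hsNorm_le _ _).trans ?_
    have e : (s - t) • Y = V - (V - (s - t) • Y) := by abel
    rw [e]
    exact (hsNorm_sub_le _ _).trans (add_le_add le_rfl b2)
  -- The error is cancelled from both sides, which requires `Y` to be Hilbert-Schmidt; this is why
  -- the blocks away from the diagonal had to be treated first.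
  have hfin : ENNReal.ofReal (4 * d) * hsNorm Y ≠ ∞ :=
    (ENNReal.mul_lt_top ENNReal.ofReal_lt_top hYtop).ne
  refine (ENNReal.add_le_add_iff_right hfin).1 ?_
  have hst := hfar s hsA t htB
  calc hsNorm U + ENNReal.ofReal (4 * d) * hsNorm Y
      ≤ ENNReal.ofReal (‖s - t‖ + 4 * d) * hsNorm Y + ENNReal.ofReal (4 * d) * hsNorm Y := by
        gcongr
    _ = ENNReal.ofReal (‖s - t‖ + 4 * d + 4 * d) * hsNorm Y := by
        rw [← add_mul, ← ENNReal.ofReal_add (by positivity) (by positivity)]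
    _ ≤ ENNReal.ofReal (2 * ‖s - t‖) * hsNorm Y := by
        exact mul_le_mul_left (ENNReal.ofReal_le_ofReal (by linarith)) _
    _ = 2 * (ENNReal.ofReal ‖s - t‖ * hsNorm Y) := by
        rw [ENNReal.ofReal_mul (by norm_num), ENNReal.ofReal_ofNat, mul_assoc]
    _ ≤ 2 * (hsNorm V + ENNReal.ofReal (2 * d) * hsNorm Y) := by gcongr
    _ = 2 * hsNorm V + ENNReal.ofReal (4 * d) * hsNorm Y := by
        have e4 : ENNReal.ofReal (4 * d) = 2 * ENNReal.ofReal (2 * d) := by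
          rw [← ENNReal.ofReal_ofNat 2, ← ENNReal.ofReal_mul zero_le_two]
          congr 1; ring
        rw [mul_add, e4, mul_assoc]

/-- On `EΛ(Ω)` the commutators with Lipschitz functions are controlled by the commutators with
the coordinate function. -/
theorem hsNorm_commutator_le_coordinate {X : BL2 Ω} (hX : lipL X < ∞) {n : ℕ}
    {f ζ : Lp ℂ ∞ (leb Ω)} (hf : f ∈ essLip Ω) (hf1 : lipNorm f ≤ 1) (hζ : IsCoordinate n ζ) :
    hsNorm (chi Ω (measurableSet_ball (x := (0 : ℂ)) (ε := n)) * (mulOp f * X - X * mulOp f)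
      * chi Ω (measurableSet_ball (x := (0 : ℂ)) (ε := n))) ≤
    2 * hsNorm (chi Ω (measurableSet_ball (x := (0 : ℂ)) (ε := n))
      * (mulOp ζ * X - X * mulOp ζ) * chi Ω (measurableSet_ball (x := (0 : ℂ)) (ε := n))) := by
  set Z := mulOp f * X - X * mulOp f with hZ
  set V := mulOp ζ * X - X * mulOp ζ with hV
  set χ := chi Ω (measurableSet_ball (x := (0 : ℂ)) (ε := n)) with hχ
  have hZtop : hsNorm Z < ∞ := (hsNorm_le_lipL X f hf hf1).trans_lt hX
  have hfar : ∀ j, hsSq (blockPart n j (fun a b => ¬ Near j a b) Z)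
      ≤ (2 * hsNorm (χ * V * χ)) ^ 2 := by
    intro j
    calc hsSq (blockPart n j (fun a b => ¬ Near j a b) Z)
        ≤ 2 ^ 2 * hsSq (blockPart n j (fun a b => ¬ Near j a b) V) := by
          rw [hsSq_blockPart, hsSq_blockPart, Finset.mul_sum]
          refine Finset.sum_le_sum fun a ha => ?_
          rw [Finset.mul_sum]
          refine Finset.sum_le_sum fun b hb => ?_
          rw [← hsNorm_sq, ← hsNorm_sq, ← mul_pow]
          have hb' : b ∈ index n j ∧ ¬ Near j a b := by simpa only [Finset.mem_filter] using hb
          gcongr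
          exact hsNorm_far_block_le ha hb'.1 hb'.2 hX hf1 hζ
      _ ≤ 2 ^ 2 * hsSq (χ * V * χ) := by
          gcongr
          rw [← hsSq_blockPart_add (q := Near j) (j := j)]
          exact le_add_self
      _ = _ := by rw [mul_pow, hsNorm_sq]
  rw [hsNorm_le_iff_hsSq_le]
  have hlim : Tendsto (fun j => hsNorm (blockPart n j (Near j) Z) ^ 2
      + (2 * hsNorm (χ * V * χ)) ^ 2) atTop (𝓝 (0 + (2 * hsNorm (χ * V * χ)) ^ 2)) := by
    refine Tendsto.add ?_ tendsto_const_nhds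
    simpa using ENNReal.Tendsto.pow (n := 2) (tendsto_blockPart_near hZtop n)
  rw [zero_add] at hlim
  -- The bound for the far blocks does not depend on `j`, while the near blocks of the
  -- Hilbert-Schmidt operator `Z` vanish as `j → ∞`.
  refine ge_of_tendsto' hlim fun j => ?_
  rw [← hsSq_blockPart_add (q := Near j) (j := j), hsNorm_sq]
  exact add_le_add le_rfl (hfar j)

end Comparison

end LipAlg

end

noncomputable section

namespace LipAlg

/-! ### Approximate units -/

section Compact

variable {H : Type*} [NormedAddCommGroup H] [InnerProductSpace ℂ H]

/-- Strong convergence of a bounded sequence is uniform on the compact closure of the image of the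
unit ball; a finite net makes this explicit. -/
theorem tendsto_enorm_mul_of_isCompactOperator {T : H →L[ℂ] H} (hT : IsCompactOperator T)
    {q : ℕ → H →L[ℂ] H} (hq : ∀ n, ‖q n‖ ≤ 1)
    (h : ∀ x, Tendsto (fun n => q n x) atTop (𝓝 0)) :
    Tendsto (fun n => ‖q n * T‖ₑ) atTop (𝓝 0) := by
  have key : Tendsto (fun n => ‖q n * T‖) atTop (𝓝 0) := by
    rw [Metric.tendsto_atTop]
    intro ε hε
    obtain ⟨t, ht, hcover⟩ := Metric.totallyBounded_iff.1
      (hT.isCompact_closure_image_closedBall 1).totallyBounded (ε / 4) (by positivity)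
    have hev : ∀ᶠ n in atTop, ∀ y ∈ t, ‖q n y‖ < ε / 4 :=
      (eventually_all_finite ht).2 fun y _ => by
        have := (h y).norm
        rw [norm_zero] at this
        exact this.eventually_lt_const (by positivity)
    obtain ⟨N, hN⟩ := eventually_atTop.1 hev
    refine ⟨N, fun n hn => ?_⟩
    rw [dist_zero_right, norm_norm]
    refine lt_of_le_of_lt (ContinuousLinearMap.opNorm_le_of_unit_norm (C := ε / 2)
      (by positivity) fun x hx => ?_) (half_lt_self hε)
    have hmem : T x ∈ closure (T '' Metric.closedBall 0 1) :=
      subset_closure ⟨x, by simp [hx], rfl⟩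
    obtain ⟨y, hy, hxy⟩ := Set.mem_iUnion₂.1 (hcover hmem)
    rw [Metric.mem_ball, dist_eq_norm] at hxy
    have e : (q n * T) x = q n (T x - y) + q n y := by
      rw [mul_apply_eq_comp, map_sub, sub_add_cancel]
    rw [e]
    have h1 : ‖q n (T x - y)‖ ≤ ‖T x - y‖ := by
      simpa using (q n).le_of_opNorm_le (hq n) (T x - y)
    have h2 := hN n hn y hy
    exact (norm_add_le _ _).trans (by linarith)
  have h2 := ENNReal.tendsto_ofReal key
  simpa [ofReal_norm] using h2

end Compact

/-! ### Convergence in the seminorm `L`, uniformly over the Lipschitz functions. -/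

section Approximation

variable {Ω : Set ℂ}

theorem hsSq_add_of_orthogonal {H : Type*} [NormedAddCommGroup H] [InnerProductSpace ℂ H]
    [CompleteSpace H] {Y Z : H →L[ℂ] H} (h1 : star Y * Z = 0) :
    hsSq (Y + Z) = hsSq Y + hsSq Z := by
  have h2 : star Z * Y = 0 := by simpa using congrArg star h1
  have h := hsSq_sum_of_star_mul_eq_zero Finset.univ (fun b : Bool => bif b then Y else Z)
    (by rintro (_ | _) - (_ | _) - hne <;> simp_all)
  simpa using h

/-- Pythagoras for the compression of an operator by a projection. -/
theorem hsSq_compression_add {H : Type*} [NormedAddCommGroup H] [InnerProductSpace ℂ H]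
    [CompleteSpace H] {p : H →L[ℂ] H} (h1 : star p = p) (h2 : p * p = p) (Z : H →L[ℂ] H) :
    hsSq (p * Z * p) + hsSq (Z - p * Z * p) = hsSq Z := by
  have hq : star (1 - p) = 1 - p := by rw [star_sub, star_one, h1]
  have hpq : p * (1 - p) = 0 := by rw [mul_sub, mul_one, h2, sub_self]
  have hqp : (1 - p) * p = 0 := by rw [sub_mul, one_mul, h2, sub_self]
  have e1 : Z = p * Z + (1 - p) * Z := by noncomm_ring
  have e2 : Z - p * Z * p = p * Z * (1 - p) + (1 - p) * Z := by noncomm_ring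
  have o1 : star (p * Z) * ((1 - p) * Z) = 0 := by
    rw [star_mul, h1, mul_assoc, ← mul_assoc p, hpq, zero_mul, mul_zero]
  have o2 : star (p * Z * (1 - p)) * ((1 - p) * Z) = 0 := by
    rw [star_mul, star_mul, h1, mul_assoc, mul_assoc, ← mul_assoc p, hpq, zero_mul, mul_zero,
      mul_zero]
  have s1 : hsSq Z = hsSq (p * Z) + hsSq ((1 - p) * Z) := by
    conv_lhs => rw [e1]
    exact hsSq_add_of_orthogonal o1
  have s2 : hsSq (p * Z) = hsSq (p * Z * p) + hsSq (p * Z * (1 - p)) := by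
    rw [← hsSq_star, ← hsSq_star (p * Z * p), ← hsSq_star (p * Z * (1 - p)),
      ← hsSq_add_of_orthogonal, ← star_add, ← mul_add, add_sub_cancel, mul_one]
    rw [star_star, star_mul, hq, mul_assoc, ← mul_assoc p (1 - p), hpq, zero_mul, mul_zero]
  rw [e2, hsSq_add_of_orthogonal o2, ← add_assoc, ← s2, ← s1]

/-- The Hilbert-Schmidt norm is lower semicontinuous for strong convergence, being a supremum over
finite families. -/
theorem hsNorm_le_of_eventually_compression {H : Type*} [NormedAddCommGroup H]
    [InnerProductSpace ℂ H] [CompleteSpace H] {χ : ℕ → H →L[ℂ] H} (hχ : ∀ m, ‖χ m‖ ≤ 1)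
    (hlim : ∀ x, Tendsto (fun m => χ m x) atTop (𝓝 x)) {Z : H →L[ℂ] H} {c : ℝ≥0∞}
    (h : ∀ᶠ m : ℕ in atTop, hsNorm (χ m * Z * χ m) ≤ c) : hsNorm Z ≤ c := by
  rw [hsNorm_le_iff]
  intro s hs
  have hx : ∀ x, Tendsto (fun m : ℕ => (χ m * Z * χ m) x) atTop (𝓝 (Z x)) := by
    intro x
    have h1 : Tendsto (fun m : ℕ => Z (χ m x)) atTop (𝓝 (Z x)) :=
      (Z.continuous.tendsto x).comp (hlim x)
    have h2 : Tendsto (fun m : ℕ => χ m (Z (χ m x) - Z x)) atTop (𝓝 0) := by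
      refine squeeze_zero_norm (fun m => ?_) (tendsto_iff_norm_sub_tendsto_zero.1 h1)
      simpa only [one_mul] using (χ m).le_of_opNorm_le (hχ m) (Z (χ m x) - Z x)
    have h3 := h2.add (hlim (Z x))
    rw [zero_add] at h3
    refine h3.congr fun m => ?_
    rw [map_sub, sub_add_cancel, mul_apply_eq_comp, mul_apply_eq_comp]
  have h4 : Tendsto (fun m : ℕ => (∑ x ∈ s, ‖(χ m * Z * χ m) x‖ₑ ^ (2 : ℝ)) ^ (1 / 2 : ℝ)) atTop
      (𝓝 ((∑ x ∈ s, ‖Z x‖ₑ ^ (2 : ℝ)) ^ (1 / 2 : ℝ))) :=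
    (tendsto_finsetSum s fun x _ => (hx x).enorm.ennrpow_const 2).ennrpow_const _
  refine le_of_tendsto h4 ?_
  filter_upwards [h] with m hm
  exact (hsNorm_le_iff _ _).1 hm s hs

/-- The estimate behind the approximate unit: `L ((P n - 1) T) → 0` for all `T ∈ EΛ(Ω)`. -/
theorem tendsto_lipL_mul_sub {P : ℕ → BL2 Ω} (hs : ∀ n, star (P n) = P n)
    (hi : ∀ n, P n * P n = P n) (hlim : ∀ x, Tendsto (fun n => P n x) atTop (𝓝 x))
    (hL : Tendsto (fun n => lipL (P n)) atTop (𝓝 0)) (hfin : ∀ n, lipL (P n) < ∞)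
    (hcomm : ∀ n m : ℕ, Commute (chi Ω (measurableSet_ball (x := (0 : ℂ)) (ε := m))) (P n))
    {T : BL2 Ω} (hT : lipL T < ∞) :
    Tendsto (fun n => lipL (P n * T - T)) atTop (𝓝 0) := by
  have hq1 : ∀ n, ‖P n - 1‖ ≤ 1 := fun n => by
    rw [norm_sub_rev]; exact norm_one_sub_le_one (hs n) (hi n)
  have hq0 : ∀ x, Tendsto (fun n => (P n - 1) x) atTop (𝓝 0) := fun x => by
    simpa using (hlim x).sub_const x
  choose ζ hζ using exists_isCoordinate Ω
  set χ : ℕ → BL2 Ω := fun m => chi Ω (measurableSet_ball (x := (0 : ℂ)) (ε := m)) with hχ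
  have hχn : ∀ m, ‖χ m‖ ≤ 1 := fun m => norm_chi_le _
  -- The `Z m` are compressions of what would be the commutator of `T` with the coordinate. They are
  -- consistent with each other and bounded by `L(T)` in Hilbert-Schmidt norm.
  set Z : ℕ → BL2 Ω := fun m => χ m * (mulOp (ζ m) * T - T * mulOp (ζ m)) * χ m with hZ
  have hχζ : ∀ m m', m ≤ m' → mulOp (ζ m) * χ m = mulOp (ζ m') * χ m := by
    intro m m' hm
    ext1 x
    refine Lp.ext ?_
    rw [mul_apply_eq_comp, mul_apply_eq_comp]
    filter_upwards [mulOp_apply_ae (ζ m) (χ m x), mulOp_apply_ae (ζ m') (χ m x),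
      chi_apply_ae measurableSet_ball x, (hζ m).2.2, (hζ m').2.2] with z h1 h2 h3 h4 h5
    rw [h1, h2, h3]
    by_cases hz : z ∈ Metric.ball (0 : ℂ) m
    · rw [h4 hz, h5 (Metric.ball_subset_ball (by exact_mod_cast hm) hz)]
    · rw [Set.indicator_of_notMem hz, mul_zero, mul_zero]
  have hχζ' : ∀ m m', m ≤ m' → χ m * mulOp (ζ m) = χ m * mulOp (ζ m') := fun m m' hm => by
    rw [(commute_chi_mulOp _ _).eq, (commute_chi_mulOp _ _).eq]
    exact hχζ m m' hm
  have hZcomp : ∀ m m', m ≤ m' → χ m * Z m' * χ m = Z m := by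
    intro m m' hm
    have h1 : χ m * χ m' = χ m :=
      chi_mul_chi_of_subset _ _ (Metric.ball_subset_ball (by exact_mod_cast hm))
    have h2 : χ m' * χ m = χ m :=
      chi_mul_chi_of_subset' _ _ (Metric.ball_subset_ball (by exact_mod_cast hm))
    have e : χ m * Z m' * χ m
        = (χ m * χ m') * (mulOp (ζ m') * T - T * mulOp (ζ m')) * (χ m' * χ m) := by
      simp only [hZ, mul_assoc]
    rw [e, h1, h2]
    simp only [hZ, mul_sub, sub_mul, ← mul_assoc]
    rw [hχζ' m m' hm, mul_assoc _ (mulOp (ζ m')) (χ m), ← hχζ m m' hm, mul_assoc _ (mulOp (ζ m))]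
  have hZL : ∀ m, hsNorm (Z m) ≤ lipL T := fun m =>
    (hsNorm_mul_le_right (hχn m) _).trans ((hsNorm_mul_le_left (hχn m) _).trans
      (hsNorm_le_lipL T _ (hζ m).1 (hζ m).2.1))
  rw [ENNReal.tendsto_nhds_zero]
  intro ε hε
  -- Three errors of size `η` arise, and the comparison with the coordinate doubles them.
  set η := min (ε / 6) 1 with hη
  have hη0 : 0 < η := lt_min (ENNReal.div_pos hε.ne' (by norm_num)) one_pos
  have hηtop : η ≠ ∞ := ((min_le_right _ _).trans_lt ENNReal.one_lt_top).ne
  -- A nearly maximal `Z m0` is within `η` of all later `Z m` by Pythagoras. One fixed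
  -- Hilbert-Schmidt operator thus replaces the whole sequence, and strong convergence can be
  -- applied to it.
  obtain ⟨m0, hm0⟩ : ∃ m0, ∀ m, hsSq (Z m) ≤ hsSq (Z m0) + η ^ 2 := by
    have hsup : (⨆ m, hsSq (Z m)) ≠ ∞ := by
      refine ((iSup_le fun m => ?_).trans_lt (ENNReal.pow_lt_top (n := 2) hT)).ne
      rw [← hsNorm_sq]
      gcongr
      exact hZL m
    by_cases hz : (⨆ m, hsSq (Z m)) = 0
    · exact ⟨0, fun m => ((le_iSup (fun m => hsSq (Z m)) m).trans hz.le).trans zero_le⟩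
    · obtain ⟨m0, hm0⟩ := lt_iSup_iff.1
        (ENNReal.sub_lt_self hsup hz (pow_ne_zero 2 hη0.ne'))
      exact ⟨m0, fun m => (le_iSup (fun m => hsSq (Z m)) m).trans
        (tsub_le_iff_right.1 hm0.le)⟩
  have hclose : ∀ m, m0 ≤ m → hsNorm (Z m - Z m0) ≤ η := by
    intro m hm
    rw [hsNorm_le_iff_hsSq_le]
    have h1 := hsSq_compression_add (p := χ m0) (star_chi _) (chi_mul_self _) (Z m)
    rw [hZcomp m0 m hm] at h1
    have h2 : hsSq (Z m0) ≠ ∞ :=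
      ((hsNorm_lt_top_iff _).1 ((hZL m0).trans_lt hT)).ne
    refine (ENNReal.add_le_add_iff_left h2).1 ?_
    rw [h1]
    exact hm0 m
  have hev1 : ∀ᶠ n in atTop, lipL (P n) * ‖T‖ₑ ≤ η := by
    have := ENNReal.Tendsto.mul_const (b := ‖T‖ₑ) hL (Or.inr enorm_ne_top)
    rw [zero_mul] at this
    exact this.eventually_le_const hη0
  have hev2 : ∀ᶠ n in atTop, hsNorm ((P n - 1) * Z m0) ≤ η :=
    (tendsto_hsNorm_mul ((hZL m0).trans_lt hT) hq1 hq0).eventually_le_const hη0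
  filter_upwards [hev1, hev2] with n h1 h2
  have hX : lipL (P n * T - T) < ∞ :=
    (EAlg Ω).sub_mem ((EAlg Ω).mul_mem (hfin n) hT) hT
  have hcoord : ∀ m, m0 ≤ m → hsNorm (χ m * (mulOp (ζ m) * (P n * T - T)
      - (P n * T - T) * mulOp (ζ m)) * χ m) ≤ η + (η + η) := by
    intro m hm
    -- Commutation of `P n` with the indicators of the balls turns the compression of `(P n - 1) [ζ
    -- m, T]` into `(P n - 1) * Z m`.
    have hc : χ m * (P n - 1) = (P n - 1) * χ m :=
      ((hcomm n m).sub_right (Commute.one_right _)).eq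
    have e : χ m * (mulOp (ζ m) * (P n * T - T) - (P n * T - T) * mulOp (ζ m)) * χ m
        = χ m * ((mulOp (ζ m) * P n - P n * mulOp (ζ m)) * T) * χ m
          + ((P n - 1) * Z m0 + (P n - 1) * (Z m - Z m0)) := by
      rw [← mul_add, add_sub_cancel]
      have : (P n - 1) * Z m
          = χ m * ((P n - 1) * (mulOp (ζ m) * T - T * mulOp (ζ m))) * χ m := by
        simp only [hZ]
        rw [← mul_assoc, ← mul_assoc, ← hc, ← mul_assoc]
      rw [this, ← add_mul, ← mul_add]
      congr 2
      noncomm_ring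
    rw [e]
    refine (hsNorm_add_le _ _).trans (add_le_add ?_ ((hsNorm_add_le _ _).trans
      (add_le_add h2 ((hsNorm_mul_le_left (hq1 n) _).trans (hclose m hm)))))
    refine (hsNorm_mul_le_right (hχn m) _).trans ((hsNorm_mul_le_left (hχn m) _).trans
      ((hsNorm_mul_le' _ _).trans (le_trans ?_ h1)))
    gcongr
    exact hsNorm_le_lipL _ _ (hζ m).1 (hζ m).2.1
  have hfinal : lipL (P n * T - T) ≤ 2 * (η + (η + η)) := by
    refine iSup₂_le fun f hf => hsNorm_le_of_eventually_compression hχn tendsto_chi_ball ?_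
    filter_upwards [eventually_ge_atTop m0] with m hm
    refine (hsNorm_commutator_le_coordinate hX hf.1 hf.2 (hζ m)).trans ?_
    gcongr
    exact hcoord m hm
  refine hfinal.trans ?_
  have h6 : 2 * (η + (η + η)) = 6 * η := by ring
  rw [h6]
  calc 6 * η ≤ 6 * (ε / 6) := by gcongr; exact min_le_left _ _
    _ = ε := ENNReal.mul_div_cancel (by norm_num) (by norm_num)

end Approximation

/-! ### Restriction to a ball and extension by zero. -/

section Inclusion

variable {Ω : Set ℂ}

theorem chi_eq_one_of_subset {A : Set ℂ} (hΩ : MeasurableSet Ω) (hA : MeasurableSet A)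
    (h : Ω ⊆ A) : chi Ω hA = 1 := by
  ext1 x
  refine Lp.ext ?_
  filter_upwards [chi_apply_ae hA x, ae_restrict_mem hΩ] with z h1 h2
  rw [h1, Set.indicator_of_mem (h h2), one_apply_eq_self]

theorem extendL2_restrictL2 (hΩ : MeasurableSet Ω) {A : Set ℂ} (hA : MeasurableSet A) (x : L2 Ω) :
    extendL2 (Set.inter_subset_left : Ω ∩ A ⊆ Ω) (restrictL2 Set.inter_subset_left x)
      = chi Ω hA x := by
  have hm : MeasurableSet (Ω ∩ A) := hΩ.inter hA
  have h0 := restrictL2_apply_ae (Set.inter_subset_left : Ω ∩ A ⊆ Ω) x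
  have hr : (leb Ω).restrict (Ω ∩ A) = leb (Ω ∩ A) :=
    Measure.restrict_restrict_of_subset Set.inter_subset_left
  have h0' : ∀ᵐ z ∂(leb Ω).restrict (Ω ∩ A),
      restrictL2 (Set.inter_subset_left : Ω ∩ A ⊆ Ω) x z = x z := hr.symm ▸ h0
  refine Lp.ext ?_
  filter_upwards [extendL2_apply_ae (Set.inter_subset_left : Ω ∩ A ⊆ Ω) hm
    (restrictL2 Set.inter_subset_left x), chi_apply_ae hA x, ae_imp_of_ae_restrict h0',
    ae_restrict_mem hΩ] with z h1 h2 h3 h4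
  rw [h1, h2]
  by_cases hz : z ∈ A
  · rw [Set.indicator_of_mem (show z ∈ Ω ∩ A from ⟨h4, hz⟩), Set.indicator_of_mem hz, h3 ⟨h4, hz⟩]
  · rw [Set.indicator_of_notMem (fun h => hz h.2), Set.indicator_of_notMem hz]

end Inclusion

end LipAlg

end

noncomputable section

namespace LipAlg

variable {Ω : Set ℂ}

/-- An operator of finite rank that lives on a ball comes from `EΛ(Ω ∩ n𝔻)`. -/
theorem exists_inclOp_eq (hΩ : MeasurableSet Ω) {P : BL2 Ω} {n : ℕ}
    (hfin : FiniteDimensional ℂ P.range)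
    (h1 : chi Ω (measurableSet_ball (x := (0 : ℂ)) (ε := n)) * P = P)
    (h2 : P * chi Ω (measurableSet_ball (x := (0 : ℂ)) (ε := n)) = P) :
    ∃ T ∈ EAlg (Ω ∩ Metric.ball (0 : ℂ) n), P = inclOp Set.inter_subset_left T := by
  have hm : MeasurableSet (Ω ∩ Metric.ball (0 : ℂ) n) := hΩ.inter measurableSet_ball
  refine ⟨restrictL2 Set.inter_subset_left ∘L P ∘L extendL2 Set.inter_subset_left, ?_, ?_⟩
  · have hone : chi (Ω ∩ Metric.ball (0 : ℂ) n)
        (measurableSet_ball (x := (0 : ℂ)) (ε := n)) = 1 :=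
      chi_eq_one_of_subset hm measurableSet_ball Set.inter_subset_right
    exact lipL_lt_top_of_hsNorm_lt_top (n := n)
      (hsNorm_lt_top_of_finiteDimensional_range (finiteDimensional_range_of_comp hfin _ _))
      (by rw [hone, one_mul]) (by rw [hone, mul_one])
  · have hc : extendL2 (Set.inter_subset_left : Ω ∩ Metric.ball (0 : ℂ) n ⊆ Ω)
        ∘L restrictL2 Set.inter_subset_left
        = chi Ω (measurableSet_ball (x := (0 : ℂ)) (ε := n)) := by
      ext1 x
      exact extendL2_restrictL2 hΩ measurableSet_ball x
    have e : inclOp (Set.inter_subset_left : Ω ∩ Metric.ball (0 : ℂ) n ⊆ Ω)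
        (restrictL2 Set.inter_subset_left ∘L P ∘L extendL2 Set.inter_subset_left)
        = (extendL2 (Set.inter_subset_left : Ω ∩ Metric.ball (0 : ℂ) n ⊆ Ω)
          ∘L restrictL2 Set.inter_subset_left) * P * (extendL2
          (Set.inter_subset_left : Ω ∩ Metric.ball (0 : ℂ) n ⊆ Ω)
          ∘L restrictL2 Set.inter_subset_left) := by
      ext1 x
      simp only [inclOp, ContinuousLinearMap.comp_apply, mul_apply_eq_comp]
    rw [e, hc, h1, h2]

end LipAlg

end

noncomputable section

namespace LipAlg

/-! ### The norm `|||·|||` and adjoints. -/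

variable {Ω : Set ℂ}

theorem lipL_neg_le (T : BL2 Ω) : lipL (-T) ≤ lipL T := by
  refine iSup₂_le fun f hf => ?_
  have e : mulOp f * -T - -T * mulOp f = -(mulOp f * T - T * mulOp f) := by noncomm_ring
  rw [e, hsNorm_neg]
  exact hsNorm_le_lipL T f hf.1 hf.2

theorem lipL_neg (T : BL2 Ω) : lipL (-T) = lipL T :=
  le_antisymm (lipL_neg_le T) (by simpa using lipL_neg_le (-T))

theorem lipL_star (T : BL2 Ω) : lipL (star T) = lipL T :=
  le_antisymm (lipL_star_le T) (by simpa using lipL_star_le (star T))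

theorem triNorm_add_le (S T : EAlg Ω) : triNorm (S + T) ≤ triNorm S + triNorm T := by
  calc triNorm (S + T) ≤ (‖(S : BL2 Ω)‖ₑ + ‖(T : BL2 Ω)‖ₑ)
        + (lipL (S : BL2 Ω) + lipL (T : BL2 Ω)) :=
        add_le_add (enorm_add_le (S : BL2 Ω) (T : BL2 Ω)) (lipL_add_le _ _)
    _ = triNorm S + triNorm T := add_add_add_comm _ _ _ _

theorem triNorm_neg (T : EAlg Ω) : triNorm (-T) = triNorm T :=
  congrArg₂ (· + ·) (enorm_neg (T : BL2 Ω)) (lipL_neg (T : BL2 Ω))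

theorem triNorm_star (T : EAlg Ω) : triNorm (star T) = triNorm T :=
  congrArg₂ (· + ·) (enorm_star_op (T : BL2 Ω)) (lipL_star (T : BL2 Ω))

theorem triNorm_mul_le (S T : EAlg Ω) : triNorm (S * T) ≤ triNorm S * triNorm T := by
  have h1 : ‖(S : BL2 Ω) * T‖ₑ ≤ ‖(S : BL2 Ω)‖ₑ * ‖(T : BL2 Ω)‖ₑ := by
    rw [← ofReal_norm, ← ofReal_norm, ← ofReal_norm, ← ENNReal.ofReal_mul (norm_nonneg _)]
    exact ENNReal.ofReal_le_ofReal (norm_mul_le _ _)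
  calc triNorm (S * T) ≤ ‖(S : BL2 Ω)‖ₑ * ‖(T : BL2 Ω)‖ₑ
        + (lipL (S : BL2 Ω) * ‖(T : BL2 Ω)‖ₑ + ‖(S : BL2 Ω)‖ₑ * lipL (T : BL2 Ω)) :=
        add_le_add h1 (lipL_mul_le _ _)
    _ ≤ ‖(S : BL2 Ω)‖ₑ * ‖(T : BL2 Ω)‖ₑ
        + (lipL (S : BL2 Ω) * ‖(T : BL2 Ω)‖ₑ + ‖(S : BL2 Ω)‖ₑ * lipL (T : BL2 Ω))
        + lipL (S : BL2 Ω) * lipL (T : BL2 Ω) := le_self_add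
    _ = triNorm S * triNorm T := by rw [triNorm, triNorm]; ring

/-- By compactness `(1 - P n) T → 0` in norm, so taking adjoints shows that `T*` is the norm limit
of the finite rank operators `T* P n`. -/
theorem isCompactOperator_star {H : Type*} [NormedAddCommGroup H] [InnerProductSpace ℂ H]
    [CompleteSpace H] {T : H →L[ℂ] H} {P : ℕ → H →L[ℂ] H} (hT : IsCompactOperator T)
    (hs : ∀ n, star (P n) = P n) (hi : ∀ n, P n * P n = P n)
    (hfin : ∀ n, FiniteDimensional ℂ (P n).range)
    (hlim : ∀ x, Tendsto (fun n => P n x) atTop (𝓝 x)) :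
    IsCompactOperator (star T : H →L[ℂ] H) := by
  have hq1 : ∀ n, ‖1 - P n‖ ≤ 1 := fun n => norm_one_sub_le_one (hs n) (hi n)
  have hq0 : ∀ x, Tendsto (fun n => (1 - P n) x) atTop (𝓝 0) := fun x => by
    simpa using (hlim x).const_sub x
  have h := tendsto_enorm_mul_of_isCompactOperator hT hq1 hq0
  have h2 : Tendsto (fun n => star T * P n) atTop (𝓝 (star T)) := by
    rw [tendsto_iff_edist_tendsto_0]
    refine h.congr fun n => ?_
    rw [edist_comm, edist_eq_enorm_sub, ← enorm_star_op]
    congr 1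
    rw [star_mul, star_sub, star_one, hs, mul_sub, mul_one]
  exact isCompactOperator_of_tendsto h2 (Eventually.of_forall fun n =>
    (isCompactOperator_of_finiteDimensional_range (hfin n)).clm_comp (star T))

end LipAlg

end

noncomputable section

namespace LipAlg

/-! ### The algebra of corners and the approximate unit. -/

variable {Ω : Set ℂ}

/-- The union of the corners `P n B(L²(Ω)) P n`, as a subalgebra of `EΛ(Ω)`. -/
def cornerUnion (P : ℕ → BL2 Ω) (hmul : ∀ n m, n ≤ m → P m * P n = P n)
    (hmul' : ∀ n m, n ≤ m → P n * P m = P n) : NonUnitalSubalgebra ℂ (EAlg Ω) where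
  carrier := {T | ∃ n, P n * (T : BL2 Ω) * P n = T}
  zero_mem' := ⟨0, by simp⟩
  add_mem' := by
    have lift : ∀ {n m : ℕ} {T : BL2 Ω}, n ≤ m → P n * T * P n = T → P m * T * P m = T := by
      intro n m T h hT
      rw [← hT, ← mul_assoc, ← mul_assoc, hmul n m h, mul_assoc _ (P n) (P m), hmul' n m h]
    rintro S T ⟨n, hn⟩ ⟨m, hm⟩
    refine ⟨max n m, ?_⟩
    change P _ * ((S : BL2 Ω) + T) * P _ = S + T
    rw [mul_add, add_mul, lift (le_max_left n m) hn, lift (le_max_right n m) hm]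
  mul_mem' := by
    have liftL : ∀ {n m : ℕ} {T : BL2 Ω}, n ≤ m → P n * T * P n = T → P m * T = T := by
      intro n m T h hT
      rw [← hT, ← mul_assoc, ← mul_assoc, hmul n m h]
    have liftR : ∀ {n m : ℕ} {T : BL2 Ω}, n ≤ m → P n * T * P n = T → T * P m = T := by
      intro n m T h hT
      rw [← hT, mul_assoc, hmul' n m h]
    rintro S T ⟨n, hn⟩ ⟨m, hm⟩
    refine ⟨max n m, ?_⟩
    change P _ * ((S : BL2 Ω) * T) * P _ = S * T
    rw [← mul_assoc, liftL (le_max_left n m) hn, mul_assoc, liftR (le_max_right n m) hm]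
  smul_mem' := by
    rintro c T ⟨n, hn⟩
    refine ⟨n, ?_⟩
    change P n * (c • (T : BL2 Ω)) * P n = c • (T : BL2 Ω)
    rw [mul_smul_comm, smul_mul_assoc, hn]

/-- Compactness of `T` enters only in the operator norm part; the part with `L` holds on all of
`EΛ(Ω)`. Multiplication from the right is reduced to the left by taking adjoints. -/
theorem tendsto_triNorm_approximate_unit {P : ℕ → EAlg Ω}
    (hs : ∀ n, star (P n : BL2 Ω) = P n) (hi : ∀ n, (P n : BL2 Ω) * P n = P n)
    (hfin : ∀ n, FiniteDimensional ℂ (P n : BL2 Ω).range)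
    (hlim : ∀ x, Tendsto (fun n => (P n : BL2 Ω) x) atTop (𝓝 x))
    (hL : Tendsto (fun n => lipL (P n : BL2 Ω)) atTop (𝓝 0))
    (hcomm : ∀ n m : ℕ, Commute (chi Ω (measurableSet_ball (x := (0 : ℂ)) (ε := m)))
      (P n : BL2 Ω)) {T : EAlg Ω} (hT : T ∈ KIdeal Ω) :
    Tendsto (fun n => triNorm (P n * T - T)) atTop (𝓝 0) ∧
      Tendsto (fun n => triNorm (T * P n - T)) atTop (𝓝 0) := by
  have left : ∀ {T : EAlg Ω}, IsCompactOperator (T : BL2 Ω) →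
      Tendsto (fun n => triNorm (P n * T - T)) atTop (𝓝 0) := by
    intro T hT
    have h1 : Tendsto (fun n => ‖((P n : BL2 Ω) - 1) * T‖ₑ) atTop (𝓝 0) :=
      tendsto_enorm_mul_of_isCompactOperator hT
        (fun n => by rw [norm_sub_rev]; exact norm_one_sub_le_one (hs n) (hi n))
        (fun x => by simpa using (hlim x).sub_const x)
    have h2 := tendsto_lipL_mul_sub hs hi hlim hL (fun n => (P n).2) hcomm T.2
    have h3 := h1.add h2
    rw [add_zero] at h3
    refine h3.congr fun n => ?_
    rw [sub_mul, one_mul]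
    rfl
  rw [mem_KIdeal] at hT
  refine ⟨left hT, ?_⟩
  have h : IsCompactOperator ((star T : EAlg Ω) : BL2 Ω) :=
    isCompactOperator_star hT hs hi hfin hlim
  refine (left h).congr fun n => ?_
  rw [← triNorm_star]
  congr 1
  have hsn : star (P n) = P n := Subtype.ext (hs n)
  rw [star_sub, star_mul, star_star, hsn]

end LipAlg

end



theorem mainTheorem8 (Ω : Set ℂ) (hΩ : MeasurableSet Ω) :
    ∃ P : ℕ → LipAlg.EAlg Ω,
      -- finite rank self-adjoint projections in `KΛ(Ω)`
      (∀ n, P n ∈ LipAlg.KIdeal Ω) ∧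
      (∀ n, IsStarProjection (P n : LipAlg.BL2 Ω)) ∧
      (∀ n, FiniteDimensional ℂ (P n : LipAlg.BL2 Ω).range) ∧
      -- `P n ↑ I`
      (Monotone fun n => (P n : LipAlg.BL2 Ω)) ∧
      (∀ x : LipAlg.L2 Ω, Tendsto (fun n => (P n : LipAlg.BL2 Ω) x) atTop (𝓝 x)) ∧
      -- `L(P n) → 0`
      Tendsto (fun n => LipAlg.lipL (P n : LipAlg.BL2 Ω)) atTop (𝓝 0) ∧
      -- `P n` lies in the image of `EΛ(Ω ∩ n𝔻)`
      (∀ n : ℕ, ∃ T ∈ LipAlg.EAlg (Ω ∩ Metric.ball (0 : ℂ) n),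
        (P n : LipAlg.BL2 Ω) = LipAlg.inclOp Set.inter_subset_left T) ∧
      -- `P n` commutes with multiplication by the indicator function of `Ω ∩ m𝔻`
      (∀ n m : ℕ, Commute (P n : LipAlg.BL2 Ω)
        (LipAlg.mulOp (LipAlg.indLinf Ω (Metric.ball (0 : ℂ) m) measurableSet_ball))) ∧
      -- `(P n)` is a bounded approximate unit of `KΛ(Ω)`
      (∃ C : ℝ≥0, ∀ n, LipAlg.triNorm (P n) ≤ C) ∧
      (∀ T ∈ LipAlg.KIdeal Ω,
        Tendsto (fun n => LipAlg.triNorm (P n * T - T)) atTop (𝓝 0) ∧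
        Tendsto (fun n => LipAlg.triNorm (T * P n - T)) atTop (𝓝 0)) ∧
      -- the union of the `P n B(L²(Ω)) P n` is a dense subalgebra of `KΛ(Ω)`
      (∃ D : NonUnitalSubalgebra ℂ (LipAlg.EAlg Ω),
        (fun T : LipAlg.EAlg Ω => (T : LipAlg.BL2 Ω)) '' (D : Set (LipAlg.EAlg Ω)) =
          ⋃ n, Set.range (fun S : LipAlg.BL2 Ω => (P n : LipAlg.BL2 Ω) * S * P n) ∧
        (∀ S ∈ D, S ∈ LipAlg.KIdeal Ω) ∧
        ∀ T ∈ LipAlg.KIdeal Ω, ∀ ε : ℝ≥0∞, 0 < ε →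
          ∃ S ∈ D, LipAlg.triNorm (T - S) < ε) := by
  obtain ⟨P, hs, hi, hfin, hstep, hlim, hLb, hchi, hcomm⟩ := LipAlg.exists_projection_sequence Ω
  have hmul : ∀ n m, n ≤ m → P m * P n = P n := by
    intro n m h
    induction m, h using Nat.le_induction with
    | base => exact hi n
    | succ m _ ih => rw [← ih, ← mul_assoc, hstep]
  have hmul' : ∀ n m, n ≤ m → P n * P m = P n := by
    intro n m h
    have := congrArg star (hmul n m h)
    rwa [star_mul, hs, hs] at this
  have hLt : ∀ n, LipAlg.lipL (P n) < ∞ := fun n => (hLb n).trans_lt ENNReal.ofReal_lt_top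
  have hL : Tendsto (fun n => LipAlg.lipL (P n)) atTop (𝓝 0) := by
    refine tendsto_of_tendsto_of_tendsto_of_le_of_le tendsto_const_nhds ?_
      (fun n => zero_le) hLb
    simpa using ENNReal.tendsto_ofReal (tendsto_one_div_add_atTop_nhds_zero_nat (𝕜 := ℝ))
  have hproj : ∀ n, IsStarProjection (P n) := fun n => ⟨hi n, hs n⟩
  have hchi' : ∀ n : ℕ, P n * LipAlg.chi Ω (measurableSet_ball (x := (0 : ℂ)) (ε := n)) = P n :=
    fun n => ((hcomm n n).eq).symm.trans (hchi n)
  have hnorm : ∀ n, ‖P n‖ₑ ≤ 1 := fun n => by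
    rw [← ofReal_norm]
    exact ENNReal.ofReal_le_one.2 (LipAlg.norm_le_one_of_idem (hs n) (hi n))
  set Q : ℕ → LipAlg.EAlg Ω := fun n => ⟨P n, hLt n⟩ with hQ
  have hbound : ∀ n, LipAlg.triNorm (Q n) ≤ (2 : ℝ≥0) := by
    intro n
    have h1 : LipAlg.lipL (P n) ≤ 1 := (hLb n).trans (ENNReal.ofReal_le_one.2 (by
      rw [div_le_one (by positivity)]
      linarith [(Nat.cast_nonneg n : (0 : ℝ) ≤ n)]))
    calc LipAlg.triNorm (Q n) ≤ 1 + 1 := add_le_add (hnorm n) h1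
      _ = ((2 : ℝ≥0) : ℝ≥0∞) := by norm_num
  have hunit : ∀ T ∈ LipAlg.KIdeal Ω,
      Tendsto (fun n => LipAlg.triNorm (Q n * T - T)) atTop (𝓝 0) ∧
      Tendsto (fun n => LipAlg.triNorm (T * Q n - T)) atTop (𝓝 0) := fun T hT =>
    LipAlg.tendsto_triNorm_approximate_unit (P := Q) hs hi hfin hlim hL hcomm hT
  have hcorner : ∀ n (S : LipAlg.BL2 Ω), FiniteDimensional ℂ (P n * S * P n).range := fun n S =>
    LipAlg.finiteDimensional_range_of_comp (hfin n) 1 (S * P n)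
  refine ⟨Q, fun n => (LipAlg.mem_KIdeal _).2
    (LipAlg.isCompactOperator_of_finiteDimensional_range (hfin n)), hproj, hfin,
    monotone_nat_of_le_succ fun n => (hproj n).le_of_mul_eq_right (hproj (n + 1)) (hstep n),
    hlim, hL, fun n => LipAlg.exists_inclOp_eq hΩ (hfin n) (hchi n) (hchi' n),
    fun n m => (hcomm n m).symm, ⟨2, hbound⟩, hunit,
    LipAlg.cornerUnion P hmul hmul', ?_, ?_, ?_⟩
  · ext S
    simp only [Set.mem_image, Set.mem_iUnion, Set.mem_range, SetLike.mem_coe]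
    constructor
    · rintro ⟨T, ⟨n, hn⟩, rfl⟩
      exact ⟨n, T, hn⟩
    · rintro ⟨n, S, rfl⟩
      -- For an arbitrary bounded `S` the corner has finite rank and is supported in the ball of
      -- radius `n`, hence it belongs to `EΛ(Ω)`.
      have hmem : LipAlg.lipL (P n * S * P n) < ∞ :=
        LipAlg.lipL_lt_top_of_hsNorm_lt_top (n := n)
          (LipAlg.hsNorm_lt_top_of_finiteDimensional_range (hcorner n S))
          (by rw [← mul_assoc, ← mul_assoc, hchi]) (by rw [mul_assoc, hchi'])
      refine ⟨⟨P n * S * P n, hmem⟩, ⟨n, ?_⟩, rfl⟩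
      change P n * (P n * S * P n) * P n = P n * S * P n
      rw [← mul_assoc, ← mul_assoc, hi, mul_assoc _ (P n), hi]
  · rintro S ⟨n, hn⟩
    rw [LipAlg.mem_KIdeal, ← hn]
    exact LipAlg.isCompactOperator_of_finiteDimensional_range (hcorner n S)
  · intro T hT ε hε
    obtain ⟨h1, h2⟩ := hunit T hT
    -- The factor `2` is the uniform bound for `|||Q n|||`, needed for the term `Q n * (T * Q n -
    -- T)` below.
    have h3 : Tendsto (fun n => LipAlg.triNorm (Q n * T - T)
        + 2 * LipAlg.triNorm (T * Q n - T)) atTop (𝓝 0) := by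
      simpa using h1.add (ENNReal.Tendsto.const_mul h2 (Or.inr ENNReal.ofNat_ne_top))
    obtain ⟨n, hn⟩ := (h3.eventually_lt_const hε).exists
    have hQi : Q n * Q n = Q n := Subtype.ext (hi n)
    refine ⟨Q n * T * Q n, ⟨n, ?_⟩, lt_of_le_of_lt ?_ hn⟩
    · change P n * (P n * (T : LipAlg.BL2 Ω) * P n) * P n = P n * (T : LipAlg.BL2 Ω) * P n
      rw [← mul_assoc, ← mul_assoc, hi, mul_assoc _ (P n), hi]
    · have e : T - Q n * T * Q n = -((Q n * T - T) + Q n * (T * Q n - T)) := by noncomm_ring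
      rw [e, LipAlg.triNorm_neg]
      refine (LipAlg.triNorm_add_le _ _).trans (add_le_add_right
        ((LipAlg.triNorm_mul_le _ _).trans ?_) _)
      gcongr
      exact hbound n
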